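/- All categories are small, and monoidal categories and functors are strict; composition is written in diagrammatic order and traces are taken on the left, \(\mathsf{tr}_S\colon \mathcal C(S\oplus X,S\oplus Y)\to\mathcal C(X,Y)\). Definitions. A signature is a directed graph: its vertices are sorts, its edges are generators, each with one sort as arity and one sort as coarity; \(\mathbf{Sig}\) is the category of signatures and graph morphisms. A finite biproduct category (\(\mathbf{FBCat}\)) is a symmetric monoidal category \((\mathcal C,\oplus,0)\) with a commutative monoid \((\nabla_X\colon X\oplus X\to X,\ e_X\colon 0\to X)\) and a cocommutative comonoid \((\Delta_X\colon X\to X\oplus X,\ !_X\colon X\to 0)\) on each object, coherent with \(\oplus,0\) and natural in all arrows; morphisms are symmetric monoidal functors preserving these monoids and comonoids. Convolution is \(f\sqcup g=\Delta;(f\oplus g);\nabla\). It has idempotent convolution (\(\mathbf{FIBCat}\)) if it is poset enriched (composition and \(\oplus\) are monotone) and \(\Delta;\nabla\le\mathrm{id}\), \(\mathrm{id}\le\nabla;\Delta\), \(!_X;e_X\le\mathrm{id}\), \(\mathrm{id}\le e_X;!_X\); morphisms moreover preserve the order. \(\mathbf{UTFIBCat}\) has as objects the finite biproduct categories with idempotent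 convolution that carry a monoidal trace which is uniform: \(f;(r\oplus\mathrm{id}_Y)=(r\oplus\mathrm{id}_X);g\) implies \(\mathsf{tr}_Sf=\mathsf{tr}_Tg\), for \(f\colon S\oplus X\to S\oplus Y\), \(g\colon T\oplus X\to T\oplus Y\), \(r\colon S\to T\); morphisms moreover preserve the trace. A Kleene bicategory (\(\mathbf{KBicat}\)) is a finite biproduct category with idempotent convolution and a monoidal trace such that \(\mathsf{tr}_X(\nabla_X;\Delta_X)\le \mathrm{id}_X\) and such that, for \(f,g\) as above, \(\mathsf{tr}_Sf\le\mathsf{tr}_Tg\) holds whenever \(f;(r\oplus \mathrm{id}_Y)\le(r\oplus \mathrm{id}_X);g\) for some \(r\colon S\to T\), or \((r\oplus \mathrm{id}_X);f\le g;(r\oplus \mathrm{id}_Y)\) for some \(r\colon T\to S\); morphisms moreover preserve the trace. Every Kleene bicategory is uniformly traced. Theorem. The functor \(\mathbf{KBicat}\to\mathbf{Sig}\) sending a Kleene bicategory to its underlying graph has a left adjoint, which sends a signature \(\Sigma\) to the free Kleene bicategory \(\mathcal K_\Sigma\) on \(\Sigma\). More precisely, there are adjunctions \[M\dashv U_M,\quad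 Q_{\mathrm{id}}\dashv \iota_{\mathrm{id}},\quad \mathrm{UTr}\dashv U_{T},\quad Q_K\dashv\iota_K,\qquad \mathbf{Sig}\xrightarrow{M}\mathbf{FBCat}\xrightarrow{Q_{\mathrm{id}}}\mathbf{FIBCat}\xrightarrow{\mathrm{UTr}}\mathbf{UTFIBCat}\xrightarrow{Q_K}\mathbf{KBicat},\] where the right adjoints are the forgetful functors and inclusions, whose composite is the required adjunction and which are given as follows. (1) \(M(\Sigma)\) is the matrix construction on the free category on \(\Sigma\), and the unit is the canonical embedding: objects are the finite formal sums of sorts, and the arrows between two sorts are the finite formal sums (finite multisets) of paths of generators, addition being convolution (so arrows between formal sums are matrices of such). (2) \(Q_{\mathrm{id}}(\mathcal C)\) has the objects of \(\mathcal C\) and is the quotient of its hom-sets by the least congruence for \(;\) and \(\oplus\) with \(\Delta_X;\nabla_X\sim\mathrm{id}_X\) for all \(X\); the unit is the quotient functor. (3) \(\mathrm{UTr}(\mathcal C)\) has the objects of \(\mathcal C\); its arrows \(X\to Y\) are the classes of pairs \((f\mid S)\) with \(f\colon S\oplus X\to S\oplus Y\) in \(\mathcal C\), representing the trace of the image of \(f\)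 under the unit, for the least congruence for \(;\), \(\oplus\) and trace of such pairs that contains sliding, \((f;(u\oplus\mathrm{id})\mid T)\sim((u\oplus\mathrm{id});f\mid S)\) for \(u\colon S\to T\), \(f\colon T\oplus X\to S\oplus Y\), and yanking, \((\sigma_{S,S}\mid S)\sim(\mathrm{id}_S\mid 0)\), and satisfies uniformity: for pairs \(u,v\colon S\to T\), \(f\), \(g\), if \(u\sim v\) and \(f;(u\oplus\mathrm{id})\sim(v\oplus\mathrm{id});g\) then \(\mathsf{tr}_Sf\sim\mathsf{tr}_Tg\). (4) \(Q_K(\mathcal C)\) has the objects of \(\mathcal C\) and is the quotient of its hom-sets by the Kleene congruence; the unit is the quotient functor. The Kleene congruence is the least congruence \(\sim\) for \(;\), \(\oplus\) and trace such that, writing \(f\lesssim g\) for \(f\sqcup g\sim g\): \(\lesssim\) contains \(\le\), is transitive and is preserved by \(;\) and \(\oplus\); \(\mathsf{tr}_X(\nabla_X;\Delta_X)\lesssim\mathrm{id}_X\); and for \(u\sim v\colon S\to T\), \(f;(u\oplus\mathrm{id})\lesssim(v\oplus\mathrm{id});g\) implies \(\mathsf{tr}_Sf\lesssim\mathsf{tr}_Tg\),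 and \((v\oplus\mathrm{id});g\lesssim f;(u\oplus\mathrm{id})\) implies \(\mathsf{tr}_Tg\lesssim\mathsf{tr}_Sf\). -/

import Mathlib

open CategoryTheory MonoidalCategory

universe u

noncomputable section

namespace FreeKleene

/-! ## Strict symmetric monoidal categories

Monoidal categories are Mathlib's; the tensor product is the sum `⊕` and the unit is the zero
object `0`. Composition `f ≫ g` is in diagrammatic order. -/

section Structures

variable (C : Type u) [Category.{u} C] [MonoidalCategory C]

/-- A monoidal category is strict if its product is associative and unital on objects on the nose
and all structural isomorphisms are identities (up to these equalities of objects). -/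
class Strict : Prop where
  assoc_obj : ∀ X Y Z : C, (X ⊗ Y) ⊗ Z = X ⊗ (Y ⊗ Z)
  unit_obj : ∀ X : C, 𝟙_ C ⊗ X = X
  obj_unit : ∀ X : C, X ⊗ 𝟙_ C = X
  associator_eq : ∀ X Y Z : C, (α_ X Y Z).hom = eqToHom (assoc_obj X Y Z)
  leftUnitor_eq : ∀ X : C, (λ_ X).hom = eqToHom (unit_obj X)
  rightUnitor_eq : ∀ X : C, (ρ_ X).hom = eqToHom (obj_unit X)

/-- A finite biproduct category: a symmetric monoidal category in which every object carries a
commutative monoid and a cocommutative comonoid, coherently with the monoidal structure, and every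
arrow is a morphism of monoids and of comonoids. -/
class FinBiproduct [SymmetricCategory C] where
  codiag : ∀ X : C, X ⊗ X ⟶ X
  cobang : ∀ X : C, 𝟙_ C ⟶ X
  diag : ∀ X : C, X ⟶ X ⊗ X
  bang : ∀ X : C, X ⟶ 𝟙_ C
  -- commutative monoids
  codiag_assoc : ∀ X : C,
    (codiag X ▷ X) ≫ codiag X = (α_ X X X).hom ≫ (X ◁ codiag X) ≫ codiag X
  cobang_codiag : ∀ X : C, (cobang X ▷ X) ≫ codiag X = (λ_ X).hom
  braiding_codiag : ∀ X : C, (β_ X X).hom ≫ codiag X = codiag X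
  -- cocommutative comonoids
  diag_assoc : ∀ X : C,
    diag X ≫ (diag X ▷ X) ≫ (α_ X X X).hom = diag X ≫ (X ◁ diag X)
  diag_bang : ∀ X : C, diag X ≫ (bang X ▷ X) = (λ_ X).inv
  diag_braiding : ∀ X : C, diag X ≫ (β_ X X).hom = diag X
  -- coherence with the monoidal structure
  codiag_zero : codiag (𝟙_ C) = (λ_ (𝟙_ C)).hom
  codiag_sum : ∀ X Y : C, codiag (X ⊗ Y) = tensorμ X Y X Y ≫ (codiag X ⊗ₘ codiag Y)
  cobang_zero : cobang (𝟙_ C) = 𝟙 (𝟙_ C)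
  cobang_sum : ∀ X Y : C, cobang (X ⊗ Y) = (λ_ (𝟙_ C)).inv ≫ (cobang X ⊗ₘ cobang Y)
  diag_zero : diag (𝟙_ C) = (λ_ (𝟙_ C)).inv
  diag_sum : ∀ X Y : C, diag (X ⊗ Y) = (diag X ⊗ₘ diag Y) ≫ tensorμ X X Y Y
  bang_zero : bang (𝟙_ C) = 𝟙 (𝟙_ C)
  bang_sum : ∀ X Y : C, bang (X ⊗ Y) = (bang X ⊗ₘ bang Y) ≫ (λ_ (𝟙_ C)).hom
  -- naturality
  diag_natural : ∀ {X Y : C} (f : X ⟶ Y), f ≫ diag Y = diag X ≫ (f ⊗ₘ f)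
  bang_natural : ∀ {X Y : C} (f : X ⟶ Y), f ≫ bang Y = bang X
  codiag_natural : ∀ {X Y : C} (f : X ⟶ Y), codiag X ≫ f = (f ⊗ₘ f) ≫ codiag Y
  cobang_natural : ∀ {X Y : C} (f : X ⟶ Y), cobang X ≫ f = cobang Y


/-- A poset enrichment of a monoidal category: every hom-set is partially ordered, and composition
and the monoidal product are monotone. -/
class PosetEnriched where
  homOrder : ∀ X Y : C, PartialOrder (X ⟶ Y)
  comp_mono : ∀ {X Y Z : C} {f f' : X ⟶ Y} {g g' : Y ⟶ Z},
    f ≤ f' → g ≤ g' → f ≫ g ≤ f' ≫ g'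
  tensor_mono : ∀ {X Y X' Y' : C} {f f' : X ⟶ Y} {g g' : X' ⟶ Y'},
    f ≤ f' → g ≤ g' → (f ⊗ₘ g) ≤ (f' ⊗ₘ g')

attribute [reducible, instance] PosetEnriched.homOrder

/-- The comonoids `(diag, bang)` are right adjoint to the monoids `(codiag, cobang)`. -/
class AdjointBiproduct [SymmetricCategory C] [FinBiproduct C] [PosetEnriched C] : Prop where
  diag_codiag : ∀ X : C, FinBiproduct.diag X ≫ FinBiproduct.codiag X ≤ 𝟙 X
  codiag_diag : ∀ X : C, 𝟙 (X ⊗ X) ≤ FinBiproduct.codiag X ≫ FinBiproduct.diag X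
  bang_cobang : ∀ X : C, FinBiproduct.bang X ≫ FinBiproduct.cobang X ≤ 𝟙 X
  cobang_bang : ∀ X : C, 𝟙 (𝟙_ C) ≤ FinBiproduct.cobang X ≫ FinBiproduct.bang X

/-- A trace on a symmetric monoidal category. -/
class Traced [SymmetricCategory C] where
  tr : ∀ (S : C) {X Y : C}, (S ⊗ X ⟶ S ⊗ Y) → (X ⟶ Y)
  tightening : ∀ (S : C) {X' X Y Y' : C} (u : X' ⟶ X) (f : S ⊗ X ⟶ S ⊗ Y) (v : Y ⟶ Y'),
    tr S ((S ◁ u) ≫ f ≫ (S ◁ v)) = u ≫ tr S f ≫ v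
  strength : ∀ (S : C) {X Y Z W : C} (f : S ⊗ X ⟶ S ⊗ Y) (g : Z ⟶ W),
    tr S ((α_ S X Z).inv ≫ (f ⊗ₘ g) ≫ (α_ S Y W).hom) = (tr S f ⊗ₘ g)
  joining : ∀ (S T : C) {X Y : C} (f : S ⊗ (T ⊗ X) ⟶ S ⊗ (T ⊗ Y)),
    tr T (tr S f) = tr (S ⊗ T) ((α_ S T X).hom ≫ f ≫ (α_ S T Y).inv)
  vanishing : ∀ {X Y : C} (f : X ⟶ Y), tr (𝟙_ C) ((λ_ X).hom ≫ f ≫ (λ_ Y).inv) = f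
  sliding : ∀ {S T X Y : C} (f : T ⊗ X ⟶ S ⊗ Y) (w : S ⟶ T),
    tr T (f ≫ (w ▷ Y)) = tr S ((w ▷ X) ≫ f)
  yanking : ∀ S : C, tr S (β_ S S).hom = 𝟙 S

/-- Uniformity of the trace. -/
class UniformTrace [SymmetricCategory C] [Traced C] : Prop where
  uniformity : ∀ {S T X Y : C} (f : S ⊗ X ⟶ S ⊗ Y) (g : T ⊗ X ⟶ T ⊗ Y) (r : S ⟶ T),
    f ≫ (r ▷ Y) = (r ▷ X) ≫ g → Traced.tr S f = Traced.tr T g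

/-- The axioms relating trace and order in a Kleene bicategory: the trace of `codiag ≫ diag` is
below the identity, and the trace is posetal uniform. -/
class KleeneTrace [SymmetricCategory C] [FinBiproduct C] [PosetEnriched C] [Traced C] : Prop where
  trace_codiag_diag : ∀ X : C,
    Traced.tr X (FinBiproduct.codiag X ≫ FinBiproduct.diag X) ≤ 𝟙 X
  uniform_right : ∀ {S T X Y : C} (f : S ⊗ X ⟶ S ⊗ Y) (g : T ⊗ X ⟶ T ⊗ Y) (r : S ⟶ T),
    f ≫ (r ▷ Y) ≤ (r ▷ X) ≫ g → Traced.tr S f ≤ Traced.tr T g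
  uniform_left : ∀ {S T X Y : C} (f : S ⊗ X ⟶ S ⊗ Y) (g : T ⊗ X ⟶ T ⊗ Y) (r : T ⟶ S),
    (r ▷ X) ≫ f ≤ g ≫ (r ▷ Y) → Traced.tr S f ≤ Traced.tr T g

end Structures

/-- Convolution of two parallel arrows of a finite biproduct category. -/
def conv {C : Type u} [Category.{u} C] [MonoidalCategory C] [SymmetricCategory C] [FinBiproduct C]
    {X Y : C} (f g : X ⟶ Y) : X ⟶ Y :=
  FinBiproduct.diag X ≫ (f ⊗ₘ g) ≫ FinBiproduct.codiag Y

/-- The unit of convolution. -/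
def convZero {C : Type u} [Category.{u} C] [MonoidalCategory C] [SymmetricCategory C]
    [FinBiproduct C] (X Y : C) : X ⟶ Y :=
  FinBiproduct.bang X ≫ FinBiproduct.cobang Y

/-- The convolution of a finite list of parallel arrows. -/
def convSum {C : Type u} [Category.{u} C] [MonoidalCategory C] [SymmetricCategory C]
    [FinBiproduct C] {X Y : C} (l : List (X ⟶ Y)) : X ⟶ Y :=
  l.foldr conv (convZero X Y)

/-! ## Structure-preserving functors -/

section Functors

variable {C D E : Type u} [Category.{u} C] [Category.{u} D] [Category.{u} E]
  [MonoidalCategory C] [MonoidalCategory D] [MonoidalCategory E]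
  [SymmetricCategory C] [SymmetricCategory D] [SymmetricCategory E]

/-- A strict symmetric monoidal functor. -/
structure IsStrictSymmetric (F : C ⥤ D) : Prop where
  obj_zero : F.obj (𝟙_ C) = 𝟙_ D
  obj_sum : ∀ X Y : C, F.obj (X ⊗ Y) = F.obj X ⊗ F.obj Y
  map_sum : ∀ {X Y X' Y' : C} (f : X ⟶ Y) (g : X' ⟶ Y'),
    F.map (f ⊗ₘ g) = eqToHom (obj_sum X X') ≫ (F.map f ⊗ₘ F.map g) ≫ eqToHom (obj_sum Y Y').symm
  map_braiding : ∀ X Y : C,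
    F.map (β_ X Y).hom =
      eqToHom (obj_sum X Y) ≫ (β_ (F.obj X) (F.obj Y)).hom ≫ eqToHom (obj_sum Y X).symm

/-- A strict symmetric monoidal functor preserving monoids and comonoids. -/
structure IsFB [FinBiproduct C] [FinBiproduct D] (F : C ⥤ D) : Prop
    extends IsStrictSymmetric F where
  map_codiag : ∀ X : C,
    F.map (FinBiproduct.codiag X) = eqToHom (obj_sum X X) ≫ FinBiproduct.codiag (F.obj X)
  map_cobang : ∀ X : C,
    F.map (FinBiproduct.cobang X) = eqToHom obj_zero ≫ FinBiproduct.cobang (F.obj X)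
  map_diag : ∀ X : C,
    F.map (FinBiproduct.diag X) = FinBiproduct.diag (F.obj X) ≫ eqToHom (obj_sum X X).symm
  map_bang : ∀ X : C,
    F.map (FinBiproduct.bang X) = FinBiproduct.bang (F.obj X) ≫ eqToHom obj_zero.symm

/-- The image of an arrow `S ⊗ X ⟶ S ⊗ Y` under a strict monoidal functor, seen as an arrow
`F S ⊗ F X ⟶ F S ⊗ F Y`. -/
def mapLoop {F : C ⥤ D} (hF : IsStrictSymmetric F) {S X Y : C} (f : S ⊗ X ⟶ S ⊗ Y) :
    F.obj S ⊗ F.obj X ⟶ F.obj S ⊗ F.obj Y :=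
  eqToHom (hF.obj_sum S X).symm ≫ F.map f ≫ eqToHom (hF.obj_sum S Y)

/-- A strict monoidal functor preserves traces. -/
def PreservesTrace [Traced C] [Traced D] {F : C ⥤ D} (hF : IsStrictSymmetric F) : Prop :=
  ∀ {S X Y : C} (f : S ⊗ X ⟶ S ⊗ Y),
    F.map (Traced.tr S f) = Traced.tr (F.obj S) (mapLoop hF f)

/-- A functor between poset enriched categories preserves the order. -/
def PreservesOrder [PosetEnriched C] [PosetEnriched D] (F : C ⥤ D) : Prop :=
  ∀ {X Y : C} {f g : X ⟶ Y}, f ≤ g → F.map f ≤ F.map g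

theorem IsStrictSymmetric.id : IsStrictSymmetric (𝟭 C) where
  obj_zero := rfl
  obj_sum _ _ := rfl
  map_sum f g := by simp
  map_braiding X Y := by simp

theorem IsStrictSymmetric.comp {F : C ⥤ D} {G : D ⥤ E} (hF : IsStrictSymmetric F)
    (hG : IsStrictSymmetric G) : IsStrictSymmetric (F ⋙ G) where
  obj_zero := by simp [hF.obj_zero, hG.obj_zero]
  obj_sum X Y := by simp [hF.obj_sum, hG.obj_sum]
  map_sum f g := by simp [hF.map_sum, hG.map_sum, eqToHom_map]
  map_braiding X Y := by simp [hF.map_braiding, hG.map_braiding, eqToHom_map]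

theorem IsFB.id [FinBiproduct C] : IsFB (𝟭 C) where
  toIsStrictSymmetric := .id
  map_codiag X := by simp
  map_cobang X := by simp
  map_diag X := by simp
  map_bang X := by simp

theorem IsFB.comp [FinBiproduct C] [FinBiproduct D] [FinBiproduct E] {F : C ⥤ D} {G : D ⥤ E}
    (hF : IsFB F) (hG : IsFB G) : IsFB (F ⋙ G) where
  toIsStrictSymmetric := hF.toIsStrictSymmetric.comp hG.toIsStrictSymmetric
  map_codiag X := by simp [hF.map_codiag, hG.map_codiag, eqToHom_map]
  map_cobang X := by simp [hF.map_cobang, hG.map_cobang, eqToHom_map]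
  map_diag X := by simp [hF.map_diag, hG.map_diag, eqToHom_map]
  map_bang X := by simp [hF.map_bang, hG.map_bang, eqToHom_map]

theorem PreservesTrace.id [Traced C] : PreservesTrace (.id : IsStrictSymmetric (𝟭 C)) := by
  intro S X Y f
  simp [mapLoop]

theorem PreservesTrace.comp [Traced C] [Traced D] [Traced E] {F : C ⥤ D} {G : D ⥤ E}
    {hF : IsStrictSymmetric F} {hG : IsStrictSymmetric G} (tF : PreservesTrace hF)
    (tG : PreservesTrace hG) : PreservesTrace (hF.comp hG) := by
  intro S X Y f
  have h1 := tF f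
  have h2 := tG (mapLoop hF f)
  rw [Functor.comp_map, h1, h2]
  simp [mapLoop, eqToHom_map]

end Functors

/-! ## The categories of the various kinds of categories -/

/-- A (small, strict) finite biproduct category. -/
structure FBCat : Type (u + 1) where
  carrier : Type u
  [category : Category.{u} carrier]
  [monoidal : MonoidalCategory carrier]
  [symmetric : SymmetricCategory carrier]
  [strict : Strict carrier]
  [biproduct : FinBiproduct carrier]

attribute [instance] FBCat.category FBCat.monoidal FBCat.symmetric FBCat.strict FBCat.biproduct

/-- A (small, strict) finite biproduct category with idempotent convolution. -/
structure FIBCat : Type (u + 1) extends FBCat.{u} where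
  [poset : PosetEnriched carrier]
  [adjoint : AdjointBiproduct carrier]

attribute [instance] FIBCat.poset FIBCat.adjoint

/-- A (small, strict) uniformly traced finite biproduct category with idempotent convolution. -/
structure UTFIBCat : Type (u + 1) extends FIBCat.{u} where
  [traced : Traced carrier]
  [uniform : UniformTrace carrier]

attribute [instance] UTFIBCat.traced UTFIBCat.uniform

/-- A (small, strict) Kleene bicategory. -/
structure KBicat : Type (u + 1) extends FIBCat.{u} where
  [traced : Traced carrier]
  [kleene : KleeneTrace carrier]

attribute [instance] KBicat.traced KBicat.kleene

/-- Morphisms of finite biproduct categories. -/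
@[ext]
structure FBHom (C D : FBCat.{u}) where
  functor : C.carrier ⥤ D.carrier
  isFB : IsFB functor

/-- Morphisms of finite biproduct categories with idempotent convolution. -/
@[ext]
structure FIBHom (C D : FIBCat.{u}) extends FBHom C.toFBCat D.toFBCat where
  mono : PreservesOrder functor

/-- Morphisms of uniformly traced finite biproduct categories with idempotent convolution. -/
@[ext]
structure UTFIBHom (C D : UTFIBCat.{u}) extends FIBHom C.toFIBCat D.toFIBCat where
  trace : PreservesTrace isFB.toIsStrictSymmetric

/-- Morphisms of Kleene bicategories. -/
@[ext]
structure KHom (C D : KBicat.{u}) extends FIBHom C.toFIBCat D.toFIBCat where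
  trace : PreservesTrace isFB.toIsStrictSymmetric

instance : Category FBCat.{u} where
  Hom := FBHom
  id C := ⟨𝟭 _, .id⟩
  comp F G := ⟨F.functor ⋙ G.functor, F.isFB.comp G.isFB⟩

instance : Category FIBCat.{u} where
  Hom := FIBHom
  id C := ⟨⟨𝟭 _, .id⟩, fun h => h⟩
  comp F G := ⟨⟨F.functor ⋙ G.functor, F.isFB.comp G.isFB⟩, fun h => G.mono (F.mono h)⟩

instance : Category UTFIBCat.{u} where
  Hom := UTFIBHom
  id C := ⟨⟨⟨𝟭 _, .id⟩, fun h => h⟩, PreservesTrace.id⟩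
  comp F G := ⟨⟨⟨F.functor ⋙ G.functor, F.isFB.comp G.isFB⟩, fun h => G.mono (F.mono h)⟩,
    PreservesTrace.comp F.trace G.trace⟩

instance : Category KBicat.{u} where
  Hom := KHom
  id C := ⟨⟨⟨𝟭 _, .id⟩, fun h => h⟩, PreservesTrace.id⟩
  comp F G := ⟨⟨⟨F.functor ⋙ G.functor, F.isFB.comp G.isFB⟩, fun h => G.mono (F.mono h)⟩,
    PreservesTrace.comp F.trace G.trace⟩

/-! ## Forgetful functors

A signature is a quiver: its vertices are the sorts, and its arrows are the generators, each with
one sort as arity and one sort as coarity. -/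

/-- The underlying signature of a finite biproduct category: all objects and all arrows. -/
def FBCat.forget : FBCat.{u} ⥤ Quiv.{u, u} where
  obj C := Quiv.of C.carrier
  map F := F.functor.toPrefunctor

/-- Forget the order. -/
def FIBCat.forget : FIBCat.{u} ⥤ FBCat.{u} where
  obj C := C.toFBCat
  map F := F.toFBHom

/-- Forget the trace. -/
def UTFIBCat.forget : UTFIBCat.{u} ⥤ FIBCat.{u} where
  obj C := C.toFIBCat
  map F := F.toFIBHom

instance KBicat.uniformTrace (C : KBicat.{u}) : UniformTrace C.carrier where
  uniformity f g r h :=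
    le_antisymm (KleeneTrace.uniform_right f g r h.le) (KleeneTrace.uniform_left g f r h.ge)

/-- A Kleene bicategory is uniformly traced. -/
def KBicat.incl : KBicat.{u} ⥤ UTFIBCat.{u} where
  obj C := { toFIBCat := C.toFIBCat }
  map F := { toFIBHom := F.toFIBHom, trace := F.trace }

/-- The underlying signature of a Kleene bicategory: all objects and all arrows. -/
def KBicat.forget : KBicat.{u} ⥤ Quiv.{u, u} where
  obj C := Quiv.of C.carrier
  map F := F.functor.toPrefunctor

/-! ## The congruences -/

/-- The idempotency congruence of a finite biproduct category. -/
inductive IdCong {C : Type u} [Category.{u} C] [MonoidalCategory C] [SymmetricCategory C]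
    [FinBiproduct C] : ∀ {X Y : C}, (X ⟶ Y) → (X ⟶ Y) → Prop
  | idem (X : C) : IdCong (FinBiproduct.diag X ≫ FinBiproduct.codiag X) (𝟙 X)
  | refl {X Y : C} (f : X ⟶ Y) : IdCong f f
  | trans {X Y : C} {f g h : X ⟶ Y} : IdCong f g → IdCong g h → IdCong f h
  | symm {X Y : C} {f g : X ⟶ Y} : IdCong f g → IdCong g f
  | comp {X Y Z : C} {f f' : X ⟶ Y} {g g' : Y ⟶ Z} :
      IdCong f f' → IdCong g g' → IdCong (f ≫ g) (f' ≫ g')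
  | sum {X Y X' Y' : C} {f f' : X ⟶ Y} {g g' : X' ⟶ Y'} :
      IdCong f f' → IdCong g g' → IdCong (f ⊗ₘ g) (f' ⊗ₘ g')

/-- The Kleene congruence: the least traced monoidal congruence closed under the rules for the
relation `f ≲ g`, which abbreviates that `conv f g` is congruent to `g`. -/
inductive KleeneCong {C : Type u} [Category.{u} C] [MonoidalCategory C] [SymmetricCategory C]
    [FinBiproduct C] [PosetEnriched C] [Traced C] : ∀ {X Y : C}, (X ⟶ Y) → (X ⟶ Y) → Prop
  -- traced monoidal congruence
  | refl {X Y : C} (f : X ⟶ Y) : KleeneCong f f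
  | trans {X Y : C} {f g h : X ⟶ Y} : KleeneCong f g → KleeneCong g h → KleeneCong f h
  | symm {X Y : C} {f g : X ⟶ Y} : KleeneCong f g → KleeneCong g f
  | comp {X Y Z : C} {f f' : X ⟶ Y} {g g' : Y ⟶ Z} :
      KleeneCong f f' → KleeneCong g g' → KleeneCong (f ≫ g) (f' ≫ g')
  | sum {X Y X' Y' : C} {f f' : X ⟶ Y} {g g' : X' ⟶ Y'} :
      KleeneCong f f' → KleeneCong g g' → KleeneCong (f ⊗ₘ g) (f' ⊗ₘ g')
  | trace {S X Y : C} {f g : S ⊗ X ⟶ S ⊗ Y} :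
      KleeneCong f g → KleeneCong (Traced.tr S f) (Traced.tr S g)
  -- rules for `≲`
  | le {X Y : C} {f g : X ⟶ Y} : f ≤ g → KleeneCong (conv f g) g
  | trace_le_id (X : C) :
      KleeneCong (conv (Traced.tr X (FinBiproduct.codiag X ≫ FinBiproduct.diag X)) (𝟙 X)) (𝟙 X)
  | le_trans {X Y : C} {f g h : X ⟶ Y} :
      KleeneCong (conv f g) g → KleeneCong (conv g h) h → KleeneCong (conv f h) h
  | le_comp {X Y Z : C} {f f' : X ⟶ Y} {g g' : Y ⟶ Z} :
      KleeneCong (conv f f') f' → KleeneCong (conv g g') g' →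
        KleeneCong (conv (f ≫ g) (f' ≫ g')) (f' ≫ g')
  | le_sum {X Y X' Y' : C} {f f' : X ⟶ Y} {g g' : X' ⟶ Y'} :
      KleeneCong (conv f f') f' → KleeneCong (conv g g') g' →
        KleeneCong (conv (f ⊗ₘ g) (f' ⊗ₘ g')) (f' ⊗ₘ g')
  | uniform_right {S T X Y : C} {w v : S ⟶ T} {f : S ⊗ X ⟶ S ⊗ Y} {g : T ⊗ X ⟶ T ⊗ Y} :
      KleeneCong w v →
      KleeneCong (conv (f ≫ (w ▷ Y)) ((v ▷ X) ≫ g)) ((v ▷ X) ≫ g) →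
        KleeneCong (conv (Traced.tr S f) (Traced.tr T g)) (Traced.tr T g)
  | uniform_left {S T X Y : C} {w v : S ⟶ T} {f : S ⊗ X ⟶ S ⊗ Y} {g : T ⊗ X ⟶ T ⊗ Y} :
      KleeneCong w v →
      KleeneCong (conv ((v ▷ X) ≫ g) (f ≫ (w ▷ Y))) (f ≫ (w ▷ Y)) →
        KleeneCong (conv (Traced.tr T g) (Traced.tr S f)) (Traced.tr S f)

/-! ## The free uniformly traced category

Arrows are represented by pairs of an object `S` and an arrow `S ⊗ X ⟶ S ⊗ Y`. -/

section FreeTrace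

variable {C : Type u} [Category.{u} C] [MonoidalCategory C]

/-- A formal trace `(f | S) : X ⟶ Y`. -/
structure FormalTrace (X Y : C) where
  state : C
  hom : state ⊗ X ⟶ state ⊗ Y

/-- An arrow of the category as a formal trace over the zero object. -/
def FormalTrace.of {X Y : C} (f : X ⟶ Y) : FormalTrace X Y :=
  ⟨𝟙_ C, 𝟙_ C ◁ f⟩

variable [SymmetricCategory C]

/-- Composition of formal traces: `S ⊗ T ⊗ X ⟶ T ⊗ S ⊗ X ⟶ T ⊗ S ⊗ Y ⟶ S ⊗ T ⊗ Y ⟶ S ⊗ T ⊗ Z`. -/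
def FormalTrace.comp {X Y Z : C} (f : FormalTrace X Y) (g : FormalTrace Y Z) :
    FormalTrace X Z :=
  ⟨f.state ⊗ g.state,
    ((β_ f.state g.state).hom ▷ X) ≫ (α_ g.state f.state X).hom ≫ (g.state ◁ f.hom) ≫
      (α_ g.state f.state Y).inv ≫ ((β_ g.state f.state).hom ▷ Y) ≫
      (α_ f.state g.state Y).hom ≫ (f.state ◁ g.hom) ≫ (α_ f.state g.state Z).inv⟩

/-- Monoidal product of formal traces. -/
def FormalTrace.sum {X Y X' Y' : C} (f : FormalTrace X Y) (g : FormalTrace X' Y') :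
    FormalTrace (X ⊗ X') (Y ⊗ Y') :=
  ⟨f.state ⊗ g.state,
    tensorμ f.state g.state X X' ≫ (f.hom ⊗ₘ g.hom) ≫ tensorμ f.state Y g.state Y'⟩

/-- Trace of a formal trace. -/
def FormalTrace.tr (T : C) {X Y : C} (f : FormalTrace (T ⊗ X) (T ⊗ Y)) : FormalTrace X Y :=
  ⟨f.state ⊗ T, (α_ f.state T X).hom ≫ f.hom ≫ (α_ f.state T Y).inv⟩

/-- The congruence on formal traces generated by sliding, yanking (these two give the free traced
monoidal category) and the uniformity rule. -/
inductive UniformCong : ∀ {X Y : C}, FormalTrace X Y → FormalTrace X Y → Prop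
  | refl {X Y : C} (f : FormalTrace X Y) : UniformCong f f
  | trans {X Y : C} {f g h : FormalTrace X Y} :
      UniformCong f g → UniformCong g h → UniformCong f h
  | symm {X Y : C} {f g : FormalTrace X Y} : UniformCong f g → UniformCong g f
  | comp {X Y Z : C} {f f' : FormalTrace X Y} {g g' : FormalTrace Y Z} :
      UniformCong f f' → UniformCong g g' → UniformCong (f.comp g) (f'.comp g')
  | sum {X Y X' Y' : C} {f f' : FormalTrace X Y} {g g' : FormalTrace X' Y'} :
      UniformCong f f' → UniformCong g g' → UniformCong (f.sum g) (f'.sum g')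
  | trace {T X Y : C} {f g : FormalTrace (T ⊗ X) (T ⊗ Y)} :
      UniformCong f g → UniformCong (f.tr T) (g.tr T)
  | sliding {S T X Y : C} (f : T ⊗ X ⟶ S ⊗ Y) (w : S ⟶ T) :
      UniformCong ⟨T, f ≫ (w ▷ Y)⟩ ⟨S, (w ▷ X) ≫ f⟩
  | yanking (S : C) : UniformCong ⟨S, (β_ S S).hom⟩ (.of (𝟙 S))
  | uniformity {S T X Y : C} {w v : FormalTrace S T} {f : FormalTrace (S ⊗ X) (S ⊗ Y)}
      {g : FormalTrace (T ⊗ X) (T ⊗ Y)} :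
      UniformCong w v →
      UniformCong (f.comp (w.sum (.of (𝟙 Y)))) ((v.sum (.of (𝟙 X))).comp g) →
        UniformCong (f.tr S) (g.tr T)

end FreeTrace

/-! ## The constructions

Each predicate says that the unit of an adjunction exhibits its codomain as the result of the
corresponding construction. -/

/-- `η` exhibits `D` as the biproduct completion (matrix construction) of the free category on the
signature `Q`: the objects are the formal finite sums of sorts, and the arrows between two sorts are
the formal finite sums of paths; arrows between sums are then matrices of such. -/
structure IsMatrixConstruction {Q : Quiv.{u, u}} {D : FBCat.{u}} (η : Q ⥤q D.carrier) : Prop where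
  obj_bijective : Function.Bijective
    (fun l : List Q => l.foldr (fun A X => η.obj A ⊗ X) (𝟙_ D.carrier))
  hom_surjective : ∀ (A B : Q) (f : η.obj A ⟶ η.obj B),
    ∃ l : List (Quiver.Path A B), convSum (l.map fun p => composePath (η.mapPath p)) = f
  hom_injective : ∀ (A B : Q) (l l' : List (Quiver.Path A B)),
    convSum (l.map fun p => composePath (η.mapPath p)) =
      convSum (l'.map fun p => composePath (η.mapPath p)) → l.Perm l'

/-- `F` exhibits `D` as the quotient of the hom-sets of `C` by the relation `R`. -/
structure IsQuotientFunctor {C D : Type u} [Category.{u} C] [Category.{u} D]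
    (R : ∀ {X Y : C}, (X ⟶ Y) → (X ⟶ Y) → Prop) (F : C ⥤ D) : Prop where
  obj_bijective : Function.Bijective F.obj
  map_surjective : ∀ X Y : C, Function.Surjective (F.map : (X ⟶ Y) → (F.obj X ⟶ F.obj Y))
  map_eq_iff : ∀ {X Y : C} (f g : X ⟶ Y), F.map f = F.map g ↔ R f g

/-- The value of a formal trace under a strict monoidal functor to a traced category. -/
def FormalTrace.eval {C D : Type u} [Category.{u} C] [Category.{u} D] [MonoidalCategory C]
    [MonoidalCategory D] [SymmetricCategory C] [SymmetricCategory D] [Traced D] {F : C ⥤ D}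
    (hF : IsStrictSymmetric F) {X Y : C} (f : FormalTrace X Y) : F.obj X ⟶ F.obj Y :=
  Traced.tr (F.obj f.state) (mapLoop hF f.hom)

/-- `η` exhibits `D` as the free uniformly traced category on `C`: the objects are those of `C`,
and the arrows are formal traces modulo sliding, yanking and uniformity. -/
structure IsUniformTraceConstruction {C : FIBCat.{u}} {D : UTFIBCat.{u}}
    (η : FIBHom C D.toFIBCat) : Prop where
  obj_bijective : Function.Bijective η.functor.obj
  hom_surjective : ∀ (X Y : C.carrier) (h : η.functor.obj X ⟶ η.functor.obj Y),
    ∃ f : FormalTrace X Y, f.eval η.isFB.toIsStrictSymmetric = h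
  hom_eq_iff : ∀ {X Y : C.carrier} (f g : FormalTrace X Y),
    f.eval η.isFB.toIsStrictSymmetric = g.eval η.isFB.toIsStrictSymmetric ↔ UniformCong f g

end FreeKleene

end

open FreeKleene

/-! Each of the four adjunctions comes from an explicit construction with an explicit unit and a
bijection of hom-sets given by composing with that unit; the required adjunction is their composite.
Two observations carry the constructions.

First, naturality of the monoids and comonoids makes `⊗` a biproduct: an arrow between sums is a
matrix, convolution adds entries, and arrows with equal entries are equal (`hom_ext`). Structural
coherences thereby become entrywise computations. Second, with idempotent convolution the order is
forced: `f ≤ g` means `conv f g = g` (`le_iff_conv`). Conversely, idempotency alone turns this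
relation into a poset enrichment with the required adjunctions (`adjointBiproduct_of_idem`). The
order thus carries no data, and every functor preserving the biproduct structure preserves it
(`IsFB.preservesOrder`).

Matrices. A row over the free category is a finite multiset of pairs of a target summand and a path.
Any assignment of arrows to generators extends by composing along paths and adding up
(`isFB_liftFunctor`). The extension is unique, since every row is a finite sum of paths followed by
injections of summands (`liftFunctor_unit`).

Quotients. The quotient by a monoidal congruence inherits all equational structure. The rules of the
idempotency and Kleene congruences are sound in every target (`IdCong.map_eq`, `KleeneCong.map_eq`),
so functors factor through the quotients; the same rules make the quotients satisfy the axioms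
(`quo_idem`, `quo_kleeneTrace`).

Traces. In matrix form a formal trace is an automaton: a state `S` with blocks `S ⟶ S`, `S ⟶ Y`, `X
⟶ S`, `X ⟶ Y`. By uniformity, two automata are congruent as soon as an arrow between their states
commutes with the blocks (`UniformCong.uniform`). The laws of the free category that involve general
arrows are then proved by exhibiting such a simulation: a rearrangement of states for the monoidal
laws and most trace laws; copying, merging, discarding or creating a state for naturality of the
biproduct structure; one run through a block matrix for sliding. Evaluating a formal trace by an
actual trace respects the operations (`eval_comp`, `eval_sum`, `eval_tr`) and the congruence
(`UniformCong.eval_eq`), which gives the extension of a functor. It is unique because every class is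
the trace of an arrow from `C` (`trace_arr`). -/

noncomputable section

namespace FreeKleene

/-! ## Matrix calculus in finite biproduct categories -/

section Biproduct

open FinBiproduct

variable {C : Type u} [Category.{u} C] [MonoidalCategory C] [SymmetricCategory C] [FinBiproduct C]

/-- The first projection. -/
def fst (X Y : C) : X ⊗ Y ⟶ X := (X ◁ bang Y) ≫ (ρ_ X).hom

/-- The second projection. -/
def snd (X Y : C) : X ⊗ Y ⟶ Y := (bang X ▷ Y) ≫ (λ_ Y).hom

/-- The first injection. -/
def inl (X Y : C) : X ⟶ X ⊗ Y := (ρ_ X).inv ≫ (X ◁ cobang Y)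

/-- The second injection. -/
def inr (X Y : C) : Y ⟶ X ⊗ Y := (λ_ Y).inv ≫ (cobang X ▷ Y)

/-- The pairing of two arrows. -/
def lift {X Y Z : C} (f : X ⟶ Y) (g : X ⟶ Z) : X ⟶ Y ⊗ Z := diag X ≫ (f ⊗ₘ g)

/-- The copairing of two arrows. -/
def desc {X Y Z : C} (f : X ⟶ Z) (g : Y ⟶ Z) : X ⊗ Y ⟶ Z := (f ⊗ₘ g) ≫ codiag Z

/-- Cocommutativity turns the left counit law, the only one among the axioms, into the right one. -/
theorem diag_bang_right (X : C) : diag X ≫ (X ◁ bang X) = (ρ_ X).inv := by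
  rw [← diag_braiding, Category.assoc, ← BraidedCategory.braiding_naturality_left,
    ← Category.assoc, diag_bang, leftUnitor_inv_braiding]

theorem cobang_codiag_right (X : C) : (X ◁ cobang X) ≫ codiag X = (ρ_ X).hom := by
  rw [← braiding_codiag, BraidedCategory.braiding_naturality_right_assoc, cobang_codiag,
    braiding_leftUnitor]

@[simp]
theorem lift_fst {X Y Z : C} (f : X ⟶ Y) (g : X ⟶ Z) : lift f g ≫ fst Y Z = f := by
  have h : (f ⊗ₘ g) ≫ (Y ◁ bang Z) = (X ◁ bang X) ≫ (f ▷ 𝟙_ C) := by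
    rw [← id_tensorHom, tensorHom_comp_tensorHom, bang_natural, Category.comp_id,
      ← id_tensorHom, ← tensorHom_id, tensorHom_comp_tensorHom, Category.id_comp, Category.comp_id]
  rw [lift, fst, Category.assoc, reassoc_of% h, ← Category.assoc, diag_bang_right]
  simp

@[simp]
theorem lift_fst_assoc {X Y Z : C} (f : X ⟶ Y) (g : X ⟶ Z) {U : C} (u : _ ⟶ U) :
    lift f g ≫ fst Y Z ≫ u = f ≫ u := by
  simp only [← Category.assoc, lift_fst]

@[simp]
theorem lift_snd {X Y Z : C} (f : X ⟶ Y) (g : X ⟶ Z) : lift f g ≫ snd Y Z = g := by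
  have h : (f ⊗ₘ g) ≫ (bang Y ▷ Z) = (bang X ▷ X) ≫ (𝟙_ C ◁ g) := by
    rw [← tensorHom_id, tensorHom_comp_tensorHom, bang_natural, Category.comp_id,
      ← id_tensorHom, ← tensorHom_id, tensorHom_comp_tensorHom, Category.id_comp, Category.comp_id]
  rw [lift, snd, Category.assoc, reassoc_of% h, ← Category.assoc, diag_bang]
  simp

@[simp]
theorem lift_snd_assoc {X Y Z : C} (f : X ⟶ Y) (g : X ⟶ Z) {U : C} (u : _ ⟶ U) :
    lift f g ≫ snd Y Z ≫ u = g ≫ u := by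
  simp only [← Category.assoc, lift_snd]

@[simp]
theorem inl_desc {X Y Z : C} (f : X ⟶ Z) (g : Y ⟶ Z) : inl X Y ≫ desc f g = f := by
  have h : (X ◁ cobang Y) ≫ (f ⊗ₘ g) = (f ▷ 𝟙_ C) ≫ (Z ◁ cobang Z) := by
    rw [← id_tensorHom, tensorHom_comp_tensorHom, cobang_natural, Category.id_comp,
      ← id_tensorHom, ← tensorHom_id, tensorHom_comp_tensorHom, Category.id_comp, Category.comp_id]
  rw [desc, inl, Category.assoc, reassoc_of% h, cobang_codiag_right]
  simp

@[simp]
theorem inr_desc {X Y Z : C} (f : X ⟶ Z) (g : Y ⟶ Z) : inr X Y ≫ desc f g = g := by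
  have h : (cobang X ▷ Y) ≫ (f ⊗ₘ g) = (𝟙_ C ◁ g) ≫ (cobang Z ▷ Z) := by
    rw [← tensorHom_id, tensorHom_comp_tensorHom, cobang_natural, Category.id_comp,
      ← id_tensorHom, ← tensorHom_id, tensorHom_comp_tensorHom, Category.id_comp, Category.comp_id]
  rw [desc, inr, Category.assoc, reassoc_of% h, cobang_codiag]
  simp

-- This is the uniqueness half of the product property. By `diag_sum` the diagonal of a sum is two
-- diagonals and an interchange; after the two middle factors are discarded, each summand is left
-- with a counit law.
@[simp]
theorem lift_fst_snd (X Y : C) : lift (fst X Y) (snd X Y) = 𝟙 (X ⊗ Y) := by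
  -- The interchange is invisible once its middle factors are zero objects, since braiding with the
  -- unit is a composite of unitors.
  have h : tensorμ X (𝟙_ C) (𝟙_ C) Y ≫ ((ρ_ X).hom ⊗ₘ (λ_ Y).hom) = ((ρ_ X).hom ⊗ₘ (λ_ Y).hom) := by
    simp only [tensorμ, braiding_tensorUnit_left]
    monoidal
  have h2 := tensorμ_natural (𝟙 X) (bang X) (bang Y) (𝟙 Y)
  have h3 : diag X ≫ (𝟙 X ⊗ₘ bang X) = (ρ_ X).inv := by rw [id_tensorHom, diag_bang_right]
  have h4 : diag Y ≫ (bang Y ⊗ₘ 𝟙 Y) = (λ_ Y).inv := by rw [tensorHom_id, diag_bang]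
  rw [lift, diag_sum, fst, snd, ← tensorHom_comp_tensorHom, Category.assoc, ← id_tensorHom,
    ← tensorHom_id]
  rw [← reassoc_of% h2, h, tensorHom_comp_tensorHom_assoc, h3, h4, tensorHom_comp_tensorHom]
  simp

@[simp]
theorem desc_inl_inr (X Y : C) : desc (inl X Y) (inr X Y) = 𝟙 (X ⊗ Y) := by
  have h : ((ρ_ X).inv ⊗ₘ (λ_ Y).inv) ≫ tensorμ X (𝟙_ C) (𝟙_ C) Y = ((ρ_ X).inv ⊗ₘ (λ_ Y).inv) := by
    simp only [tensorμ, braiding_tensorUnit_left]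
    monoidal
  have h2 := tensorμ_natural (𝟙 X) (cobang Y) (cobang X) (𝟙 Y)
  have h3 : (𝟙 X ⊗ₘ cobang X) ≫ codiag X = (ρ_ X).hom := by rw [id_tensorHom, cobang_codiag_right]
  have h4 : (cobang Y ⊗ₘ 𝟙 Y) ≫ codiag Y = (λ_ Y).hom := by rw [tensorHom_id, cobang_codiag]
  rw [desc, codiag_sum, inl, inr, ← tensorHom_comp_tensorHom, Category.assoc, ← id_tensorHom,
    ← tensorHom_id]
  rw [reassoc_of% h2, reassoc_of% h, tensorHom_comp_tensorHom, h3, h4, tensorHom_comp_tensorHom]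
  simp

@[simp]
theorem comp_lift {W X Y Z : C} (h : W ⟶ X) (f : X ⟶ Y) (g : X ⟶ Z) :
    h ≫ lift f g = lift (h ≫ f) (h ≫ g) := by
  rw [lift, reassoc_of% diag_natural h, tensorHom_comp_tensorHom, lift]

@[simp]
theorem comp_lift_assoc {W X Y Z : C} (h : W ⟶ X) (f : X ⟶ Y) (g : X ⟶ Z) {U : C} (u : _ ⟶ U) :
    h ≫ lift f g ≫ u = lift (h ≫ f) (h ≫ g) ≫ u := by
  simp only [← Category.assoc, comp_lift]

@[simp]
theorem desc_comp {W X Y Z : C} (f : X ⟶ Z) (g : Y ⟶ Z) (h : Z ⟶ W) :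
    desc f g ≫ h = desc (f ≫ h) (g ≫ h) := by
  rw [desc, Category.assoc, codiag_natural h, tensorHom_comp_tensorHom_assoc, desc]

theorem lift_ext {X Y Z : C} {f g : X ⟶ Y ⊗ Z} (h₁ : f ≫ fst Y Z = g ≫ fst Y Z)
    (h₂ : f ≫ snd Y Z = g ≫ snd Y Z) : f = g := by
  rw [← Category.comp_id f, ← Category.comp_id g, ← lift_fst_snd, comp_lift, comp_lift, h₁, h₂]

theorem desc_ext {X Y Z : C} {f g : X ⊗ Y ⟶ Z} (h₁ : inl X Y ≫ f = inl X Y ≫ g)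
    (h₂ : inr X Y ≫ f = inr X Y ≫ g) : f = g := by
  rw [← Category.id_comp f, ← Category.id_comp g, ← desc_inl_inr, desc_comp, desc_comp, h₁, h₂]

/-- Both bracketings are brought to the form threefold diagonal, three arrows, threefold codiagonal;
coassociativity, associativity and naturality of the associator then match them. -/
theorem conv_assoc {X Y : C} (f g h : X ⟶ Y) : conv (conv f g) h = conv f (conv g h) := by
  have h1 : conv (conv f g) h =
      (diag X ≫ (diag X ▷ X)) ≫ ((f ⊗ₘ g) ⊗ₘ h) ≫ ((codiag Y ▷ Y) ≫ codiag Y) := by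
    simp only [conv, ← tensorHom_id, Category.assoc, tensorHom_comp_tensorHom_assoc,
      Category.id_comp, Category.comp_id]
  have h2 : conv f (conv g h) =
      (diag X ≫ (X ◁ diag X)) ≫ (f ⊗ₘ (g ⊗ₘ h)) ≫ ((Y ◁ codiag Y) ≫ codiag Y) := by
    simp only [conv, ← id_tensorHom, Category.assoc, tensorHom_comp_tensorHom_assoc,
      Category.id_comp, Category.comp_id]
  simp only [h1, h2, codiag_assoc, ← diag_assoc, Category.assoc, associator_naturality_assoc]

theorem conv_comm {X Y : C} (f g : X ⟶ Y) : conv f g = conv g f := by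
  conv_lhs => rw [conv, ← diag_braiding, ← braiding_codiag]
  simp only [Category.assoc, ← BraidedCategory.braiding_naturality_assoc,
    SymmetricCategory.symmetry_assoc, FreeKleene.conv]

theorem comp_convZero {X Y Z : C} (f : X ⟶ Y) : f ≫ convZero Y Z = convZero X Z := by
  rw [convZero, ← Category.assoc, bang_natural, convZero]

theorem convZero_comp {X Y Z : C} (f : Y ⟶ Z) : convZero X Y ≫ f = convZero X Z := by
  rw [convZero, Category.assoc, cobang_natural, convZero]

theorem lift_desc {X Y Z W : C} (f : X ⟶ Y) (g : X ⟶ Z) (h : Y ⟶ W) (k : Z ⟶ W) :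
    lift f g ≫ desc h k = conv (f ≫ h) (g ≫ k) := by
  rw [lift, desc, Category.assoc, tensorHom_comp_tensorHom_assoc, conv]

theorem convZero_conv {X Y : C} (f : X ⟶ Y) : conv (convZero X Y) f = f := by
  have h : (convZero X Y ⊗ₘ f) = (bang X ▷ X) ≫ (𝟙_ C ◁ f) ≫ (cobang Y ▷ Y) := by
    simp only [← tensorHom_id, ← id_tensorHom, tensorHom_comp_tensorHom, convZero, Category.id_comp,
      Category.comp_id]
  rw [conv, h, Category.assoc, Category.assoc, cobang_codiag, ← Category.assoc, diag_bang]
  simp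

/-- Hom-sets of a finite biproduct category are commutative monoids under convolution. -/
instance homAddCommMonoid (X Y : C) : AddCommMonoid (X ⟶ Y) where
  add := conv
  zero := convZero X Y
  add_assoc := conv_assoc
  zero_add := convZero_conv
  add_zero f := (conv_comm _ _).trans (convZero_conv f)
  add_comm := conv_comm
  nsmul := @nsmulRec _ ⟨convZero X Y⟩ ⟨conv⟩

theorem convZero_eq_zero (X Y : C) : convZero X Y = 0 := rfl

@[simp]
theorem comp_zero' {X Y Z : C} (f : X ⟶ Y) : f ≫ (0 : Y ⟶ Z) = 0 := comp_convZero f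

@[simp]
theorem zero_comp' {X Y Z : C} (f : Y ⟶ Z) : (0 : X ⟶ Y) ≫ f = 0 := convZero_comp f

@[simp]
theorem comp_add' {X Y Z : C} (f : X ⟶ Y) (g h : Y ⟶ Z) : f ≫ (g + h) = f ≫ g + f ≫ h := by
  change f ≫ conv g h = conv (f ≫ g) (f ≫ h)
  rw [conv, reassoc_of% diag_natural f, tensorHom_comp_tensorHom_assoc, conv]

@[simp]
theorem add_comp' {X Y Z : C} (f g : X ⟶ Y) (h : Y ⟶ Z) : (f + g) ≫ h = f ≫ h + g ≫ h := by
  change conv f g ≫ h = conv (f ≫ h) (g ≫ h)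
  rw [conv, Category.assoc, Category.assoc, codiag_natural h, tensorHom_comp_tensorHom_assoc, conv]

-- Row times column: together with `comp_lift` and `desc_comp`, this lets `simp` multiply block
-- matrices.
@[simp]
theorem lift_comp_desc {X Y Z W : C} (f : X ⟶ Y) (g : X ⟶ Z) (h : Y ⟶ W) (k : Z ⟶ W) :
    lift f g ≫ desc h k = f ≫ h + g ≫ k := lift_desc f g h k

-- The structure maps are rewritten as pairings and copairings, so that the matrix rules apply to
-- them.
@[simp]
theorem diag_eq (X : C) : diag X = lift (𝟙 X) (𝟙 X) := by simp [lift]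

@[simp]
theorem codiag_eq (X : C) : codiag X = desc (𝟙 X) (𝟙 X) := by simp [desc]

/-- Since `bang` at the unit is the identity, naturality of `bang` makes the unit terminal. -/
theorem to_unit_unique {X : C} (f g : X ⟶ 𝟙_ C) : f = g := by
  rw [← Category.comp_id f, ← Category.comp_id g, ← bang_zero, bang_natural, bang_natural]

theorem from_unit_unique {X : C} (f g : 𝟙_ C ⟶ X) : f = g := by
  rw [← Category.id_comp f, ← Category.id_comp g, ← cobang_zero, cobang_natural, cobang_natural]

theorem eq_zero_of_to_unit {X : C} (f : X ⟶ 𝟙_ C) : f = 0 := to_unit_unique _ _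

theorem eq_zero_of_from_unit {X : C} (f : 𝟙_ C ⟶ X) : f = 0 := from_unit_unique _ _

@[simp]
theorem bang_eq (X : C) : bang X = 0 := eq_zero_of_to_unit _

@[simp]
theorem cobang_eq (X : C) : cobang X = 0 := eq_zero_of_from_unit _

@[simp]
theorem tensor_fst {X Y X' Y' : C} (f : X ⟶ Y) (g : X' ⟶ Y') :
    (f ⊗ₘ g) ≫ fst Y Y' = fst X X' ≫ f := by
  rw [fst, fst, ← id_tensorHom, tensorHom_comp_tensorHom_assoc, bang_natural, Category.assoc,
    ← rightUnitor_naturality, ← id_tensorHom, ← tensorHom_id, tensorHom_comp_tensorHom_assoc]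
  simp

@[simp]
theorem tensor_fst_assoc {X Y X' Y' : C} (f : X ⟶ Y) (g : X' ⟶ Y') {U : C} (u : _ ⟶ U) :
    (f ⊗ₘ g) ≫ fst Y Y' ≫ u = fst X X' ≫ f ≫ u := by
  simp only [← Category.assoc, tensor_fst]

@[simp]
theorem tensor_snd {X Y X' Y' : C} (f : X ⟶ Y) (g : X' ⟶ Y') :
    (f ⊗ₘ g) ≫ snd Y Y' = snd X X' ≫ g := by
  rw [snd, snd, ← tensorHom_id, tensorHom_comp_tensorHom_assoc, bang_natural, Category.assoc,
    ← leftUnitor_naturality, ← id_tensorHom, ← tensorHom_id, tensorHom_comp_tensorHom_assoc]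
  simp

@[simp]
theorem inl_tensor {X Y X' Y' : C} (f : X ⟶ Y) (g : X' ⟶ Y') :
    inl X X' ≫ (f ⊗ₘ g) = f ≫ inl Y Y' := by
  rw [inl, inl, Category.assoc, ← id_tensorHom, tensorHom_comp_tensorHom, cobang_natural,
    rightUnitor_inv_naturality_assoc, ← id_tensorHom, ← tensorHom_id, tensorHom_comp_tensorHom]
  simp

@[simp]
theorem inl_tensor_assoc {X Y X' Y' : C} (f : X ⟶ Y) (g : X' ⟶ Y') {U : C} (u : _ ⟶ U) :
    inl X X' ≫ (f ⊗ₘ g) ≫ u = f ≫ inl Y Y' ≫ u := by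
  simp only [← Category.assoc, inl_tensor]

@[simp]
theorem inr_tensor {X Y X' Y' : C} (f : X ⟶ Y) (g : X' ⟶ Y') :
    inr X X' ≫ (f ⊗ₘ g) = g ≫ inr Y Y' := by
  rw [inr, inr, Category.assoc, ← tensorHom_id, tensorHom_comp_tensorHom, cobang_natural,
    leftUnitor_inv_naturality_assoc, ← id_tensorHom, ← tensorHom_id, tensorHom_comp_tensorHom]
  simp

@[simp]
theorem inr_tensor_assoc {X Y X' Y' : C} (f : X ⟶ Y) (g : X' ⟶ Y') {U : C} (u : _ ⟶ U) :
    inr X X' ≫ (f ⊗ₘ g) ≫ u = g ≫ inr Y Y' ≫ u := by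
  simp only [← Category.assoc, inr_tensor]

@[simp]
theorem inl_fst (X Y : C) : inl X Y ≫ fst X Y = 𝟙 X := by
  -- The zero arrow discards and then creates, so copairing with it is the projection by the unit
  -- law of the monoid.
  have h : desc (𝟙 X) 0 = fst X Y := by
    rw [desc]
    have : (𝟙 X ⊗ₘ (0 : Y ⟶ X)) = (X ◁ bang Y) ≫ (X ◁ cobang X) := by
      rw [← whiskerLeft_comp, id_tensorHom]
      rfl
    rw [this, Category.assoc, cobang_codiag_right, fst]
  rw [← h, inl_desc]

@[simp]
theorem inl_fst_assoc (X Y : C) {U : C} (u : _ ⟶ U) :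
    inl X Y ≫ fst X Y ≫ u = 𝟙 X ≫ u := by
  simp only [← Category.assoc, inl_fst]

@[simp]
theorem inr_snd (X Y : C) : inr X Y ≫ snd X Y = 𝟙 Y := by
  have h : desc 0 (𝟙 Y) = snd X Y := by
    rw [desc]
    have : ((0 : X ⟶ Y) ⊗ₘ 𝟙 Y) = (bang X ▷ Y) ≫ (cobang Y ▷ Y) := by
      rw [← comp_whiskerRight, tensorHom_id]
      rfl
    rw [this, Category.assoc, cobang_codiag, snd]
  rw [← h, inr_desc]

@[simp]
theorem inr_snd_assoc (X Y : C) {U : C} (u : _ ⟶ U) :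
    inr X Y ≫ snd X Y ≫ u = 𝟙 Y ≫ u := by
  simp only [← Category.assoc, inr_snd]

@[simp]
theorem inl_snd (X Y : C) : inl X Y ≫ snd X Y = 0 := by
  rw [snd, ← tensorHom_id, inl_tensor_assoc, bang_eq]
  simp

@[simp]
theorem inl_snd_assoc (X Y : C) {U : C} (u : _ ⟶ U) :
    inl X Y ≫ snd X Y ≫ u = 0 ≫ u := by
  simp only [← Category.assoc, inl_snd]

@[simp]
theorem inr_fst (X Y : C) : inr X Y ≫ fst X Y = 0 := by
  rw [fst, ← id_tensorHom, inr_tensor_assoc, bang_eq]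
  simp

@[simp]
theorem inr_fst_assoc (X Y : C) {U : C} (u : _ ⟶ U) :
    inr X Y ≫ fst X Y ≫ u = 0 ≫ u := by
  simp only [← Category.assoc, inr_fst]

end Biproduct

/-! ### Entries of the structural arrows -/

section Components

open FinBiproduct

variable {C : Type u} [Category.{u} C] [MonoidalCategory C] [SymmetricCategory C] [FinBiproduct C]

theorem hom_ext {X Y Z W : C} {f g : X ⊗ Y ⟶ Z ⊗ W}
    (h₁ : inl X Y ≫ f ≫ fst Z W = inl X Y ≫ g ≫ fst Z W)
    (h₂ : inl X Y ≫ f ≫ snd Z W = inl X Y ≫ g ≫ snd Z W)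
    (h₃ : inr X Y ≫ f ≫ fst Z W = inr X Y ≫ g ≫ fst Z W)
    (h₄ : inr X Y ≫ f ≫ snd Z W = inr X Y ≫ g ≫ snd Z W) : f = g :=
  desc_ext (lift_ext (by simpa using h₁) (by simpa using h₂))
    (lift_ext (by simpa using h₃) (by simpa using h₄))

@[simp]
theorem rightUnitor_hom_eq (X : C) : (ρ_ X).hom = fst X (𝟙_ C) := by
  rw [fst, bang_zero, whiskerLeft_id, Category.id_comp]

@[simp]
theorem leftUnitor_hom_eq (X : C) : (λ_ X).hom = snd (𝟙_ C) X := by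
  rw [snd, bang_zero, id_whiskerRight, Category.id_comp]

@[simp]
theorem rightUnitor_inv_eq (X : C) : (ρ_ X).inv = inl X (𝟙_ C) := by
  rw [inl, cobang_zero, whiskerLeft_id, Category.comp_id]

@[simp]
theorem leftUnitor_inv_eq (X : C) : (λ_ X).inv = inr (𝟙_ C) X := by
  rw [inr, cobang_zero, id_whiskerRight, Category.comp_id]

@[simp]
theorem fst_unit (X : C) : fst (𝟙_ C) X = 0 := eq_zero_of_to_unit _

@[simp]
theorem inl_unit (X : C) : inl (𝟙_ C) X = 0 := eq_zero_of_from_unit _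

@[simp]
theorem inr_unit (X : C) : inr X (𝟙_ C) = 0 := eq_zero_of_from_unit _

@[simp]
theorem whiskerRight_fst {X Y : C} (f : X ⟶ Y) (Z : C) :
    (f ▷ Z) ≫ fst Y Z = fst X Z ≫ f := by
  rw [← tensorHom_id, tensor_fst]

@[simp]
theorem whiskerRight_fst_assoc {X Y : C} (f : X ⟶ Y) (Z : C) {V : C}
    (u : _ ⟶ V) : (f ▷ Z) ≫ fst Y Z ≫ u = fst X Z ≫ f ≫ u := by
  simp only [← Category.assoc, whiskerRight_fst]

@[simp]
theorem whiskerRight_snd {X Y : C} (f : X ⟶ Y) (Z : C) :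
    (f ▷ Z) ≫ snd Y Z = snd X Z := by
  rw [← tensorHom_id, tensor_snd, Category.comp_id]

@[simp]
theorem whiskerRight_snd_assoc {X Y : C} (f : X ⟶ Y) (Z : C) {V : C}
    (u : _ ⟶ V) : (f ▷ Z) ≫ snd Y Z ≫ u = snd X Z ≫ u := by
  simp only [← Category.assoc, whiskerRight_snd]

@[simp]
theorem inl_whiskerRight {X Y : C} (f : X ⟶ Y) (Z : C) :
    inl X Z ≫ (f ▷ Z) = f ≫ inl Y Z := by
  rw [← tensorHom_id, inl_tensor]

@[simp]
theorem inl_whiskerRight_assoc {X Y : C} (f : X ⟶ Y) (Z : C) {V : C}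
    (u : _ ⟶ V) : inl X Z ≫ (f ▷ Z) ≫ u = f ≫ inl Y Z ≫ u := by
  simp only [← Category.assoc, inl_whiskerRight]

@[simp]
theorem inr_whiskerRight {X Y : C} (f : X ⟶ Y) (Z : C) :
    inr X Z ≫ (f ▷ Z) = inr Y Z := by
  rw [← tensorHom_id, inr_tensor, Category.id_comp]

@[simp]
theorem inr_whiskerRight_assoc {X Y : C} (f : X ⟶ Y) (Z : C) {V : C}
    (u : _ ⟶ V) : inr X Z ≫ (f ▷ Z) ≫ u = inr Y Z ≫ u := by
  simp only [← Category.assoc, inr_whiskerRight]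

@[simp]
theorem whiskerLeft_fst (Z : C) {X Y : C} (f : X ⟶ Y) :
    (Z ◁ f) ≫ fst Z Y = fst Z X := by
  rw [← id_tensorHom, tensor_fst, Category.comp_id]

@[simp]
theorem whiskerLeft_snd (Z : C) {X Y : C} (f : X ⟶ Y) :
    (Z ◁ f) ≫ snd Z Y = snd Z X ≫ f := by
  rw [← id_tensorHom, tensor_snd]

@[simp]
theorem whiskerLeft_snd_assoc (Z : C) {X Y : C} (f : X ⟶ Y) {V : C}
    (u : _ ⟶ V) : (Z ◁ f) ≫ snd Z Y ≫ u = snd Z X ≫ f ≫ u := by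
  simp only [← Category.assoc, whiskerLeft_snd]

@[simp]
theorem inl_whiskerLeft (Z : C) {X Y : C} (f : X ⟶ Y) :
    inl Z X ≫ (Z ◁ f) = inl Z Y := by
  rw [← id_tensorHom, inl_tensor, Category.id_comp]

@[simp]
theorem inl_whiskerLeft_assoc (Z : C) {X Y : C} (f : X ⟶ Y) {V : C}
    (u : _ ⟶ V) : inl Z X ≫ (Z ◁ f) ≫ u = inl Z Y ≫ u := by
  simp only [← Category.assoc, inl_whiskerLeft]

@[simp]
theorem inr_whiskerLeft (Z : C) {X Y : C} (f : X ⟶ Y) :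
    inr Z X ≫ (Z ◁ f) = f ≫ inr Z Y := by
  rw [← id_tensorHom, inr_tensor]

@[simp]
theorem inr_whiskerLeft_assoc (Z : C) {X Y : C} (f : X ⟶ Y) {V : C}
    (u : _ ⟶ V) : inr Z X ≫ (Z ◁ f) ≫ u = f ≫ inr Z Y ≫ u := by
  simp only [← Category.assoc, inr_whiskerLeft]

@[simp]
theorem braiding_fst (X Y : C) : (β_ X Y).hom ≫ fst Y X = snd X Y := by
  rw [fst, ← BraidedCategory.braiding_naturality_left_assoc, braiding_rightUnitor, snd]

@[simp]
theorem braiding_fst_assoc (X Y : C) {V : C}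
    (u : _ ⟶ V) : (β_ X Y).hom ≫ fst Y X ≫ u = snd X Y ≫ u := by
  simp only [← Category.assoc, braiding_fst]

@[simp]
theorem braiding_snd (X Y : C) : (β_ X Y).hom ≫ snd Y X = fst X Y := by
  rw [snd, ← BraidedCategory.braiding_naturality_right_assoc, braiding_leftUnitor, fst]

@[simp]
theorem braiding_snd_assoc (X Y : C) {V : C}
    (u : _ ⟶ V) : (β_ X Y).hom ≫ snd Y X ≫ u = fst X Y ≫ u := by
  simp only [← Category.assoc, braiding_snd]

@[simp]
theorem inl_braiding (X Y : C) : inl X Y ≫ (β_ X Y).hom = inr Y X :=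
  lift_ext (by simp) (by simp)

@[simp]
theorem inl_braiding_assoc (X Y : C) {V : C}
    (u : _ ⟶ V) : inl X Y ≫ (β_ X Y).hom ≫ u = inr Y X ≫ u := by
  simp only [← Category.assoc, inl_braiding]

@[simp]
theorem inr_braiding (X Y : C) : inr X Y ≫ (β_ X Y).hom = inl Y X :=
  lift_ext (by simp) (by simp)

@[simp]
theorem inr_braiding_assoc (X Y : C) {V : C}
    (u : _ ⟶ V) : inr X Y ≫ (β_ X Y).hom ≫ u = inl Y X ≫ u := by
  simp only [← Category.assoc, inr_braiding]

-- By `bang_sum`, discarding a sum is discarding both summands; what remains is coherence.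
@[simp]
theorem associator_fst (X Y Z : C) :
    (α_ X Y Z).hom ≫ fst X (Y ⊗ Z) = fst (X ⊗ Y) Z ≫ fst X Y := by
  simp only [fst, bang_sum, MonoidalCategory.tensorHom_def']
  monoidal

@[simp]
theorem associator_snd_snd (X Y Z : C) :
    (α_ X Y Z).hom ≫ snd X (Y ⊗ Z) ≫ snd Y Z = snd (X ⊗ Y) Z := by
  simp only [snd, bang_sum, MonoidalCategory.tensorHom_def]
  monoidal

@[simp]
theorem associator_snd_snd_assoc (X Y Z : C) {V : C}
    (u : _ ⟶ V) : (α_ X Y Z).hom ≫ snd X (Y ⊗ Z) ≫ snd Y Z ≫ u = snd (X ⊗ Y) Z ≫ u := by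
  rw [reassoc_of% associator_snd_snd]

@[simp]
theorem associator_snd_fst (X Y Z : C) :
    (α_ X Y Z).hom ≫ snd X (Y ⊗ Z) ≫ fst Y Z = fst (X ⊗ Y) Z ≫ snd X Y := by
  -- The discards of `X` and `Z` act on different factors and may be exchanged; the rest is
  -- coherence.
  have h : (bang X ▷ Y ▷ Z) ≫ ((𝟙_ C ⊗ Y) ◁ bang Z) =
      ((X ⊗ Y) ◁ bang Z) ≫ (bang X ▷ Y ▷ 𝟙_ C) := (whisker_exchange _ _).symm
  have h2 : (α_ X Y Z).hom ≫ snd X (Y ⊗ Z) ≫ fst Y Z = ((bang X ▷ Y ▷ Z) ≫ ((𝟙_ C ⊗ Y) ◁ bang Z)) ≫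
      (α_ _ _ _).hom ≫ (λ_ _).hom ≫ (ρ_ _).hom := by
    simp only [snd, fst]
    monoidal
  rw [h2, h, snd, fst]
  monoidal

@[simp]
theorem associator_snd_fst_assoc (X Y Z : C) {V : C}
    (u : _ ⟶ V) : (α_ X Y Z).hom ≫ snd X (Y ⊗ Z) ≫ fst Y Z ≫ u = fst (X ⊗ Y) Z ≫ snd X Y ≫ u := by
  rw [reassoc_of% associator_snd_fst]

@[simp]
theorem inl_inl_associator (X Y Z : C) :
    inl X Y ≫ inl (X ⊗ Y) Z ≫ (α_ X Y Z).hom = inl X (Y ⊗ Z) :=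
  lift_ext (by simp) (lift_ext (by simp) (by simp))

@[simp]
theorem inl_inl_associator_assoc (X Y Z : C) {V : C}
    (u : _ ⟶ V) : inl X Y ≫ inl (X ⊗ Y) Z ≫ (α_ X Y Z).hom ≫ u = inl X (Y ⊗ Z) ≫ u := by
  rw [reassoc_of% inl_inl_associator]

@[simp]
theorem inr_inl_associator (X Y Z : C) :
    inr X Y ≫ inl (X ⊗ Y) Z ≫ (α_ X Y Z).hom = inl Y Z ≫ inr X (Y ⊗ Z) :=
  lift_ext (by simp) (lift_ext (by simp) (by simp))

@[simp]
theorem inr_inl_associator_assoc (X Y Z : C) {V : C}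
    (u : _ ⟶ V) : inr X Y ≫ inl (X ⊗ Y) Z ≫ (α_ X Y Z).hom ≫ u = inl Y Z ≫ inr X (Y ⊗ Z) ≫ u := by
  rw [reassoc_of% inr_inl_associator]

@[simp]
theorem inr_associator (X Y Z : C) :
    inr (X ⊗ Y) Z ≫ (α_ X Y Z).hom = inr Y Z ≫ inr X (Y ⊗ Z) :=
  lift_ext (by simp) (lift_ext (by simp) (by simp))

@[simp]
theorem inr_associator_assoc (X Y Z : C) {V : C}
    (u : _ ⟶ V) : inr (X ⊗ Y) Z ≫ (α_ X Y Z).hom ≫ u = inr Y Z ≫ inr X (Y ⊗ Z) ≫ u := by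
  simp only [← Category.assoc, inr_associator]

@[simp]
theorem associator_inv_snd (X Y Z : C) :
    (α_ X Y Z).inv ≫ snd (X ⊗ Y) Z = snd X (Y ⊗ Z) ≫ snd Y Z := by
  rw [Iso.inv_comp_eq, associator_snd_snd]

@[simp]
theorem associator_inv_snd_assoc (X Y Z : C) {V : C}
    (u : _ ⟶ V) : (α_ X Y Z).inv ≫ snd (X ⊗ Y) Z ≫ u = snd X (Y ⊗ Z) ≫ snd Y Z ≫ u := by
  simp only [← Category.assoc, associator_inv_snd]

@[simp]
theorem associator_inv_fst_fst (X Y Z : C) :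
    (α_ X Y Z).inv ≫ fst (X ⊗ Y) Z ≫ fst X Y = fst X (Y ⊗ Z) := by
  rw [Iso.inv_comp_eq, associator_fst]

@[simp]
theorem associator_inv_fst_snd (X Y Z : C) :
    (α_ X Y Z).inv ≫ fst (X ⊗ Y) Z ≫ snd X Y = snd X (Y ⊗ Z) ≫ fst Y Z := by
  rw [Iso.inv_comp_eq, associator_snd_fst]

@[simp]
theorem inl_associator_inv (X Y Z : C) :
    inl X (Y ⊗ Z) ≫ (α_ X Y Z).inv = inl X Y ≫ inl (X ⊗ Y) Z := by
  rw [Iso.comp_inv_eq, Category.assoc, inl_inl_associator]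

@[simp]
theorem inl_associator_inv_assoc (X Y Z : C) {V : C}
    (u : _ ⟶ V) : inl X (Y ⊗ Z) ≫ (α_ X Y Z).inv ≫ u = inl X Y ≫ inl (X ⊗ Y) Z ≫ u := by
  simp only [← Category.assoc, inl_associator_inv]

@[simp]
theorem inl_inr_associator_inv (X Y Z : C) :
    inl Y Z ≫ inr X (Y ⊗ Z) ≫ (α_ X Y Z).inv = inr X Y ≫ inl (X ⊗ Y) Z := by
  rw [← Category.assoc, Iso.comp_inv_eq, Category.assoc, inr_inl_associator]

@[simp]
theorem inl_inr_associator_inv_assoc (X Y Z : C) {V : C}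
    (u : _ ⟶ V) : inl Y Z ≫ inr X (Y ⊗ Z) ≫ (α_ X Y Z).inv ≫ u = inr X Y ≫ inl (X ⊗ Y) Z ≫ u := by
  rw [reassoc_of% inl_inr_associator_inv]

@[simp]
theorem inr_inr_associator_inv (X Y Z : C) :
    inr Y Z ≫ inr X (Y ⊗ Z) ≫ (α_ X Y Z).inv = inr (X ⊗ Y) Z := by
  rw [← Category.assoc, Iso.comp_inv_eq, inr_associator]

@[simp]
theorem inr_inr_associator_inv_assoc (X Y Z : C) {V : C}
    (u : _ ⟶ V) : inr Y Z ≫ inr X (Y ⊗ Z) ≫ (α_ X Y Z).inv ≫ u = inr (X ⊗ Y) Z ≫ u := by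
  rw [reassoc_of% inr_inr_associator_inv]

@[simp]
theorem lift_whiskerRight {W X Y Z : C} (f : W ⟶ X) (g : W ⟶ Y) (h : X ⟶ Z) :
    lift f g ≫ (h ▷ Y) = lift (f ≫ h) g := lift_ext (by simp) (by simp)

@[simp]
theorem lift_whiskerLeft {W X Y Z : C} (f : W ⟶ X) (g : W ⟶ Y) (h : Y ⟶ Z) :
    lift f g ≫ (X ◁ h) = lift f (g ≫ h) := lift_ext (by simp) (by simp)

@[simp]
theorem whiskerRight_desc {X Y Z U : C} (f : X ⟶ Y) (h : Y ⟶ U) (k : Z ⟶ U) :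
    (f ▷ Z) ≫ desc h k = desc (f ≫ h) k := desc_ext (by simp) (by simp)

@[simp]
theorem whiskerLeft_desc {X Y Z U : C} (f : X ⟶ Y) (h : Z ⟶ U) (k : Y ⟶ U) :
    (Z ◁ f) ≫ desc h k = desc h (f ≫ k) := desc_ext (by simp) (by simp)

theorem lift_eq_add {X Y Z : C} (f : X ⟶ Y) (g : X ⟶ Z) :
    lift f g = f ≫ inl Y Z + g ≫ inr Y Z := lift_ext (by simp) (by simp)

@[simp]
theorem add_lift {X Y Z : C} (f f' : X ⟶ Y) (g g' : X ⟶ Z) :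
    lift f g + lift f' g' = lift (f + f') (g + g') := lift_ext (by simp) (by simp)

@[simp]
theorem lift_zero (X Y Z : C) : lift (0 : X ⟶ Y) (0 : X ⟶ Z) = 0 := lift_ext (by simp) (by simp)

theorem tensor_add {X Y Z W : C} (f g : X ⟶ Y) (h k : Z ⟶ W) :
    ((f + g) ⊗ₘ (h + k)) = (f ⊗ₘ h) + (g ⊗ₘ k) :=
  hom_ext (by simp) (by simp) (by simp) (by simp)

/-- Every arrow between binary sums is a matrix. -/
theorem eq_matrix {X Y Z W : C} (f : X ⊗ Y ⟶ Z ⊗ W) :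
    ∃ (a : X ⟶ Z) (b : X ⟶ W) (c : Y ⟶ Z) (d : Y ⟶ W), f = desc (lift a b) (lift c d) :=
  ⟨inl X Y ≫ f ≫ fst Z W, inl X Y ≫ f ≫ snd Z W, inr X Y ≫ f ≫ fst Z W, inr X Y ≫ f ≫ snd Z W,
    hom_ext (by simp) (by simp) (by simp) (by simp)⟩

end Components

/-! ## The order of a finite biproduct category with idempotent convolution -/

section Order

open FinBiproduct

variable {C : Type u} [Category.{u} C] [MonoidalCategory C] [SymmetricCategory C] [FinBiproduct C]

theorem add_self_of_idem (h : ∀ X : C, diag X ≫ codiag X = 𝟙 X) {X Y : C} (f : X ⟶ Y) :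
    f + f = f := by
  have := congrArg (· ≫ f) (h X)
  simpa using this

/-- If convolution is idempotent, hom-sets are semilattices, hence ordered. -/
@[reducible]
def posetEnrichedOfIdem (h : ∀ X : C, diag X ≫ codiag X = 𝟙 X) : PosetEnriched C where
  homOrder X Y :=
    { le := fun f g => conv f g = g
      le_refl := fun f => add_self_of_idem h f
      le_trans := fun f g k (hf : f + g = g) (hg : g + k = k) => by
        change f + k = k
        rw [← hg, ← add_assoc, hf]
      le_antisymm := fun f g (hf : f + g = g) (hg : g + f = f) => by
        rw [← hf, add_comm, hg] }
  comp_mono {X Y Z f f' g g'} hf hg := by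
    change f + f' = f' at hf
    change g + g' = g' at hg
    change f ≫ g + f' ≫ g' = f' ≫ g'
    rw [← hf, ← hg]
    simp only [comp_add', add_comp', ← add_assoc, add_self_of_idem h]
  tensor_mono {X Y X' Y' f f' g g'} hf hg := by
    change f + f' = f' at hf
    change g + g' = g' at hg
    change (f ⊗ₘ g) + (f' ⊗ₘ g') = (f' ⊗ₘ g')
    rw [← tensor_add, hf, hg]

theorem adjointBiproduct_of_idem (h : ∀ X : C, diag X ≫ codiag X = 𝟙 X) :
    letI := posetEnrichedOfIdem h
    AdjointBiproduct C :=
  letI := posetEnrichedOfIdem h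
  { diag_codiag := fun X => le_of_eq (h X)
    codiag_diag := fun X => by
      -- This compares the identity matrix with the matrix all of whose entries are identities;
      -- entrywise it reads `1 + 1 = 1` and `0 + 1 = 1`.
      change 𝟙 _ + codiag X ≫ diag X = codiag X ≫ diag X
      apply hom_ext <;> simp [add_self_of_idem h]
    bang_cobang := fun X => by
      change bang X ≫ cobang X + 𝟙 X = 𝟙 X
      simp
    cobang_bang := fun X => le_of_eq (to_unit_unique _ _) }

variable [PosetEnriched C]

theorem add_mono {X Y : C} {f f' g g' : X ⟶ Y} (hf : f ≤ f') (hg : g ≤ g') : f + g ≤ f' + g' :=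
  PosetEnriched.comp_mono le_rfl
    (PosetEnriched.comp_mono (PosetEnriched.tensor_mono hf hg) le_rfl)

variable [AdjointBiproduct C]

/-- Composing `f` with `bang_cobang` gives the claim, because anything followed by `bang ≫ cobang`
is zero. -/
theorem zero_le_hom {X Y : C} (f : X ⟶ Y) : 0 ≤ f := by
  have h := PosetEnriched.comp_mono (le_refl f) (AdjointBiproduct.bang_cobang Y)
  simpa using h

theorem diag_codiag_eq_id (X : C) : diag X ≫ codiag X = 𝟙 X := by
  refine le_antisymm (AdjointBiproduct.diag_codiag X) ?_
  -- The missing inequality is `1 = 1 + 0 ≤ 1 + 1`.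
  have h := add_mono (le_refl (𝟙 X)) (zero_le_hom (𝟙 X))
  simpa using h

theorem add_self' {X Y : C} (f : X ⟶ Y) : f + f = f := add_self_of_idem diag_codiag_eq_id f

/-- Zero is least and addition is monotone and idempotent, so addition is the join. The order is
therefore definable from the biproduct structure. -/
theorem le_iff_conv {X Y : C} {f g : X ⟶ Y} : f ≤ g ↔ conv f g = g := by
  change _ ↔ f + g = g
  constructor
  · intro h
    refine le_antisymm ?_ ?_
    · simpa [add_self'] using add_mono h (le_refl g)
    · simpa using add_mono (zero_le_hom f) (le_refl g)
  · intro h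
    rw [← h]
    simpa using add_mono (le_refl f) (zero_le_hom g)

end Order

/-! ## Matrices and structure-preserving functors -/

section Functors

variable {C D : Type u} [Category.{u} C] [Category.{u} D]
  [MonoidalCategory C] [MonoidalCategory D] [SymmetricCategory C] [SymmetricCategory D]
  [FinBiproduct C] [FinBiproduct D] {F : C ⥤ D}

theorem IsFB.map_lift (hF : IsFB F) {X Y Z : C} (f : X ⟶ Y) (g : X ⟶ Z) :
    F.map (lift f g) = lift (F.map f) (F.map g) ≫ eqToHom (hF.obj_sum Y Z).symm := by
  rw [lift, F.map_comp, hF.map_diag, hF.map_sum, lift]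
  simp [-diag_eq]

theorem IsFB.map_desc (hF : IsFB F) {X Y Z : C} (f : X ⟶ Z) (g : Y ⟶ Z) :
    F.map (desc f g) = eqToHom (hF.obj_sum X Y) ≫ desc (F.map f) (F.map g) := by
  rw [desc, F.map_comp, hF.map_codiag, hF.map_sum, desc]
  simp [-codiag_eq]

theorem IsFB.map_zero (hF : IsFB F) (X Y : C) : F.map (0 : X ⟶ Y) = 0 := by
  rw [← convZero_eq_zero, convZero, F.map_comp, hF.map_bang, hF.map_cobang]
  simp

theorem IsFB.map_add (hF : IsFB F) {X Y : C} (f g : X ⟶ Y) :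
    F.map (f + g) = F.map f + F.map g := by
  have h : f + g = lift f g ≫ desc (𝟙 _) (𝟙 _) := by simp
  rw [h, F.map_comp, hF.map_lift, hF.map_desc]
  simp

theorem fst_eq_desc (X Y : C) : fst X Y = desc (𝟙 X) 0 := desc_ext (by simp) (by simp)

theorem snd_eq_desc (X Y : C) : snd X Y = desc 0 (𝟙 Y) := desc_ext (by simp) (by simp)

theorem inl_eq_lift (X Y : C) : inl X Y = lift (𝟙 X) 0 := lift_ext (by simp) (by simp)

theorem inr_eq_lift (X Y : C) : inr X Y = lift 0 (𝟙 Y) := lift_ext (by simp) (by simp)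

theorem IsFB.map_fst (hF : IsFB F) (X Y : C) :
    F.map (fst X Y) = eqToHom (hF.obj_sum X Y) ≫ fst _ _ := by
  rw [fst_eq_desc, hF.map_desc, hF.map_zero, F.map_id, ← fst_eq_desc]

theorem IsFB.map_snd (hF : IsFB F) (X Y : C) :
    F.map (snd X Y) = eqToHom (hF.obj_sum X Y) ≫ snd _ _ := by
  rw [snd_eq_desc, hF.map_desc, hF.map_zero, F.map_id, ← snd_eq_desc]

theorem IsFB.map_inl (hF : IsFB F) (X Y : C) :
    F.map (inl X Y) = inl _ _ ≫ eqToHom (hF.obj_sum X Y).symm := by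
  rw [inl_eq_lift, hF.map_lift, hF.map_zero, F.map_id, ← inl_eq_lift]

theorem IsFB.map_inr (hF : IsFB F) (X Y : C) :
    F.map (inr X Y) = inr _ _ ≫ eqToHom (hF.obj_sum X Y).symm := by
  rw [inr_eq_lift, hF.map_lift, hF.map_zero, F.map_id, ← inr_eq_lift]

theorem IsFB.preservesOrder [PosetEnriched C] [AdjointBiproduct C] [PosetEnriched D]
    [AdjointBiproduct D] (hF : IsFB F) : PreservesOrder F := by
  intro X Y f g h
  rw [le_iff_conv] at h ⊢
  exact (hF.map_add f g).symm.trans (congrArg F.map h)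

end Functors

/-! ## Quotients of monoidal categories by monoidal congruences -/

/-- A congruence for composition and the monoidal product. -/
structure MonoidalCongruence (C : Type u) [Category.{u} C] [MonoidalCategory C] where
  rel : ∀ {X Y : C}, (X ⟶ Y) → (X ⟶ Y) → Prop
  equivalence : ∀ X Y : C, Equivalence (rel (X := X) (Y := Y))
  comp : ∀ {X Y Z : C} {f f' : X ⟶ Y} {g g' : Y ⟶ Z},
    rel f f' → rel g g' → rel (f ≫ g) (f' ≫ g')
  sum : ∀ {X Y X' Y' : C} {f f' : X ⟶ Y} {g g' : X' ⟶ Y'},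
    rel f f' → rel g g' → rel (f ⊗ₘ g) (f' ⊗ₘ g')

/-- The quotient of a monoidal category by a monoidal congruence. -/
@[ext]
structure Quo {C : Type u} [Category.{u} C] [MonoidalCategory C] (R : MonoidalCongruence C) :
    Type u where
  ob ::
  as : C

namespace Quo

variable {C : Type u} [Category.{u} C] [MonoidalCategory C] {R : MonoidalCongruence C}

/-- The congruence on a hom-set. -/
@[reducible]
def setoid (R : MonoidalCongruence C) (X Y : C) : Setoid (X ⟶ Y) := ⟨R.rel, R.equivalence X Y⟩

instance category : Category.{u} (Quo R) where
  Hom X Y := Quotient (setoid R X.as Y.as)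
  id X := Quotient.mk _ (𝟙 X.as)
  comp := Quotient.map₂ (· ≫ ·) fun _ _ h _ _ h' => R.comp h h'
  id_comp := by
    rintro X Y ⟨f⟩
    exact congrArg (Quotient.mk _) (Category.id_comp f)
  comp_id := by
    rintro X Y ⟨f⟩
    exact congrArg (Quotient.mk _) (Category.comp_id f)
  assoc := by
    rintro X Y Z W ⟨f⟩ ⟨g⟩ ⟨h⟩
    exact congrArg (Quotient.mk _) (Category.assoc f g h)

variable (R) in
/-- The quotient functor. -/
def functor : C ⥤ Quo R where
  obj X := ⟨X⟩
  map f := Quotient.mk _ f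

/-- The class of an arrow. -/
def arr {X Y : Quo R} (f : X.as ⟶ Y.as) : X ⟶ Y := Quotient.mk _ f

theorem arr_eq_iff {X Y : Quo R} (f g : X.as ⟶ Y.as) : (arr f : X ⟶ Y) = arr g ↔ R.rel f g :=
  ⟨fun h => Quotient.exact h, fun h => Quotient.sound h⟩

/-- Needed for strictness of the quotient: structural isomorphisms that are casts on representatives
must remain casts on classes. -/
theorem arr_eqToHom {X Y : Quo R} (h : X.as = Y.as) :
    (arr (eqToHom h) : X ⟶ Y) = eqToHom (Quo.ext h) := by
  obtain ⟨X⟩ := X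
  obtain ⟨Y⟩ := Y
  obtain rfl : X = Y := h
  rfl

/-- Isomorphisms of representatives. -/
def isoArr {X Y : Quo R} (e : X.as ≅ Y.as) : X ≅ Y where
  hom := arr e.hom
  inv := arr e.inv
  hom_inv_id := congrArg arr e.hom_inv_id
  inv_hom_id := congrArg arr e.inv_hom_id

instance monoidal : MonoidalCategory (Quo R) where
  tensorObj X Y := ⟨X.as ⊗ Y.as⟩
  tensorUnit := ⟨𝟙_ C⟩
  tensorHom := Quotient.map₂ (· ⊗ₘ ·) fun _ _ h _ _ h' => R.sum h h'
  whiskerLeft X _ _ := Quotient.map (X.as ◁ ·) fun _ _ (h : R.rel _ _) => by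
    change R.rel _ _
    simpa using R.sum ((R.equivalence _ _).refl (𝟙 X.as)) h
  whiskerRight f X := Quotient.map (· ▷ X.as) (fun _ _ (h : R.rel _ _) => by
    change R.rel _ _
    simpa using R.sum h ((R.equivalence _ _).refl (𝟙 X.as))) f
  associator X Y Z := isoArr (α_ X.as Y.as Z.as)
  leftUnitor X := isoArr (λ_ X.as)
  rightUnitor X := isoArr (ρ_ X.as)
  tensorHom_def := by
    rintro _ _ _ _ ⟨f⟩ ⟨g⟩
    exact congrArg (Quotient.mk _) (MonoidalCategory.tensorHom_def f g)
  id_tensorHom_id X Y := congrArg (Quotient.mk _) (id_tensorHom_id X.as Y.as)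
  tensorHom_comp_tensorHom := by
    rintro _ _ _ _ _ _ ⟨f⟩ ⟨g⟩ ⟨h⟩ ⟨k⟩
    exact congrArg (Quotient.mk _) (tensorHom_comp_tensorHom f g h k)
  whiskerLeft_id X Y := congrArg (Quotient.mk _) (MonoidalCategory.whiskerLeft_id X.as Y.as)
  id_whiskerRight X Y := congrArg (Quotient.mk _) (MonoidalCategory.id_whiskerRight X.as Y.as)
  associator_naturality := by
    rintro _ _ _ _ _ _ ⟨f⟩ ⟨g⟩ ⟨h⟩
    exact congrArg (Quotient.mk _) (associator_naturality f g h)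
  leftUnitor_naturality := by
    rintro _ _ ⟨f⟩
    exact congrArg (Quotient.mk _) (leftUnitor_naturality f)
  rightUnitor_naturality := by
    rintro _ _ ⟨f⟩
    exact congrArg (Quotient.mk _) (rightUnitor_naturality f)
  pentagon W X Y Z := congrArg (Quotient.mk _) (pentagon W.as X.as Y.as Z.as)
  triangle X Y := congrArg (Quotient.mk _) (triangle X.as Y.as)

theorem isQuotientFunctor : IsQuotientFunctor R.rel (functor R) where
  obj_bijective := ⟨fun _ _ h => congrArg as h, fun X => ⟨X.as, rfl⟩⟩
  map_surjective _ _ := Quotient.exists_rep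
  map_eq_iff f g := arr_eq_iff (X := ⟨_⟩) (Y := ⟨_⟩) f g

instance strict [Strict C] : Strict (Quo R) where
  assoc_obj X Y Z := Quo.ext (Strict.assoc_obj X.as Y.as Z.as)
  unit_obj X := Quo.ext (Strict.unit_obj X.as)
  obj_unit X := Quo.ext (Strict.obj_unit X.as)
  associator_eq X Y Z :=
    (congrArg arr (Strict.associator_eq X.as Y.as Z.as)).trans (arr_eqToHom _)
  leftUnitor_eq X := (congrArg arr (Strict.leftUnitor_eq X.as)).trans (arr_eqToHom _)
  rightUnitor_eq X := (congrArg arr (Strict.rightUnitor_eq X.as)).trans (arr_eqToHom _)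

section Lift

variable {D : Type u} [Category.{u} D]

/-- A functor respecting the congruence factors through the quotient. -/
def lift (F : C ⥤ D) (h : ∀ {X Y : C} (f g : X ⟶ Y), R.rel f g → F.map f = F.map g) :
    Quo R ⥤ D where
  obj X := F.obj X.as
  map := Quotient.lift F.map h
  map_id X := F.map_id X.as
  map_comp := by
    rintro _ _ _ ⟨f⟩ ⟨g⟩
    exact F.map_comp f g

/-- This is uniqueness of the factorization: objects of the quotient are representatives up to
structure eta, and every arrow is a class, so the two functors agree definitionally up to trivial
casts. -/
theorem lift_functor (G : Quo R ⥤ D) (h) : lift (functor R ⋙ G) h = G := by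
  refine CategoryTheory.Functor.ext (fun _ => rfl) ?_
  rintro X Y ⟨f⟩
  exact ((Category.id_comp _).trans (Category.comp_id _)).symm

end Lift

variable [SymmetricCategory C]

instance symmetric : SymmetricCategory (Quo R) where
  braiding X Y := isoArr (β_ X.as Y.as)
  braiding_naturality_right := by
    rintro X _ _ ⟨f⟩
    exact congrArg (Quotient.mk _) (BraidedCategory.braiding_naturality_right X.as f)
  braiding_naturality_left := by
    rintro _ _ ⟨f⟩ X
    exact congrArg (Quotient.mk _) (BraidedCategory.braiding_naturality_left f X.as)
  hexagon_forward X Y Z :=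
    congrArg (Quotient.mk _) (BraidedCategory.hexagon_forward X.as Y.as Z.as)
  hexagon_reverse X Y Z :=
    congrArg (Quotient.mk _) (BraidedCategory.hexagon_reverse X.as Y.as Z.as)
  symmetry X Y := congrArg (Quotient.mk _) (SymmetricCategory.symmetry X.as Y.as)

instance finBiproduct [FinBiproduct C] : FinBiproduct (Quo R) where
  codiag X := arr (FinBiproduct.codiag X.as)
  cobang X := arr (FinBiproduct.cobang X.as)
  diag X := arr (FinBiproduct.diag X.as)
  bang X := arr (FinBiproduct.bang X.as)
  codiag_assoc X := congrArg (Quotient.mk _) (FinBiproduct.codiag_assoc X.as)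
  cobang_codiag X := congrArg (Quotient.mk _) (FinBiproduct.cobang_codiag X.as)
  braiding_codiag X := congrArg (Quotient.mk _) (FinBiproduct.braiding_codiag X.as)
  diag_assoc X := congrArg (Quotient.mk _) (FinBiproduct.diag_assoc X.as)
  diag_bang X := congrArg (Quotient.mk _) (FinBiproduct.diag_bang X.as)
  diag_braiding X := congrArg (Quotient.mk _) (FinBiproduct.diag_braiding X.as)
  codiag_zero := congrArg (Quotient.mk _) (FinBiproduct.codiag_zero (C := C))
  codiag_sum X Y := congrArg (Quotient.mk _) (FinBiproduct.codiag_sum X.as Y.as)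
  cobang_zero := congrArg (Quotient.mk _) (FinBiproduct.cobang_zero (C := C))
  cobang_sum X Y := congrArg (Quotient.mk _) (FinBiproduct.cobang_sum X.as Y.as)
  diag_zero := congrArg (Quotient.mk _) (FinBiproduct.diag_zero (C := C))
  diag_sum X Y := congrArg (Quotient.mk _) (FinBiproduct.diag_sum X.as Y.as)
  bang_zero := congrArg (Quotient.mk _) (FinBiproduct.bang_zero (C := C))
  bang_sum X Y := congrArg (Quotient.mk _) (FinBiproduct.bang_sum X.as Y.as)
  diag_natural := by
    rintro _ _ ⟨f⟩
    exact congrArg (Quotient.mk _) (FinBiproduct.diag_natural f)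
  bang_natural := by
    rintro _ _ ⟨f⟩
    exact congrArg (Quotient.mk _) (FinBiproduct.bang_natural f)
  codiag_natural := by
    rintro _ _ ⟨f⟩
    exact congrArg (Quotient.mk _) (FinBiproduct.codiag_natural f)
  cobang_natural := by
    rintro _ _ ⟨f⟩
    exact congrArg (Quotient.mk _) (FinBiproduct.cobang_natural f)

theorem isFB_functor [FinBiproduct C] : IsFB (functor R) where
  obj_zero := rfl
  obj_sum _ _ := rfl
  map_sum _ _ := ((Category.id_comp _).trans (Category.comp_id _)).symm
  map_braiding _ _ := ((Category.id_comp _).trans (Category.comp_id _)).symm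
  map_codiag _ := (Category.id_comp _).symm
  map_cobang _ := (Category.id_comp _).symm
  map_diag _ := (Category.comp_id _).symm
  map_bang _ := (Category.comp_id _).symm

variable {D : Type u} [Category.{u} D] [MonoidalCategory D] [SymmetricCategory D] {F : C ⥤ D}
  (h : ∀ {X Y : C} (f g : X ⟶ Y), R.rel f g → F.map f = F.map g)

theorem isFB_lift [FinBiproduct C] [FinBiproduct D] (hF : IsFB F) : IsFB (lift F h) where
  obj_zero := hF.obj_zero
  obj_sum X Y := hF.obj_sum X.as Y.as
  map_sum := by
    rintro _ _ _ _ ⟨f⟩ ⟨g⟩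
    exact hF.map_sum f g
  map_braiding X Y := hF.map_braiding X.as Y.as
  map_codiag X := hF.map_codiag X.as
  map_cobang X := hF.map_cobang X.as
  map_diag X := hF.map_diag X.as
  map_bang X := hF.map_bang X.as

end Quo

/-! ## Idempotent convolution -/

section Idempotent

section

variable {C : Type u} [Category.{u} C] [MonoidalCategory C] [SymmetricCategory C] [FinBiproduct C]

variable (C) in
/-- The idempotency congruence. -/
def idCongruence : MonoidalCongruence C where
  rel := IdCong
  equivalence _ _ := ⟨.refl, .symm, .trans⟩
  comp := .comp
  sum := .sum

/-- The generating pair becomes equal because convolution is already idempotent in the target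
(`diag_codiag_eq_id`); the closure rules follow from strict monoidality of the functor. -/
theorem IdCong.map_eq {D : Type u} [Category.{u} D] [MonoidalCategory D] [SymmetricCategory D]
    [FinBiproduct D] [PosetEnriched D] [AdjointBiproduct D] {F : C ⥤ D} (hF : IsFB F) {X Y : C}
    {f g : X ⟶ Y} (h : IdCong f g) : F.map f = F.map g := by
  induction h with
  | idem X =>
    rw [F.map_comp, hF.map_diag, hF.map_codiag, F.map_id, ← diag_codiag_eq_id]
    simp
  | refl => rfl
  | trans _ _ h₁ h₂ => exact h₁.trans h₂
  | symm _ h => exact h.symm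
  | comp _ _ h₁ h₂ => rw [F.map_comp, F.map_comp, h₁, h₂]
  | sum _ _ h₁ h₂ => rw [hF.map_sum, hF.map_sum, h₁, h₂]

theorem quo_idem (X : Quo (idCongruence C)) :
    FinBiproduct.diag X ≫ FinBiproduct.codiag X = 𝟙 X :=
  Quotient.sound (IdCong.idem X.as)

end

/-- The free finite biproduct category with idempotent convolution. -/
def idObj (C : FBCat.{u}) : FIBCat.{u} :=
  letI := posetEnrichedOfIdem (quo_idem (C := C.carrier))
  haveI := adjointBiproduct_of_idem (quo_idem (C := C.carrier))
  { carrier := Quo (idCongruence C.carrier) }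

/-- The quotient functor to the free finite biproduct category with idempotent convolution. -/
def idUnit (C : FBCat.{u}) : C ⟶ (idObj C).toFBCat where
  functor := Quo.functor (idCongruence C.carrier)
  isFB := Quo.isFB_functor

theorem IdCong.map_fbHom {C : FBCat.{u}} {D : FIBCat.{u}} (F : FBHom C D.toFBCat) {X Y : C.carrier}
    {f g : X ⟶ Y} (h : IdCong f g) : F.functor.map f = F.functor.map g :=
  IdCong.map_eq F.isFB h

theorem FBHom.preservesOrder {C D : FIBCat.{u}} (F : FBHom C.toFBCat D.toFBCat) :
    PreservesOrder F.functor :=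
  IsFB.preservesOrder F.isFB

/-- The universal property of the quotient by the idempotency congruence. -/
def idEquiv (C : FBCat.{u}) (D : FIBCat.{u}) :
    (idObj C ⟶ D) ≃ (C ⟶ FIBCat.forget.obj D) where
  toFun G := idUnit C ≫ FIBCat.forget.map G
  invFun F :=
    have hL : IsFB (C := Quo (idCongruence C.carrier))
        (Quo.lift F.functor fun _ _ h => IdCong.map_fbHom F h) := Quo.isFB_lift _ F.isFB
    { functor := Quo.lift F.functor fun _ _ h => IdCong.map_fbHom F h
      isFB := hL
      mono := FBHom.preservesOrder (C := idObj C) (D := D) ⟨_, hL⟩ }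
  left_inv G := FIBHom.ext (Quo.lift_functor G.functor fun _ _ h =>
    IdCong.map_fbHom (D := D) (idUnit C ≫ FIBCat.forget.map G) h)
  right_inv _ := rfl

/-- The free finite biproduct category with idempotent convolution, as a functor. -/
def idFree : FBCat.{u} ⥤ FIBCat.{u} :=
  Adjunction.leftAdjointOfEquiv (G := FIBCat.forget) idEquiv fun _ _ _ _ _ => rfl

/-- Identification of idempotent convolution is left adjoint to the forgetful functor. -/
def idAdj : idFree.{u} ⊣ FIBCat.forget :=
  Adjunction.adjunctionOfEquivLeft (G := FIBCat.forget) idEquiv fun _ _ _ _ _ => rfl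

end Idempotent

/-! ## Traces and strict monoidal functors -/

section MapLoop

variable {C D : Type u} [Category.{u} C] [Category.{u} D]
  [MonoidalCategory C] [MonoidalCategory D] [SymmetricCategory C] [SymmetricCategory D] {F : C ⥤ D}

theorem IsStrictSymmetric.map_whiskerRight (hF : IsStrictSymmetric F) {X Y : C} (f : X ⟶ Y)
    (Z : C) : F.map (f ▷ Z) =
      eqToHom (hF.obj_sum X Z) ≫ (F.map f ▷ F.obj Z) ≫ eqToHom (hF.obj_sum Y Z).symm := by
  rw [← tensorHom_id, hF.map_sum, F.map_id, tensorHom_id]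

/-- With `whiskerRight_comp_mapLoop`, this puts both sides of a uniformity premise under `F.map`
between the same casts, so that a relation established in the image transfers at once. -/
theorem mapLoop_comp_whiskerRight (hF : IsStrictSymmetric F) {S T X Y : C} (f : S ⊗ X ⟶ S ⊗ Y)
    (w : S ⟶ T) : mapLoop hF f ≫ (F.map w ▷ F.obj Y) =
      eqToHom (hF.obj_sum S X).symm ≫ F.map (f ≫ (w ▷ Y)) ≫ eqToHom (hF.obj_sum T Y) := by
  simp [mapLoop, hF.map_whiskerRight]

theorem whiskerRight_comp_mapLoop (hF : IsStrictSymmetric F) {S T X Y : C} (f : T ⊗ X ⟶ T ⊗ Y)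
    (w : S ⟶ T) : (F.map w ▷ F.obj X) ≫ mapLoop hF f =
      eqToHom (hF.obj_sum S X).symm ≫ F.map ((w ▷ X) ≫ f) ≫ eqToHom (hF.obj_sum T Y) := by
  simp [mapLoop, hF.map_whiskerRight]

end MapLoop

/-! ## Quotients of traced categories -/

section QuoTrace

variable {C : Type u} [Category.{u} C] [MonoidalCategory C] [SymmetricCategory C] [Traced C]
  {R : MonoidalCongruence C}

/-- The trace of a quotient by a congruence that is compatible with traces. -/
@[reducible]
def Quo.traced (h : ∀ {S X Y : C} {f g : S ⊗ X ⟶ S ⊗ Y},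
    R.rel f g → R.rel (Traced.tr S f) (Traced.tr S g)) : Traced (Quo R) where
  tr S := Quotient.map (Traced.tr S.as) fun _ _ hfg => h hfg
  tightening := by
    rintro S _ _ _ _ ⟨w⟩ ⟨f⟩ ⟨v⟩
    exact congrArg (Quotient.mk _) (Traced.tightening S.as w f v)
  strength := by
    rintro S _ _ _ _ ⟨f⟩ ⟨g⟩
    exact congrArg (Quotient.mk _) (Traced.strength S.as f g)
  joining := by
    rintro S T _ _ ⟨f⟩
    exact congrArg (Quotient.mk _) (Traced.joining S.as T.as f)
  vanishing := by
    rintro _ _ ⟨f⟩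
    exact congrArg (Quotient.mk _) (Traced.vanishing f)
  sliding := by
    rintro _ _ _ _ ⟨f⟩ ⟨w⟩
    exact congrArg (Quotient.mk _) (Traced.sliding f w)
  yanking S := congrArg (Quotient.mk _) (Traced.yanking S.as)

end QuoTrace

/-! ## The Kleene quotient -/

section Kleene

section

variable {C : Type u} [Category.{u} C] [MonoidalCategory C] [SymmetricCategory C]
  [FinBiproduct C] [PosetEnriched C] [Traced C]

variable (C) in
/-- The Kleene congruence. -/
def kleeneCongruence : MonoidalCongruence C where
  rel := KleeneCong
  equivalence _ _ := ⟨.refl, .symm, .trans⟩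
  comp := .comp
  sum := .sum

/-- The relation `f ≲ g` stands for a congruence of `conv f g` with `g`, and in a Kleene bicategory
equality of these two is exactly `≤`. Each rule of the congruence thus becomes an axiom or a
consequence of the axioms of the target. -/
theorem KleeneCong.map_eq {D : Type u} [Category.{u} D] [MonoidalCategory D] [SymmetricCategory D]
    [FinBiproduct D] [PosetEnriched D] [AdjointBiproduct D] [Traced D] [KleeneTrace D]
    [AdjointBiproduct C]
    {F : C ⥤ D} (hF : IsFB F) (hT : PreservesTrace hF.toIsStrictSymmetric) {X Y : C}
    {f g : X ⟶ Y} (h : KleeneCong f g) : F.map f = F.map g := by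
  have hle : ∀ {X Y : C} {f g : X ⟶ Y}, F.map (conv f g) = F.map g ↔ F.map f ≤ F.map g := by
    intro X Y f g
    rw [le_iff_conv]
    exact ⟨(hF.map_add f g).symm.trans, (hF.map_add f g).trans⟩
  induction h with
  | refl => rfl
  | trans _ _ h₁ h₂ => exact h₁.trans h₂
  | symm _ h => exact h.symm
  | comp _ _ h₁ h₂ => rw [F.map_comp, F.map_comp, h₁, h₂]
  | sum _ _ h₁ h₂ => rw [hF.map_sum, hF.map_sum, h₁, h₂]
  | trace _ h => rw [hT, hT, mapLoop, mapLoop, h]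
  | le h => exact congrArg F.map (le_iff_conv.1 h)
  | trace_le_id X =>
    have e : mapLoop hF.toIsStrictSymmetric (FinBiproduct.codiag X ≫ FinBiproduct.diag X) =
        FinBiproduct.codiag (F.obj X) ≫ FinBiproduct.diag (F.obj X) := by
      rw [mapLoop, F.map_comp, hF.map_codiag, hF.map_diag]
      simp
    rw [hle, hT, F.map_id, e]
    exact KleeneTrace.trace_codiag_diag _
  | le_trans _ _ h₁ h₂ => exact hle.2 ((hle.1 h₁).trans (hle.1 h₂))
  | le_comp _ _ h₁ h₂ =>
    rw [hle, F.map_comp, F.map_comp]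
    exact PosetEnriched.comp_mono (hle.1 h₁) (hle.1 h₂)
  | le_sum _ _ h₁ h₂ =>
    rw [hle, hF.map_sum, hF.map_sum]
    exact PosetEnriched.comp_mono le_rfl
      (PosetEnriched.comp_mono (PosetEnriched.tensor_mono (hle.1 h₁) (hle.1 h₂)) le_rfl)
  | @uniform_right S T X Y w v f g _ _ h₁ h₂ =>
    rw [hle, hT, hT]
    -- The two congruent simulations `w` and `v` have the same image by `h₁`, so the one-arrow axiom
    -- applies.
    refine KleeneTrace.uniform_right _ _ (F.map w) ?_
    rw [mapLoop_comp_whiskerRight, h₁, whiskerRight_comp_mapLoop]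
    exact PosetEnriched.comp_mono le_rfl (PosetEnriched.comp_mono (hle.1 h₂) le_rfl)
  | @uniform_left S T X Y w v f g _ _ h₁ h₂ =>
    rw [hle, hT, hT]
    refine KleeneTrace.uniform_left _ _ (F.map w) ?_
    rw [mapLoop_comp_whiskerRight, h₁, whiskerRight_comp_mapLoop]
    exact PosetEnriched.comp_mono le_rfl (PosetEnriched.comp_mono (hle.1 h₂) le_rfl)

instance quoKleeneTraced : Traced (Quo (kleeneCongruence C)) := Quo.traced .trace

theorem quo_functor_preservesTrace : PreservesTrace
    (Quo.isFB_functor : IsFB (Quo.functor (kleeneCongruence C))).toIsStrictSymmetric := by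
  intro S X Y f
  have h : mapLoop (Quo.isFB_functor : IsFB (Quo.functor (kleeneCongruence C))).toIsStrictSymmetric
      f = (Quo.functor (kleeneCongruence C)).map f :=
    (Category.id_comp _).trans (Category.comp_id _)
  rw [h]
  rfl

variable [AdjointBiproduct C]

theorem quo_kleene_idem (X : Quo (kleeneCongruence C)) :
    FinBiproduct.diag X ≫ FinBiproduct.codiag X = 𝟙 X :=
  congrArg (Quotient.mk _) (diag_codiag_eq_id X.as)

/-- The order on classes is `conv f g = g`, so the rules of the congruence are the axioms read
through `Quotient.exact` and `Quotient.sound`. A single representative `r` serves as both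
simulations. -/
theorem quo_kleeneTrace :
    letI := posetEnrichedOfIdem (quo_kleene_idem (C := C))
    KleeneTrace (Quo (kleeneCongruence C)) :=
  letI := posetEnrichedOfIdem (quo_kleene_idem (C := C))
  { trace_codiag_diag := fun X => Quotient.sound (KleeneCong.trace_le_id X.as)
    uniform_right := by
      rintro S T X Y ⟨f⟩ ⟨g⟩ ⟨r⟩ h
      exact Quotient.sound (KleeneCong.uniform_right (.refl r) (Quotient.exact h))
    uniform_left := by
      rintro S T X Y ⟨f⟩ ⟨g⟩ ⟨r⟩ h
      exact Quotient.sound (KleeneCong.uniform_left (.refl r) (Quotient.exact h)) }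

end

/-- The free Kleene bicategory on a uniformly traced category. -/
def kleeneObj (C : UTFIBCat.{u}) : KBicat.{u} :=
  letI := posetEnrichedOfIdem (quo_kleene_idem (C := C.carrier))
  haveI := adjointBiproduct_of_idem (quo_kleene_idem (C := C.carrier))
  haveI := quo_kleeneTrace (C := C.carrier)
  { carrier := Quo (kleeneCongruence C.carrier) }

/-- The quotient functor to the free Kleene bicategory, without its trace. -/
def kleeneFBHom (C : UTFIBCat.{u}) : FBHom C.toFBCat (kleeneObj C).toFBCat where
  functor := Quo.functor (kleeneCongruence C.carrier)
  isFB := Quo.isFB_functor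

/-- The quotient functor to the free Kleene bicategory. -/
def kleeneUnit (C : UTFIBCat.{u}) : C ⟶ KBicat.incl.obj (kleeneObj C) where
  toFBHom := kleeneFBHom C
  mono := FBHom.preservesOrder (C := C.toFIBCat) (D := (kleeneObj C).toFIBCat) (kleeneFBHom C)
  trace := quo_functor_preservesTrace

theorem KleeneCong.map_hom {C : UTFIBCat.{u}} {D : KBicat.{u}} (F : FIBHom C.toFIBCat D.toFIBCat)
    (hT : PreservesTrace F.isFB.toIsStrictSymmetric) {X Y : C.carrier} {f g : X ⟶ Y}
    (h : KleeneCong f g) : F.functor.map f = F.functor.map g :=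
  KleeneCong.map_eq F.isFB hT h

/-- The universal property of the quotient by the Kleene congruence. -/
def kleeneEquiv (C : UTFIBCat.{u}) (D : KBicat.{u}) :
    (kleeneObj C ⟶ D) ≃ (C ⟶ KBicat.incl.obj D) where
  toFun G := kleeneUnit C ≫ KBicat.incl.map G
  invFun F :=
    have hL : IsFB (C := Quo (kleeneCongruence C.carrier))
        (Quo.lift F.functor fun _ _ h => KleeneCong.map_hom (D := D) F.toFIBHom F.trace h) :=
      Quo.isFB_lift _ F.isFB
    { functor := Quo.lift F.functor fun _ _ h => KleeneCong.map_hom (D := D) F.toFIBHom F.trace h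
      isFB := hL
      mono := FBHom.preservesOrder (C := (kleeneObj C).toFIBCat) (D := D.toFIBCat) ⟨_, hL⟩
      trace := by
        rintro S X Y ⟨f⟩
        exact F.trace f }
  left_inv G := KHom.ext (Quo.lift_functor G.functor fun _ _ h =>
    KleeneCong.map_hom (D := D) (kleeneUnit C ≫ KBicat.incl.map G).toFIBHom
      (kleeneUnit C ≫ KBicat.incl.map G).trace h)
  right_inv _ := rfl

/-- The free Kleene bicategory, as a functor. -/
def kleeneFree : UTFIBCat.{u} ⥤ KBicat.{u} :=
  Adjunction.leftAdjointOfEquiv (G := KBicat.incl) kleeneEquiv fun _ _ _ _ _ => rfl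

/-- The Kleene quotient is left adjoint to the inclusion. -/
def kleeneAdj : kleeneFree.{u} ⊣ KBicat.incl :=
  Adjunction.adjunctionOfEquivLeft (G := KBicat.incl) kleeneEquiv fun _ _ _ _ _ => rfl

end Kleene

/-! ## Formal traces in matrix form -/

section FormalTraceMatrix

variable {C : Type u} [Category.{u} C] [MonoidalCategory C] [SymmetricCategory C] [FinBiproduct C]

/-- The formal trace of a matrix. -/
def FormalTrace.mat {X Y : C} (S : C) (a : S ⟶ S) (b : S ⟶ Y) (c : X ⟶ S) (d : X ⟶ Y) :
    FormalTrace X Y :=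
  ⟨S, desc (lift a b) (lift c d)⟩

namespace FormalTrace

theorem exists_mat {X Y : C} (f : FormalTrace X Y) :
    ∃ (S : C) (a : S ⟶ S) (b : S ⟶ Y) (c : X ⟶ S) (d : X ⟶ Y), f = mat S a b c d := by
  obtain ⟨S, f⟩ := f
  obtain ⟨a, b, c, d, rfl⟩ := eq_matrix f
  exact ⟨S, a, b, c, d, rfl⟩

theorem of_eq_mat {X Y : C} (f : X ⟶ Y) : of f = mat (𝟙_ C) 0 0 0 f := by
  unfold of mat
  congr 1
  apply hom_ext <;> simp

/-- These are the blocks of two automata in series: the second state receives the output of the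
first, and nothing flows back, whence the zero block. -/
theorem mat_comp_mat {X Y Z S T : C} (a : S ⟶ S) (b : S ⟶ Y) (c : X ⟶ S) (d : X ⟶ Y)
    (a' : T ⟶ T) (b' : T ⟶ Z) (c' : Y ⟶ T) (d' : Y ⟶ Z) :
    (mat S a b c d).comp (mat T a' b' c' d') =
      mat (S ⊗ T) (desc (lift a (b ≫ c')) (lift 0 a')) (desc (b ≫ d') b') (lift c (d ≫ c'))
        (d ≫ d') := by
  unfold comp mat
  congr 1
  refine desc_ext (desc_ext (lift_ext (lift_ext ?_ ?_) ?_) (lift_ext (lift_ext ?_ ?_) ?_))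
    (lift_ext (lift_ext ?_ ?_) ?_) <;> simp <;> simp [lift_eq_add]

theorem mat_sum_mat {X Y X' Y' S T : C} (a : S ⟶ S) (b : S ⟶ Y) (c : X ⟶ S) (d : X ⟶ Y)
    (a' : T ⟶ T) (b' : T ⟶ Y') (c' : X' ⟶ T) (d' : X' ⟶ Y') :
    (mat S a b c d).sum (mat T a' b' c' d') =
      mat (S ⊗ T) (a ⊗ₘ a') (b ⊗ₘ b') (c ⊗ₘ c') (d ⊗ₘ d') := by
  unfold sum mat
  congr 1
  refine desc_ext (desc_ext (lift_ext (lift_ext ?_ ?_) (lift_ext ?_ ?_))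
    (lift_ext (lift_ext ?_ ?_) (lift_ext ?_ ?_))) (desc_ext (lift_ext (lift_ext ?_ ?_)
    (lift_ext ?_ ?_)) (lift_ext (lift_ext ?_ ?_) (lift_ext ?_ ?_))) <;> simp [tensorμ]

/-- Feedback turns the summand `T` from an input and output into a component of the state. -/
theorem tr_mat {T X Y S : C} (a : S ⟶ S) (b : S ⟶ T ⊗ Y) (c : T ⊗ X ⟶ S) (d : T ⊗ X ⟶ T ⊗ Y) :
    tr T (mat S a b c d) =
      mat (S ⊗ T) (desc (lift a (b ≫ fst T Y)) (lift (inl T X ≫ c) (inl T X ≫ d ≫ fst T Y)))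
        (desc (b ≫ snd T Y) (inl T X ≫ d ≫ snd T Y))
        (lift (inr T X ≫ c) (inr T X ≫ d ≫ fst T Y)) (inr T X ≫ d ≫ snd T Y) := by
  unfold tr mat
  congr 1
  refine desc_ext (desc_ext (lift_ext (lift_ext ?_ ?_) ?_) (lift_ext (lift_ext ?_ ?_) ?_))
    (lift_ext (lift_ext ?_ ?_) ?_) <;> simp

end FormalTrace

namespace UniformCong

open FormalTrace

/-- Formal traces over isomorphic objects are congruent. -/
theorem of_iso {X Y S T : C} {a : S ⟶ S} {b : S ⟶ Y} {c : X ⟶ S} {d : X ⟶ Y}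
    {a' : T ⟶ T} {b' : T ⟶ Y} {c' : X ⟶ T} {d' : X ⟶ Y} (e : S ≅ T)
    (ha : a ≫ e.hom = e.hom ≫ a') (hb : b = e.hom ≫ b') (hc : c ≫ e.hom = c') (hd : d = d') :
    UniformCong (mat S a b c d) (mat T a' b' c' d') := by
  have h := UniformCong.sliding (desc (lift (a' ≫ e.inv) b') (lift (c' ≫ e.inv) d')) e.hom
  have h1 : desc (lift (a' ≫ e.inv) b') (lift (c' ≫ e.inv) d') ≫ (e.hom ▷ Y) =
      desc (lift a' b') (lift c' d') := by simp
  have h2 : (e.hom ▷ X) ≫ desc (lift (a' ≫ e.inv) b') (lift (c' ≫ e.inv) d') =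
      desc (lift a b) (lift c d) := by simp [← hc, hb, hd, ← reassoc_of% ha]
  rw [h1, h2] at h
  exact h.symm

/-- An untraced arrow contributes only the zero object to the state, and the unitor removes it. -/
theorem mat_comp_of {X Y Z S : C} (a : S ⟶ S) (b : S ⟶ Y) (c : X ⟶ S) (d : X ⟶ Y) (f : Y ⟶ Z) :
    UniformCong ((mat S a b c d).comp (of f)) (mat S a (b ≫ f) c (d ≫ f)) := by
  rw [of_eq_mat, mat_comp_mat]
  refine of_iso (ρ_ S) ?_ ?_ ?_ rfl
  · apply desc_ext <;> simp
  · apply desc_ext <;> simp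
  · simp

theorem of_comp_mat {X Y Z S : C} (a : S ⟶ S) (b : S ⟶ Z) (c : Y ⟶ S) (d : Y ⟶ Z) (f : X ⟶ Y) :
    UniformCong ((of f).comp (mat S a b c d)) (mat S a b (f ≫ c) (f ≫ d)) := by
  rw [of_eq_mat, mat_comp_mat]
  refine of_iso (λ_ S) ?_ ?_ ?_ rfl
  · apply desc_ext <;> simp
  · apply desc_ext <;> simp
  · simp

theorem of_comp_of {X Y Z : C} (f : X ⟶ Y) (g : Y ⟶ Z) :
    UniformCong ((of f).comp (of g)) (of (f ≫ g)) := by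
  have h := mat_comp_of (S := 𝟙_ C) 0 0 0 f g
  rwa [zero_comp', ← of_eq_mat, ← of_eq_mat] at h

theorem of_sum_mat {X Y X' Y' S : C} (a : S ⟶ S) (b : S ⟶ Y) (c : X ⟶ S) (d : X ⟶ Y)
    (f : X' ⟶ Y') : UniformCong ((of f).sum (mat S a b c d))
      (mat S a (b ≫ inr Y' Y) (snd X' X ≫ c) (f ⊗ₘ d)) := by
  rw [of_eq_mat, mat_sum_mat]
  refine of_iso (λ_ S) ?_ ?_ ?_ rfl
  · apply desc_ext <;> simp
  · apply desc_ext <;> simp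
  · simp

theorem mat_sum_of {X Y X' Y' S : C} (a : S ⟶ S) (b : S ⟶ Y) (c : X ⟶ S) (d : X ⟶ Y)
    (f : X' ⟶ Y') : UniformCong ((mat S a b c d).sum (of f))
      (mat S a (b ≫ inl Y Y') (fst X X' ≫ c) (d ⊗ₘ f)) := by
  rw [of_eq_mat, mat_sum_mat]
  refine of_iso (ρ_ S) ?_ ?_ ?_ rfl
  · apply desc_ext <;> simp
  · apply desc_ext <;> simp
  · simp

theorem of_sum_of {X Y X' Y' : C} (f : X ⟶ Y) (g : X' ⟶ Y') :
    UniformCong ((of f).sum (of g)) (of (f ⊗ₘ g)) := by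
  have h := of_sum_mat (S := 𝟙_ C) 0 0 0 g f
  rwa [zero_comp', comp_zero', ← of_eq_mat, ← of_eq_mat] at h

/-- Every formal trace is thus congruent to the trace of an untraced arrow. This reduces `uniform`
to the general uniformity rule and later gives uniqueness of extensions. -/
theorem tr_of {S X Y : C} (a : S ⟶ S) (b : S ⟶ Y) (c : X ⟶ S) (d : X ⟶ Y) :
    UniformCong (FormalTrace.tr S (of (desc (lift a b) (lift c d)))) (mat S a b c d) := by
  rw [of_eq_mat, tr_mat]
  refine of_iso (λ_ S) ?_ ?_ ?_ ?_
  · apply desc_ext <;> simp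
  · apply desc_ext <;> simp
  · simp
  · simp

/-- Uniformity for formal traces in matrix form. -/
theorem uniform {X Y S T : C} {a : S ⟶ S} {b : S ⟶ Y} {c : X ⟶ S} {d : X ⟶ Y}
    {a' : T ⟶ T} {b' : T ⟶ Y} {c' : X ⟶ T} {d' : X ⟶ Y} (r : S ⟶ T)
    (ha : a ≫ r = r ≫ a') (hb : b = r ≫ b') (hc : c ≫ r = c') (hd : d = d') :
    UniformCong (mat S a b c d) (mat T a' b' c' d') := by
  refine (tr_of a b c d).symm.trans (UniformCong.trans ?_ (tr_of a' b' c' d'))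
  -- The rule takes formal traces as simulations; for an arrow of `C` both are chosen as `of r`, and
  -- the premise reduces to an equation of matrices in `C` because `of` respects composition and
  -- sums up to congruence.
  refine UniformCong.uniformity (w := of r) (v := of r) (.refl _) ?_
  have h : desc (lift a b) (lift c d) ≫ (r ⊗ₘ 𝟙 Y) =
      (r ⊗ₘ 𝟙 X) ≫ desc (lift a' b') (lift c' d') := by simp [ha, hb, hc, hd]
  have h1 := (UniformCong.comp (.refl (of (desc (lift a b) (lift c d))))
    (of_sum_of r (𝟙 Y))).trans (of_comp_of _ _)
  have h2 := (UniformCong.comp (of_sum_of r (𝟙 X))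
    (.refl (of (desc (lift a' b') (lift c' d'))))).trans (of_comp_of _ _)
  rw [h] at h1
  exact h1.trans h2.symm

end UniformCong

end FormalTraceMatrix

/-! ## The free uniformly traced category -/

/-- The free uniformly traced category: its arrows are classes of formal traces. -/
@[ext]
structure FreeTraced (C : Type u) : Type u where
  ob ::
  as : C

namespace FreeTraced

section Basic

variable {C : Type u} [Category.{u} C] [MonoidalCategory C] [SymmetricCategory C]

/-- The congruence on formal traces. -/
@[reducible]
def setoid (X Y : C) : Setoid (FormalTrace X Y) := ⟨UniformCong, ⟨.refl, .symm, .trans⟩⟩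

instance categoryStruct : CategoryStruct.{u} (FreeTraced C) where
  Hom X Y := Quotient (setoid X.as Y.as)
  id X := Quotient.mk _ (.of (𝟙 X.as))
  comp := Quotient.map₂ .comp fun _ _ h _ _ h' => UniformCong.comp h h'

/-- The class of a formal trace. -/
def cls {X Y : FreeTraced C} (f : FormalTrace X.as Y.as) : X ⟶ Y := Quotient.mk _ f

theorem cls_eq_iff {X Y : FreeTraced C} (f g : FormalTrace X.as Y.as) :
    (cls f : X ⟶ Y) = cls g ↔ UniformCong f g :=
  ⟨fun h => Quotient.exact h, fun h => Quotient.sound h⟩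

theorem exists_cls {X Y : FreeTraced C} (f : X ⟶ Y) : ∃ g : FormalTrace X.as Y.as, cls g = f :=
  Quotient.exists_rep f

/-- The class of an arrow. -/
def arr {X Y : FreeTraced C} (f : X.as ⟶ Y.as) : X ⟶ Y := cls (.of f)

theorem arr_eqToHom {X Y : FreeTraced C} (h : X.as = Y.as) :
    (arr (eqToHom h) : X ⟶ Y) = eqToHom (FreeTraced.ext h) := by
  obtain ⟨X⟩ := X
  obtain ⟨Y⟩ := Y
  obtain rfl : X = Y := h
  rfl

theorem arr_id (X : FreeTraced C) : (arr (𝟙 X.as) : X ⟶ X) = 𝟙 X := rfl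

end Basic

variable {C : Type u} [Category.{u} C] [MonoidalCategory C] [SymmetricCategory C] [FinBiproduct C]

/-- The class of a formal trace in matrix form. -/
def mat {X Y : FreeTraced C} (S : C) (a : S ⟶ S) (b : S ⟶ Y.as) (c : X.as ⟶ S)
    (d : X.as ⟶ Y.as) : X ⟶ Y :=
  cls (.mat S a b c d)

theorem exists_mat {X Y : FreeTraced C} (f : X ⟶ Y) :
    ∃ (S : C) (a : S ⟶ S) (b : S ⟶ Y.as) (c : X.as ⟶ S) (d : X.as ⟶ Y.as), f = mat S a b c d := by
  obtain ⟨f, rfl⟩ := exists_cls f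
  obtain ⟨S, a, b, c, d, rfl⟩ := f.exists_mat
  exact ⟨S, a, b, c, d, rfl⟩

/-- Uniformity for arrows in matrix form. -/
theorem mat_eq_mat {X Y : FreeTraced C} {S T : C} {a : S ⟶ S} {b : S ⟶ Y.as} {c : X.as ⟶ S}
    {d : X.as ⟶ Y.as} {a' : T ⟶ T} {b' : T ⟶ Y.as} {c' : X.as ⟶ T} {d' : X.as ⟶ Y.as} (r : S ⟶ T)
    (ha : a ≫ r = r ≫ a') (hb : b = r ≫ b') (hc : c ≫ r = c') (hd : d = d') :
    (mat S a b c d : X ⟶ Y) = mat T a' b' c' d' :=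
  Quotient.sound (UniformCong.uniform r ha hb hc hd)

theorem mat_comp_mat {X Y Z : FreeTraced C} {S T : C} (a : S ⟶ S) (b : S ⟶ Y.as) (c : X.as ⟶ S)
    (d : X.as ⟶ Y.as) (a' : T ⟶ T) (b' : T ⟶ Z.as) (c' : Y.as ⟶ T) (d' : Y.as ⟶ Z.as) :
    (mat S a b c d : X ⟶ Y) ≫ (mat T a' b' c' d' : Y ⟶ Z) =
      mat (S ⊗ T) (desc (lift a (b ≫ c')) (lift 0 a')) (desc (b ≫ d') b') (lift c (d ≫ c'))
        (d ≫ d') :=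
  congrArg cls (FormalTrace.mat_comp_mat a b c d a' b' c' d')

theorem mat_comp_arr {X Y Z : FreeTraced C} {S : C} (a : S ⟶ S) (b : S ⟶ Y.as) (c : X.as ⟶ S)
    (d : X.as ⟶ Y.as) (f : Y.as ⟶ Z.as) :
    (mat S a b c d : X ⟶ Y) ≫ (arr f : Y ⟶ Z) = mat S a (b ≫ f) c (d ≫ f) :=
  Quotient.sound (UniformCong.mat_comp_of a b c d f)

theorem arr_comp_mat {X Y Z : FreeTraced C} {S : C} (a : S ⟶ S) (b : S ⟶ Z.as) (c : Y.as ⟶ S)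
    (d : Y.as ⟶ Z.as) (f : X.as ⟶ Y.as) :
    (arr f : X ⟶ Y) ≫ (mat S a b c d : Y ⟶ Z) = mat S a b (f ≫ c) (f ≫ d) :=
  Quotient.sound (UniformCong.of_comp_mat a b c d f)

theorem arr_comp_arr {X Y Z : FreeTraced C} (f : X.as ⟶ Y.as) (g : Y.as ⟶ Z.as) :
    (arr f : X ⟶ Y) ≫ (arr g : Y ⟶ Z) = arr (f ≫ g) :=
  Quotient.sound (UniformCong.of_comp_of f g)

instance category : Category.{u} (FreeTraced C) where
  id_comp {X Y} f := by
    obtain ⟨S, a, b, c, d, rfl⟩ := exists_mat f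
    refine (arr_comp_mat a b c d (𝟙 X.as)).trans ?_
    rw [Category.id_comp, Category.id_comp]
  comp_id {X Y} f := by
    obtain ⟨S, a, b, c, d, rfl⟩ := exists_mat f
    refine (mat_comp_arr a b c d (𝟙 Y.as)).trans ?_
    rw [Category.comp_id, Category.comp_id]
  assoc f g h := by
    obtain ⟨S, a, b, c, d, rfl⟩ := exists_mat f
    obtain ⟨S', a', b', c', d', rfl⟩ := exists_mat g
    obtain ⟨S'', a'', b'', c'', d'', rfl⟩ := exists_mat h
    simp only [mat_comp_mat]
    -- The two bracketings carry the states `(S ⊗ S') ⊗ S''` and `S ⊗ (S' ⊗ S'')`; the associator is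
    -- the simulation.
    refine mat_eq_mat (α_ S S' S'').hom ?_ ?_ ?_ (Category.assoc _ _ _)
    · refine desc_ext (desc_ext ?_ ?_) ?_ <;> refine lift_ext ?_ (lift_ext ?_ ?_) <;> simp
    · refine desc_ext (desc_ext ?_ ?_) ?_ <;> simp
    · refine lift_ext ?_ (lift_ext ?_ ?_) <;> simp

/-- Isomorphisms of representatives. -/
def isoArr {X Y : FreeTraced C} (e : X.as ≅ Y.as) : X ≅ Y where
  hom := arr e.hom
  inv := arr e.inv
  hom_inv_id := by rw [arr_comp_arr, e.hom_inv_id, arr_id]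
  inv_hom_id := by rw [arr_comp_arr, e.inv_hom_id, arr_id]

instance monoidalStruct : MonoidalCategoryStruct (FreeTraced C) where
  tensorObj X Y := ⟨X.as ⊗ Y.as⟩
  tensorUnit := ⟨𝟙_ C⟩
  tensorHom := Quotient.map₂ .sum fun _ _ h _ _ h' => UniformCong.sum h h'
  whiskerLeft X _ _ := Quotient.map (FormalTrace.sum (.of (𝟙 X.as))) fun _ _ h =>
    UniformCong.sum (.refl _) h
  whiskerRight f X := Quotient.map (fun g => FormalTrace.sum g (.of (𝟙 X.as)))
    (fun _ _ h => UniformCong.sum h (.refl _)) f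
  associator X Y Z := isoArr (α_ X.as Y.as Z.as)
  leftUnitor X := isoArr (λ_ X.as)
  rightUnitor X := isoArr (ρ_ X.as)

@[simp]
theorem tensorUnit_as : (𝟙_ (FreeTraced C)).as = 𝟙_ C := rfl

@[simp]
theorem tensorObj_as (X Y : FreeTraced C) : (X ⊗ Y).as = X.as ⊗ Y.as := rfl

theorem mat_tensor_mat {X Y X' Y' : FreeTraced C} {S T : C} (a : S ⟶ S) (b : S ⟶ Y.as)
    (c : X.as ⟶ S) (d : X.as ⟶ Y.as) (a' : T ⟶ T) (b' : T ⟶ Y'.as) (c' : X'.as ⟶ T)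
    (d' : X'.as ⟶ Y'.as) :
    ((mat S a b c d : X ⟶ Y) ⊗ₘ (mat T a' b' c' d' : X' ⟶ Y')) =
      mat (S ⊗ T) (a ⊗ₘ a') (b ⊗ₘ b') (c ⊗ₘ c') (d ⊗ₘ d') :=
  congrArg cls (FormalTrace.mat_sum_mat a b c d a' b' c' d')

theorem arr_tensor_arr {X Y X' Y' : FreeTraced C} (f : X.as ⟶ Y.as) (g : X'.as ⟶ Y'.as) :
    ((arr f : X ⟶ Y) ⊗ₘ (arr g : X' ⟶ Y')) = arr (f ⊗ₘ g) :=
  Quotient.sound (UniformCong.of_sum_of f g)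

theorem whiskerLeft_mat {X Y : FreeTraced C} (Z : FreeTraced C) {S : C} (a : S ⟶ S)
    (b : S ⟶ Y.as) (c : X.as ⟶ S) (d : X.as ⟶ Y.as) :
    (Z ◁ (mat S a b c d : X ⟶ Y)) =
      mat S a (b ≫ inr Z.as Y.as) (snd Z.as X.as ≫ c) (Z.as ◁ d) := by
  rw [← id_tensorHom]
  exact Quotient.sound (UniformCong.of_sum_mat a b c d (𝟙 Z.as))

theorem whiskerRight_mat {X Y : FreeTraced C} (Z : FreeTraced C) {S : C} (a : S ⟶ S)
    (b : S ⟶ Y.as) (c : X.as ⟶ S) (d : X.as ⟶ Y.as) :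
    ((mat S a b c d : X ⟶ Y) ▷ Z) =
      mat S a (b ≫ inl Y.as Z.as) (fst X.as Z.as ≫ c) (d ▷ Z.as) := by
  rw [← tensorHom_id]
  exact Quotient.sound (UniformCong.mat_sum_of a b c d (𝟙 Z.as))

theorem whiskerLeft_arr {X Y : FreeTraced C} (Z : FreeTraced C) (f : X.as ⟶ Y.as) :
    (Z ◁ (arr f : X ⟶ Y)) = arr (Z.as ◁ f) := by
  rw [← id_tensorHom]
  exact Quotient.sound (UniformCong.of_sum_of (𝟙 Z.as) f)

theorem whiskerRight_arr {X Y : FreeTraced C} (Z : FreeTraced C) (f : X.as ⟶ Y.as) :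
    ((arr f : X ⟶ Y) ▷ Z) = arr (f ▷ Z.as) := by
  rw [← tensorHom_id]
  exact Quotient.sound (UniformCong.of_sum_of f (𝟙 Z.as))

theorem associator_hom (X Y Z : FreeTraced C) : (α_ X Y Z).hom = arr (α_ X.as Y.as Z.as).hom := rfl

theorem associator_inv (X Y Z : FreeTraced C) : (α_ X Y Z).inv = arr (α_ X.as Y.as Z.as).inv := rfl

theorem leftUnitor_hom (X : FreeTraced C) : (λ_ X).hom = arr (λ_ X.as).hom := rfl

theorem leftUnitor_inv (X : FreeTraced C) : (λ_ X).inv = arr (λ_ X.as).inv := rfl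

theorem rightUnitor_hom (X : FreeTraced C) : (ρ_ X).hom = arr (ρ_ X.as).hom := rfl

theorem rightUnitor_inv (X : FreeTraced C) : (ρ_ X).inv = arr (ρ_ X.as).inv := rfl

instance monoidal : MonoidalCategory (FreeTraced C) where
  tensorHom_def f g := by
    obtain ⟨S, a, b, c, d, rfl⟩ := exists_mat f
    obtain ⟨S', a', b', c', d', rfl⟩ := exists_mat g
    rw [whiskerRight_mat, whiskerLeft_mat, mat_comp_mat, mat_tensor_mat]
    -- Both sides have the state `S ⊗ S'`, so only the blocks must be compared.
    refine mat_eq_mat (𝟙 _) ?_ ?_ ?_ (MonoidalCategory.tensorHom_def _ _)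
    · apply hom_ext <;> simp
    · apply hom_ext <;> simp
    · apply hom_ext <;> simp
  id_tensorHom_id X Y := by
    refine (arr_tensor_arr _ _).trans ?_
    rw [MonoidalCategory.id_tensorHom_id]
    rfl
  tensorHom_comp_tensorHom f₁ g₁ f₂ g₂ := by
    obtain ⟨S, a, b, c, d, rfl⟩ := exists_mat f₁
    obtain ⟨S', a', b', c', d', rfl⟩ := exists_mat f₂
    obtain ⟨T, p, q, r, s, rfl⟩ := exists_mat g₁
    obtain ⟨T', p', q', r', s', rfl⟩ := exists_mat g₂
    simp only [mat_comp_mat, mat_tensor_mat]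
    -- The states are `(S ⊗ T) ⊗ (S' ⊗ T')` and `(S ⊗ S') ⊗ (T ⊗ T')`; the interchange matches them.
    refine mat_eq_mat (tensorμ S T S' T') ?_ ?_ ?_ (by simp)
    · refine desc_ext (desc_ext ?_ ?_) (desc_ext ?_ ?_) <;>
        refine lift_ext (lift_ext ?_ ?_) (lift_ext ?_ ?_) <;> simp [tensorμ]
    · refine desc_ext (desc_ext ?_ ?_) (desc_ext ?_ ?_) <;> refine lift_ext ?_ ?_ <;>
        simp [tensorμ]
    · refine desc_ext ?_ ?_ <;>
        refine lift_ext (lift_ext ?_ ?_) (lift_ext ?_ ?_) <;> simp [tensorμ]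
  whiskerLeft_id X Y := (whiskerLeft_arr X (𝟙 Y.as)).trans (by simp; rfl)
  id_whiskerRight X Y := (whiskerRight_arr Y (𝟙 X.as)).trans (by simp; rfl)
  associator_naturality f g h := by
    obtain ⟨S, a, b, c, d, rfl⟩ := exists_mat f
    obtain ⟨S', a', b', c', d', rfl⟩ := exists_mat g
    obtain ⟨S'', a'', b'', c'', d'', rfl⟩ := exists_mat h
    rw [mat_tensor_mat, mat_tensor_mat, mat_tensor_mat, mat_tensor_mat, associator_hom,
      associator_hom, mat_comp_arr, arr_comp_mat]
    refine mat_eq_mat (α_ S S' S'').hom ?_ ?_ ?_ ?_ <;>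
      exact MonoidalCategory.associator_naturality _ _ _
  leftUnitor_naturality f := by
    obtain ⟨S, a, b, c, d, rfl⟩ := exists_mat f
    rw [whiskerLeft_mat, leftUnitor_hom, leftUnitor_hom, mat_comp_arr, arr_comp_mat]
    refine mat_eq_mat (𝟙 S) ?_ ?_ ?_ ?_ <;> simp
  rightUnitor_naturality f := by
    obtain ⟨S, a, b, c, d, rfl⟩ := exists_mat f
    rw [whiskerRight_mat, rightUnitor_hom, rightUnitor_hom, mat_comp_arr, arr_comp_mat]
    refine mat_eq_mat (𝟙 S) ?_ ?_ ?_ ?_ <;> simp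
  pentagon W X Y Z := by
    simp only [associator_hom, whiskerLeft_arr, whiskerRight_arr, arr_comp_arr]
    exact congrArg arr (MonoidalCategory.pentagon _ _ _ _)
  triangle X Y := by
    simp only [associator_hom, leftUnitor_hom, rightUnitor_hom, whiskerLeft_arr, whiskerRight_arr,
      arr_comp_arr]
    exact congrArg arr (MonoidalCategory.triangle _ _)

instance strict [Strict C] : Strict (FreeTraced C) where
  assoc_obj X Y Z := FreeTraced.ext (Strict.assoc_obj X.as Y.as Z.as)
  unit_obj X := FreeTraced.ext (Strict.unit_obj X.as)
  obj_unit X := FreeTraced.ext (Strict.obj_unit X.as)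
  associator_eq X Y Z :=
    (congrArg arr (Strict.associator_eq X.as Y.as Z.as)).trans (arr_eqToHom _)
  leftUnitor_eq X := (congrArg arr (Strict.leftUnitor_eq X.as)).trans (arr_eqToHom _)
  rightUnitor_eq X := (congrArg arr (Strict.rightUnitor_eq X.as)).trans (arr_eqToHom _)

end FreeTraced

/-! ### Biproducts and trace of the free category -/

namespace FreeTraced

variable {C : Type u} [Category.{u} C] [MonoidalCategory C] [SymmetricCategory C] [FinBiproduct C]

instance symmetric : SymmetricCategory (FreeTraced C) where
  braiding X Y := isoArr (β_ X.as Y.as)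
  braiding_naturality_right X _ _ f := by
    obtain ⟨S, a, b, c, d, rfl⟩ := exists_mat f
    simp only [isoArr, whiskerLeft_mat, whiskerRight_mat, mat_comp_arr, arr_comp_mat]
    refine mat_eq_mat (𝟙 S) ?_ ?_ ?_ ?_ <;> simp
  braiding_naturality_left f X := by
    obtain ⟨S, a, b, c, d, rfl⟩ := exists_mat f
    simp only [isoArr, whiskerLeft_mat, whiskerRight_mat, mat_comp_arr, arr_comp_mat]
    refine mat_eq_mat (𝟙 S) ?_ ?_ ?_ ?_ <;> simp
  hexagon_forward X Y Z := by
    simp only [isoArr, associator_hom, whiskerLeft_arr, whiskerRight_arr, arr_comp_arr]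
    exact congrArg arr (BraidedCategory.hexagon_forward _ _ _)
  hexagon_reverse X Y Z := by
    simp only [isoArr, associator_inv, whiskerLeft_arr, whiskerRight_arr, arr_comp_arr]
    exact congrArg arr (BraidedCategory.hexagon_reverse _ _ _)
  symmetry X Y := by
    simp only [isoArr, arr_comp_arr]
    exact congrArg arr (SymmetricCategory.symmetry _ _)

theorem braiding_hom (X Y : FreeTraced C) : (β_ X Y).hom = arr (β_ X.as Y.as).hom := rfl

/-- The interchange is built from structural arrows, so the coherence axioms for sums can be
computed on representatives in `C`. -/
theorem tensorμ_eq_arr (X Y Z W : FreeTraced C) :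
    tensorμ X Y Z W = arr (tensorμ X.as Y.as Z.as W.as) := by
  simp only [tensorμ, associator_hom, associator_inv, braiding_hom, whiskerLeft_arr,
    whiskerRight_arr, arr_comp_arr]
  rfl

instance finBiproduct : FinBiproduct (FreeTraced C) where
  codiag X := arr (FinBiproduct.codiag X.as)
  cobang X := arr (FinBiproduct.cobang X.as)
  diag X := arr (FinBiproduct.diag X.as)
  bang X := arr (FinBiproduct.bang X.as)
  codiag_assoc X := by
    simp only [associator_hom, whiskerLeft_arr, whiskerRight_arr, arr_comp_arr]
    exact congrArg arr (FinBiproduct.codiag_assoc X.as)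
  cobang_codiag X := by
    simp only [leftUnitor_hom, whiskerRight_arr, arr_comp_arr]
    exact congrArg arr (FinBiproduct.cobang_codiag X.as)
  braiding_codiag X := by
    simp only [braiding_hom, arr_comp_arr]
    exact congrArg arr (FinBiproduct.braiding_codiag X.as)
  diag_assoc X := by
    simp only [associator_hom, whiskerLeft_arr, whiskerRight_arr, arr_comp_arr]
    exact congrArg arr (FinBiproduct.diag_assoc X.as)
  diag_bang X := by
    simp only [leftUnitor_inv, whiskerRight_arr, arr_comp_arr]
    exact congrArg arr (FinBiproduct.diag_bang X.as)
  diag_braiding X := by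
    simp only [braiding_hom, arr_comp_arr]
    exact congrArg arr (FinBiproduct.diag_braiding X.as)
  codiag_zero := congrArg arr (FinBiproduct.codiag_zero (C := C))
  codiag_sum X Y := by
    simp only [tensorμ_eq_arr, arr_tensor_arr, arr_comp_arr]
    exact congrArg arr (FinBiproduct.codiag_sum X.as Y.as)
  cobang_zero := congrArg arr (FinBiproduct.cobang_zero (C := C))
  cobang_sum X Y := by
    simp only [leftUnitor_inv, arr_tensor_arr, arr_comp_arr]
    exact congrArg arr (FinBiproduct.cobang_sum X.as Y.as)
  diag_zero := congrArg arr (FinBiproduct.diag_zero (C := C))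
  diag_sum X Y := by
    simp only [tensorμ_eq_arr, arr_tensor_arr, arr_comp_arr]
    exact congrArg arr (FinBiproduct.diag_sum X.as Y.as)
  bang_zero := congrArg arr (FinBiproduct.bang_zero (C := C))
  bang_sum X Y := by
    simp only [leftUnitor_hom, arr_tensor_arr, arr_comp_arr]
    exact congrArg arr (FinBiproduct.bang_sum X.as Y.as)
  diag_natural f := by
    obtain ⟨S, a, b, c, d, rfl⟩ := exists_mat f
    rw [mat_tensor_mat, mat_comp_arr, arr_comp_mat]
    -- Here the simulation is not a rearrangement: one copy of the state simulates two along the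
    -- diagonal, and all conditions are naturality of `diag` in `C`.
    refine mat_eq_mat (FinBiproduct.diag S) ?_ ?_ ?_ ?_ <;> exact FinBiproduct.diag_natural _
  bang_natural f := by
    obtain ⟨S, a, b, c, d, rfl⟩ := exists_mat f
    rw [mat_comp_arr, arr, FormalTrace.of_eq_mat]
    -- Once the output is discarded the state is irrelevant; the simulation is the zero arrow to the
    -- zero state.
    exact mat_eq_mat 0 (by simp) (by simp) (by simp) (FinBiproduct.bang_natural _)
  codiag_natural f := by
    obtain ⟨S, a, b, c, d, rfl⟩ := exists_mat f
    rw [mat_tensor_mat, mat_comp_arr, arr_comp_mat]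
    -- The codiagonal merges two states into one, so this simulation runs from right to left.
    refine (mat_eq_mat (FinBiproduct.codiag S) ?_ ?_ ?_ ?_).symm
    · exact (FinBiproduct.codiag_natural _).symm
    · exact (FinBiproduct.codiag_natural _).symm
    · exact (FinBiproduct.codiag_natural _).symm
    · exact (FinBiproduct.codiag_natural _).symm
  cobang_natural f := by
    obtain ⟨S, a, b, c, d, rfl⟩ := exists_mat f
    rw [arr_comp_mat, arr, FormalTrace.of_eq_mat]
    exact (mat_eq_mat 0 (by simp) (by simp) (by simp) (FinBiproduct.cobang_natural _).symm).symm

/-- The trace of a class of formal traces. -/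
def trace (S : FreeTraced C) {X Y : FreeTraced C} : (S ⊗ X ⟶ S ⊗ Y) → (X ⟶ Y) :=
  Quotient.map (FormalTrace.tr S.as) fun _ _ h => UniformCong.trace h

theorem trace_mat (T : FreeTraced C) {X Y : FreeTraced C} {S : C} (a : S ⟶ S)
    (b : S ⟶ T.as ⊗ Y.as) (c : T.as ⊗ X.as ⟶ S) (d : T.as ⊗ X.as ⟶ T.as ⊗ Y.as) :
    trace T (mat S a b c d : T ⊗ X ⟶ T ⊗ Y) =
      mat (S ⊗ T.as) (desc (lift a (b ≫ fst T.as Y.as))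
        (lift (inl T.as X.as ≫ c) (inl T.as X.as ≫ d ≫ fst T.as Y.as)))
        (desc (b ≫ snd T.as Y.as) (inl T.as X.as ≫ d ≫ snd T.as Y.as))
        (lift (inr T.as X.as ≫ c) (inr T.as X.as ≫ d ≫ fst T.as Y.as))
        (inr T.as X.as ≫ d ≫ snd T.as Y.as) :=
  congrArg cls (FormalTrace.tr_mat a b c d)

theorem trace_arr (S : FreeTraced C) {X Y : FreeTraced C} (f : S.as ⊗ X.as ⟶ S.as ⊗ Y.as) :
    trace S (arr f : S ⊗ X ⟶ S ⊗ Y) = (cls ⟨S.as, f⟩ : X ⟶ Y) := by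
  obtain ⟨a, b, c, d, rfl⟩ := eq_matrix f
  exact Quotient.sound (UniformCong.tr_of a b c d)

instance traced : Traced (FreeTraced C) where
  tr S := trace S
  tightening S _ _ _ _ u f v := by
    obtain ⟨U, a, b, c, d, rfl⟩ := exists_mat u
    obtain ⟨V, a', b', c', d', rfl⟩ := exists_mat f
    obtain ⟨W, a'', b'', c'', d'', rfl⟩ := exists_mat v
    simp only [whiskerLeft_mat, mat_comp_mat, trace_mat]
    -- Tracing the whole composite puts `S` last in the state, tracing the middle factor puts it
    -- next to `V`; the simulation rebrackets and moves `S` past `W`.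
    refine mat_eq_mat ((α_ U (V ⊗ W) S.as).hom ≫
      (U ◁ ((α_ V W S.as).hom ≫ (V ◁ (β_ W S.as).hom) ≫ (α_ V S.as W).inv))) ?_ ?_ ?_ ?_
    · refine desc_ext (desc_ext ?_ (desc_ext ?_ ?_)) ?_ <;>
        refine lift_ext ?_ (lift_ext (lift_ext ?_ ?_) ?_) <;> simp
    · refine desc_ext (desc_ext ?_ (desc_ext ?_ ?_)) ?_ <;> simp
    · refine lift_ext ?_ (lift_ext (lift_ext ?_ ?_) ?_) <;> simp
    · simp
  strength S _ _ _ _ f g := by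
    obtain ⟨U, a, b, c, d, rfl⟩ := exists_mat f
    obtain ⟨V, a', b', c', d', rfl⟩ := exists_mat g
    simp only [associator_inv, associator_hom, mat_tensor_mat, mat_comp_arr, arr_comp_mat,
      trace_mat]
    refine mat_eq_mat ((α_ U V S.as).hom ≫ (U ◁ (β_ V S.as).hom) ≫ (α_ U S.as V).inv) ?_ ?_ ?_ ?_
    · refine desc_ext (desc_ext ?_ ?_) ?_ <;> refine lift_ext (lift_ext ?_ ?_) ?_ <;> simp
    · refine desc_ext (desc_ext ?_ ?_) ?_ <;> refine lift_ext ?_ ?_ <;> simp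
    · refine desc_ext ?_ ?_ <;> refine lift_ext (lift_ext ?_ ?_) ?_ <;> simp
    · apply hom_ext <;> simp
  joining S T _ _ f := by
    obtain ⟨U, a, b, c, d, rfl⟩ := exists_mat f
    simp only [associator_inv, associator_hom, mat_comp_arr, arr_comp_mat, trace_mat]
    refine mat_eq_mat (α_ U S.as T.as).hom ?_ ?_ ?_ ?_
    · refine desc_ext (desc_ext ?_ ?_) ?_ <;> refine lift_ext ?_ (lift_ext ?_ ?_) <;> simp
    · refine desc_ext (desc_ext ?_ ?_) ?_ <;> simp
    · refine lift_ext ?_ (lift_ext ?_ ?_) <;> simp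
    · simp
  vanishing f := by
    obtain ⟨U, a, b, c, d, rfl⟩ := exists_mat f
    simp only [leftUnitor_inv, leftUnitor_hom, mat_comp_arr, arr_comp_mat, trace_mat]
    refine mat_eq_mat (ρ_ U).hom ?_ ?_ ?_ ?_
    · refine desc_ext ?_ ?_ <;> simp
    · refine desc_ext ?_ ?_ <;> simp
    · simp
    · simp
  sliding {S T _ _} f w := by
    obtain ⟨U, a, b, c, d, rfl⟩ := exists_mat f
    obtain ⟨V, a', b', c', d', rfl⟩ := exists_mat w
    simp only [whiskerRight_mat, mat_comp_mat, trace_mat]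
    -- The states are `(V ⊗ U) ⊗ S` on the right-hand side and `(U ⊗ V) ⊗ T` on the left. The
    -- simulation keeps `U` and sends `V` and `S` to `V` and `T` through the block matrix of `w`. It
    -- need not be invertible, and it goes from the right-hand side to the left, hence the symmetry.
    refine (mat_eq_mat (desc (desc (lift (lift 0 a') b') (lift (lift (𝟙 U) 0) 0))
      (lift (lift 0 c') d')) ?_ ?_ ?_ ?_).symm
    · refine desc_ext (desc_ext ?_ ?_) ?_ <;> refine lift_ext (lift_ext ?_ ?_) ?_ <;> simp
    · refine desc_ext (desc_ext ?_ ?_) ?_ <;> simp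
    · refine lift_ext (lift_ext ?_ ?_) ?_ <;> simp
    · simp
  yanking S := (trace_arr S _).trans (Quotient.sound (UniformCong.yanking S.as))

/-- The uniformity rule admits formal traces as simulations, so it covers every arrow of the free
category and not only those coming from `C`. -/
instance uniformTrace : UniformTrace (FreeTraced C) where
  uniformity f g r h := by
    obtain ⟨f, rfl⟩ := exists_cls f
    obtain ⟨g, rfl⟩ := exists_cls g
    obtain ⟨r, rfl⟩ := exists_cls r
    exact Quotient.sound (UniformCong.uniformity (.refl r) (Quotient.exact h))

end FreeTraced

/-! ## Traces of matrices -/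

section TraceMatrix

open Traced

variable {D : Type u} [Category.{u} D] [MonoidalCategory D] [SymmetricCategory D]
  [FinBiproduct D] [Traced D]

theorem comp_tr_comp {S X' X Y Y' : D} (u : X' ⟶ X) (a : S ⟶ S) (b : S ⟶ Y) (c : X ⟶ S) (d : X ⟶ Y)
    (v : Y ⟶ Y') : u ≫ tr S (desc (lift a b) (lift c d)) ≫ v =
      tr S (desc (lift a (b ≫ v)) (lift (u ≫ c) (u ≫ d ≫ v))) := by
  rw [← tightening]
  congr 1
  apply hom_ext <;> simp

theorem tr_whiskerRight {S X Y : D} (Z : D) (a : S ⟶ S) (b : S ⟶ Y) (c : X ⟶ S) (d : X ⟶ Y) :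
    (tr S (desc (lift a b) (lift c d)) ▷ Z) =
      tr S (desc (lift a (b ≫ inl Y Z)) (lift (fst X Z ≫ c) (d ▷ Z))) := by
  rw [← tensorHom_id, ← strength]
  congr 1
  refine desc_ext (lift_ext ?_ (lift_ext ?_ ?_))
    (desc_ext (lift_ext ?_ (lift_ext ?_ ?_)) (lift_ext ?_ (lift_ext ?_ ?_))) <;> simp

/-- The strength axiom treats a bystander on the right; conjugating with the braiding moves it to
the left. -/
theorem whiskerLeft_tr {S X Y : D} (Z : D) (a : S ⟶ S) (b : S ⟶ Y) (c : X ⟶ S) (d : X ⟶ Y) :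
    (Z ◁ tr S (desc (lift a b) (lift c d))) =
      tr S (desc (lift a (b ≫ inr Z Y)) (lift (snd Z X ≫ c) (Z ◁ d))) := by
  have h : (Z ◁ tr S (desc (lift a b) (lift c d))) =
      (β_ Z X).hom ≫ (tr S (desc (lift a b) (lift c d)) ▷ Z) ≫ (β_ Y Z).hom := by
    rw [BraidedCategory.braiding_naturality_left, SymmetricCategory.symmetry_assoc]
  rw [h, tr_whiskerRight, comp_tr_comp]
  congr 1
  refine desc_ext (lift_ext ?_ (lift_ext ?_ ?_))
    (desc_ext (lift_ext ?_ (lift_ext ?_ ?_)) (lift_ext ?_ (lift_ext ?_ ?_))) <;> simp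

/-- Tightening pulls each factor into the other trace and joining merges the two, giving the blocks
of `FormalTrace.mat_comp_mat`. Uniformity is not needed. -/
theorem tr_comp_tr {X Y Z S T : D} (a : S ⟶ S) (b : S ⟶ Y) (c : X ⟶ S) (d : X ⟶ Y)
    (a' : T ⟶ T) (b' : T ⟶ Z) (c' : Y ⟶ T) (d' : Y ⟶ Z) :
    tr S (desc (lift a b) (lift c d)) ≫ tr T (desc (lift a' b') (lift c' d')) =
      tr (S ⊗ T) (desc (lift (desc (lift a (b ≫ c')) (lift 0 a')) (desc (b ≫ d') b'))
        (lift (lift c (d ≫ c')) (d ≫ d'))) := by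
  have h := tightening T (tr S (desc (lift a b) (lift c d))) (desc (lift a' b') (lift c' d')) (𝟙 Z)
  have h' := fun f => tightening S (𝟙 (T ⊗ X)) f (desc (lift a' b') (lift c' d'))
  simp only [MonoidalCategory.whiskerLeft_id, Category.comp_id] at h
  simp only [MonoidalCategory.whiskerLeft_id, Category.id_comp] at h'
  rw [← h, whiskerLeft_tr, ← h', joining]
  congr 1
  refine desc_ext (desc_ext (lift_ext (lift_ext ?_ ?_) ?_) (lift_ext (lift_ext ?_ ?_) ?_))
    (lift_ext (lift_ext ?_ ?_) ?_) <;> simp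

theorem tr_tensor_tr {X Y X' Y' S T : D} (a : S ⟶ S) (b : S ⟶ Y) (c : X ⟶ S) (d : X ⟶ Y)
    (a' : T ⟶ T) (b' : T ⟶ Y') (c' : X' ⟶ T) (d' : X' ⟶ Y') :
    (tr S (desc (lift a b) (lift c d)) ⊗ₘ tr T (desc (lift a' b') (lift c' d'))) =
      tr (S ⊗ T) (desc (lift (a ⊗ₘ a') (b ⊗ₘ b')) (lift (c ⊗ₘ c') (d ⊗ₘ d'))) := by
  rw [MonoidalCategory.tensorHom_def, tr_whiskerRight, whiskerLeft_tr, tr_comp_tr]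
  congr 1
  refine desc_ext (desc_ext (lift_ext (lift_ext ?_ ?_) (lift_ext ?_ ?_))
    (lift_ext (lift_ext ?_ ?_) (lift_ext ?_ ?_))) (desc_ext (lift_ext (lift_ext ?_ ?_)
    (lift_ext ?_ ?_)) (lift_ext (lift_ext ?_ ?_) (lift_ext ?_ ?_))) <;> simp

theorem tr_tr {T X Y S : D} (a : S ⟶ S) (b : S ⟶ T ⊗ Y) (c : T ⊗ X ⟶ S) (d : T ⊗ X ⟶ T ⊗ Y) :
    tr T (tr S (desc (lift a b) (lift c d))) =
      tr (S ⊗ T) (desc (lift (desc (lift a (b ≫ fst T Y)) (lift (inl T X ≫ c) (inl T X ≫ d ≫ fst T Y)))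
        (desc (b ≫ snd T Y) (inl T X ≫ d ≫ snd T Y)))
        (lift (lift (inr T X ≫ c) (inr T X ≫ d ≫ fst T Y)) (inr T X ≫ d ≫ snd T Y))) := by
  rw [joining]
  congr 1
  refine desc_ext (desc_ext (lift_ext (lift_ext ?_ ?_) ?_) (lift_ext (lift_ext ?_ ?_) ?_))
    (lift_ext (lift_ext ?_ ?_) ?_) <;> simp

/-- This is sliding along an isomorphism. In the evaluation lemmas the isomorphism is the cast that
expresses strictness of `F` on the state object. -/
theorem tr_of_iso {X Y S T : D} {a : S ⟶ S} {b : S ⟶ Y} {c : X ⟶ S} {d : X ⟶ Y}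
    {a' : T ⟶ T} {b' : T ⟶ Y} {c' : X ⟶ T} {d' : X ⟶ Y} (e : S ≅ T)
    (ha : a = e.hom ≫ a' ≫ e.inv) (hb : b = e.hom ≫ b') (hc : c = c' ≫ e.inv) (hd : d = d') :
    tr S (desc (lift a b) (lift c d)) = tr T (desc (lift a' b') (lift c' d')) := by
  have h := sliding (desc (lift (a' ≫ e.inv) b') (lift (c' ≫ e.inv) d')) e.hom
  have h1 : desc (lift (a' ≫ e.inv) b') (lift (c' ≫ e.inv) d') ≫ (e.hom ▷ Y) =
      desc (lift a' b') (lift c' d') := by simp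
  have h2 : (e.hom ▷ X) ≫ desc (lift (a' ≫ e.inv) b') (lift (c' ≫ e.inv) d') =
      desc (lift a b) (lift c d) := by simp [ha, hb, hc, hd]
  rw [h1, h2] at h
  exact h.symm

theorem tr_unit {X Y : D} (d : X ⟶ Y) :
    tr (𝟙_ D) (desc (lift 0 0) (lift 0 d)) = d := by
  conv_rhs => rw [← vanishing d]
  congr 1
  apply hom_ext <;> simp

end TraceMatrix

/-! ## Evaluation of formal traces -/

section Eval

open Traced

variable {C D : Type u} [Category.{u} C] [Category.{u} D]
  [MonoidalCategory C] [MonoidalCategory D] [SymmetricCategory C] [SymmetricCategory D]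
  [FinBiproduct C] [FinBiproduct D] [Traced D] {F : C ⥤ D} (hF : IsFB F)

namespace FormalTrace

theorem eval_mat {X Y S : C} (a : S ⟶ S) (b : S ⟶ Y) (c : X ⟶ S) (d : X ⟶ Y) :
    (mat S a b c d).eval hF.toIsStrictSymmetric =
      Traced.tr (F.obj S) (desc (lift (F.map a) (F.map b)) (lift (F.map c) (F.map d))) := by
  unfold eval mat mapLoop
  congr 1
  rw [hF.map_desc, hF.map_lift, hF.map_lift]
  simp

theorem eval_comp {X Y Z : C} (f : FormalTrace X Y) (g : FormalTrace Y Z) :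
    (f.comp g).eval hF.toIsStrictSymmetric =
      f.eval hF.toIsStrictSymmetric ≫ g.eval hF.toIsStrictSymmetric := by
  obtain ⟨S, a, b, c, d, rfl⟩ := f.exists_mat
  obtain ⟨T, a', b', c', d', rfl⟩ := g.exists_mat
  rw [mat_comp_mat, eval_mat hF, eval_mat hF, eval_mat hF, tr_comp_tr]
  refine tr_of_iso (eqToIso (hF.obj_sum S T)) ?_ ?_ ?_ ?_ <;>
    simp [hF.map_desc, hF.map_lift, hF.map_zero]

theorem eval_sum {X Y X' Y' : C} (f : FormalTrace X Y) (g : FormalTrace X' Y') :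
    (f.sum g).eval hF.toIsStrictSymmetric =
      eqToHom (hF.obj_sum X X') ≫
        (f.eval hF.toIsStrictSymmetric ⊗ₘ g.eval hF.toIsStrictSymmetric) ≫
          eqToHom (hF.obj_sum Y Y').symm := by
  obtain ⟨S, a, b, c, d, rfl⟩ := f.exists_mat
  obtain ⟨T, a', b', c', d', rfl⟩ := g.exists_mat
  rw [mat_sum_mat, eval_mat hF, eval_mat hF, eval_mat hF, tr_tensor_tr, comp_tr_comp]
  refine tr_of_iso (eqToIso (hF.obj_sum S T)) ?_ ?_ ?_ ?_ <;> simp [hF.map_sum]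

theorem eval_tr {T X Y : C} (f : FormalTrace (T ⊗ X) (T ⊗ Y)) :
    (f.tr T).eval hF.toIsStrictSymmetric = Traced.tr (F.obj T)
      (eqToHom (hF.obj_sum T X).symm ≫ f.eval hF.toIsStrictSymmetric ≫
        eqToHom (hF.obj_sum T Y)) := by
  obtain ⟨S, a, b, c, d, rfl⟩ := f.exists_mat
  rw [tr_mat, eval_mat hF, eval_mat hF, comp_tr_comp, tr_tr]
  refine tr_of_iso (eqToIso (hF.obj_sum S T)) ?_ ?_ ?_ ?_ <;>
    simp [hF.map_desc, hF.map_lift, hF.map_fst, hF.map_snd, hF.map_inl, hF.map_inr]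

theorem eval_of {X Y : C} (f : X ⟶ Y) : (of f).eval hF.toIsStrictSymmetric = F.map f := by
  rw [of_eq_mat, eval_mat hF]
  refine (tr_of_iso (eqToIso hF.obj_zero) ?_ ?_ ?_ rfl).trans (tr_unit (F.map f)) <;>
    simp [hF.map_zero]

end FormalTrace

open FormalTrace

/-- Evaluation is compatible with all formal operations, so the closure rules are immediate;
sliding, yanking and uniformity are the corresponding laws of the target. -/
theorem UniformCong.eval_eq [UniformTrace D] {X Y : C} {f g : FormalTrace X Y}
    (h : UniformCong f g) :
    f.eval hF.toIsStrictSymmetric = g.eval hF.toIsStrictSymmetric := by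
  induction h with
  | refl => rfl
  | trans _ _ h₁ h₂ => exact h₁.trans h₂
  | symm _ h => exact h.symm
  | comp _ _ h₁ h₂ => rw [eval_comp hF, eval_comp hF, h₁, h₂]
  | sum _ _ h₁ h₂ => rw [eval_sum hF, eval_sum hF, h₁, h₂]
  | trace _ h => rw [eval_tr hF, eval_tr hF, h]
  | @sliding S T X Y f w =>
    have h := Traced.sliding
      (eqToHom (hF.obj_sum T X).symm ≫ F.map f ≫ eqToHom (hF.obj_sum S Y)) (F.map w)
    have h1 : mapLoop hF.toIsStrictSymmetric (f ≫ (w ▷ Y)) =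
        (eqToHom (hF.obj_sum T X).symm ≫ F.map f ≫ eqToHom (hF.obj_sum S Y)) ≫
          (F.map w ▷ F.obj Y) := by
      simp [mapLoop, hF.map_whiskerRight]
    have h2 : mapLoop hF.toIsStrictSymmetric ((w ▷ X) ≫ f) =
        (F.map w ▷ F.obj X) ≫
          (eqToHom (hF.obj_sum T X).symm ≫ F.map f ≫ eqToHom (hF.obj_sum S Y)) := by
      simp [mapLoop, hF.map_whiskerRight]
    rw [FormalTrace.eval, FormalTrace.eval, h1, h2, h]
  | yanking S =>
    rw [eval_of hF, F.map_id, ← Traced.yanking, FormalTrace.eval, mapLoop, hF.map_braiding]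
    simp
  | @uniformity S T X Y w v f g _ _ h₁ h₂ =>
    rw [eval_tr hF, eval_tr hF]
    -- The formal simulation evaluates to an actual one, and `h₁` identifies the values of `w` and
    -- `v`. The premise comes from `h₂` by cancelling casts.
    refine UniformTrace.uniformity _ _ (w.eval hF.toIsStrictSymmetric) ?_
    rw [eval_comp hF, eval_comp hF, eval_sum hF, eval_sum hF, eval_of hF, eval_of hF, F.map_id, F.map_id,
      tensorHom_id, tensorHom_id] at h₂
    have h₃ := congrArg (fun k => eqToHom (hF.obj_sum S X).symm ≫ k ≫ eqToHom (hF.obj_sum T Y)) h₂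
    simp only [Category.assoc, eqToHom_trans, eqToHom_refl, Category.comp_id,
      eqToHom_trans_assoc, Category.id_comp] at h₃
    rw [Category.assoc, Category.assoc, h₃, h₁]

end Eval

/-! ## The universal property of the free uniformly traced category -/

namespace FreeTraced

section

variable {C : Type u} [Category.{u} C] [MonoidalCategory C] [SymmetricCategory C] [FinBiproduct C]

variable (C) in
/-- The canonical functor to the free uniformly traced category. -/
def functor : C ⥤ FreeTraced C where
  obj X := ⟨X⟩
  map f := arr f
  map_id _ := rfl
  map_comp f g := (arr_comp_arr (X := ⟨_⟩) (Y := ⟨_⟩) (Z := ⟨_⟩) f g).symm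

theorem isFB_functor : IsFB (functor C) where
  obj_zero := rfl
  obj_sum _ _ := rfl
  map_sum f g := ((Category.id_comp _).trans ((Category.comp_id _).trans
    (arr_tensor_arr (X := ⟨_⟩) (Y := ⟨_⟩) (X' := ⟨_⟩) (Y' := ⟨_⟩) f g))).symm
  map_braiding _ _ := ((Category.id_comp _).trans (Category.comp_id _)).symm
  map_codiag _ := (Category.id_comp _).symm
  map_cobang _ := (Category.id_comp _).symm
  map_diag _ := (Category.comp_id _).symm
  map_bang _ := (Category.comp_id _).symm

/-- Evaluation along the unit is passage to the class. Fullness on formal traces and the description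
of equality in `isUniformTraceConstruction` therefore reduce to properties of the quotient. -/
theorem eval_functor {X Y : C} (f : FormalTrace X Y) :
    f.eval (isFB_functor (C := C)).toIsStrictSymmetric = cls (X := ⟨X⟩) (Y := ⟨Y⟩) f := by
  have h : mapLoop (isFB_functor (C := C)).toIsStrictSymmetric f.hom = (functor C).map f.hom :=
    (Category.id_comp _).trans (Category.comp_id _)
  rw [FormalTrace.eval, h]
  exact trace_arr ⟨f.state⟩ f.hom

section Lift

variable {D : Type u} [Category.{u} D] [MonoidalCategory D] [SymmetricCategory D]
  [FinBiproduct D] [Traced D] [UniformTrace D]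

/-- The extension of a functor to formal traces. -/
def lift {F : C ⥤ D} (hF : IsFB F) : FreeTraced C ⥤ D where
  obj X := F.obj X.as
  map := Quotient.lift (fun f => f.eval hF.toIsStrictSymmetric) fun _ _ h =>
    UniformCong.eval_eq hF h
  map_id X := (FormalTrace.eval_of hF _).trans (F.map_id X.as)
  map_comp := by
    rintro _ _ _ ⟨f⟩ ⟨g⟩
    exact FormalTrace.eval_comp hF f g

theorem isFB_lift {F : C ⥤ D} (hF : IsFB F) : IsFB (lift hF) where
  obj_zero := hF.obj_zero
  obj_sum X Y := hF.obj_sum X.as Y.as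
  map_sum := by
    rintro _ _ _ _ ⟨f⟩ ⟨g⟩
    exact FormalTrace.eval_sum hF f g
  map_braiding X Y := (FormalTrace.eval_of hF _).trans (hF.map_braiding X.as Y.as)
  map_codiag X := (FormalTrace.eval_of hF _).trans (hF.map_codiag X.as)
  map_cobang X := (FormalTrace.eval_of hF _).trans (hF.map_cobang X.as)
  map_diag X := (FormalTrace.eval_of hF _).trans (hF.map_diag X.as)
  map_bang X := (FormalTrace.eval_of hF _).trans (hF.map_bang X.as)

theorem preservesTrace_lift {F : C ⥤ D} (hF : IsFB F) :
    PreservesTrace (isFB_lift hF).toIsStrictSymmetric := by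
  rintro S X Y ⟨f⟩
  exact FormalTrace.eval_tr hF f

theorem functor_lift {F : C ⥤ D} (hF : IsFB F) : functor C ⋙ lift hF = F := by
  refine CategoryTheory.Functor.ext (fun _ => rfl) ?_
  intro X Y f
  exact (FormalTrace.eval_of hF f).trans ((Category.id_comp _).trans (Category.comp_id _)).symm

/-- A class is the trace of the image of an arrow of `C`, so a trace-preserving functor is
determined by its restriction along the unit. -/
theorem lift_functor {G : FreeTraced C ⥤ D} (hG : IsFB G)
    (hT : PreservesTrace hG.toIsStrictSymmetric) :
    lift (isFB_functor.comp hG) = G := by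
  refine CategoryTheory.Functor.ext (fun _ => rfl) ?_
  rintro X Y ⟨f⟩
  refine Eq.trans ?_ ((Category.id_comp _).trans (Category.comp_id _)).symm
  have h : (Quot.mk _ f : X ⟶ Y) = Traced.tr (C := FreeTraced C) ⟨f.state⟩ (arr f.hom) :=
    (trace_arr (X := X) (Y := Y) ⟨f.state⟩ f.hom).symm
  exact ((congrArg G.map h).trans
    (hT (S := ⟨f.state⟩) (X := X) (Y := Y) (arr f.hom))).symm

end Lift

end

section Adjunction

variable {C : Type u} [Category.{u} C] [MonoidalCategory C] [SymmetricCategory C] [FinBiproduct C]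
  [PosetEnriched C] [AdjointBiproduct C]

theorem idem (X : FreeTraced C) : FinBiproduct.diag X ≫ FinBiproduct.codiag X = 𝟙 X :=
  (arr_comp_arr _ _).trans (congrArg arr (diag_codiag_eq_id X.as))

end Adjunction

end FreeTraced

/-- The free uniformly traced category. -/
def traceObj (C : FIBCat.{u}) : UTFIBCat.{u} :=
  letI := posetEnrichedOfIdem (FreeTraced.idem (C := C.carrier))
  haveI := adjointBiproduct_of_idem (FreeTraced.idem (C := C.carrier))
  { carrier := FreeTraced C.carrier }

/-- The canonical functor to the free uniformly traced category, without the order. -/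
def traceFBHom (C : FIBCat.{u}) : FBHom C.toFBCat (traceObj C).toFBCat where
  functor := FreeTraced.functor C.carrier
  isFB := FreeTraced.isFB_functor

/-- The canonical functor to the free uniformly traced category. -/
def traceUnit (C : FIBCat.{u}) : C ⟶ (traceObj C).toFIBCat where
  toFBHom := traceFBHom C
  mono := FBHom.preservesOrder (C := C) (D := (traceObj C).toFIBCat) (traceFBHom C)

/-- The extension of a functor to the free uniformly traced category. -/
def traceLift {C : FIBCat.{u}} {D : UTFIBCat.{u}} (F : FIBHom C D.toFIBCat) : traceObj C ⟶ D where
  functor := FreeTraced.lift F.isFB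
  isFB := FreeTraced.isFB_lift F.isFB
  mono := FBHom.preservesOrder (C := (traceObj C).toFIBCat) (D := D.toFIBCat)
    ⟨FreeTraced.lift F.isFB, FreeTraced.isFB_lift F.isFB⟩
  trace := FreeTraced.preservesTrace_lift F.isFB

/-- The universal property of the free uniformly traced category. -/
def traceEquiv (C : FIBCat.{u}) (D : UTFIBCat.{u}) :
    (traceObj C ⟶ D) ≃ (C ⟶ UTFIBCat.forget.obj D) where
  toFun G := traceUnit C ≫ UTFIBCat.forget.map G
  invFun F := traceLift F
  left_inv G := UTFIBHom.ext (FreeTraced.lift_functor G.isFB G.trace)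
  right_inv (F : FIBHom C D.toFIBCat) := FIBHom.ext (FreeTraced.functor_lift F.isFB)

/-- The free uniformly traced category, as a functor. -/
def traceFree : FIBCat.{u} ⥤ UTFIBCat.{u} :=
  Adjunction.leftAdjointOfEquiv (G := UTFIBCat.forget) traceEquiv fun _ _ _ _ _ => rfl

/-- The free uniformly traced category is left adjoint to the forgetful functor. -/
def traceAdj : traceFree.{u} ⊣ UTFIBCat.forget :=
  Adjunction.adjunctionOfEquivLeft (G := UTFIBCat.forget) traceEquiv fun _ _ _ _ _ => rfl

theorem isUniformTraceConstruction (C : FIBCat.{u}) :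
    IsUniformTraceConstruction (D := traceObj C) (traceUnit C) where
  obj_bijective := ⟨fun _ _ h => congrArg FreeTraced.as h, fun X => ⟨FreeTraced.as X, rfl⟩⟩
  hom_surjective X Y h := by
    obtain ⟨f, hf⟩ := FreeTraced.exists_cls (X := ⟨X⟩) (Y := ⟨Y⟩) h
    exact ⟨f, (FreeTraced.eval_functor f).trans hf⟩
  hom_eq_iff f g := by
    refine Iff.trans ?_ (FreeTraced.cls_eq_iff (X := ⟨_⟩) (Y := ⟨_⟩) f g)
    exact Eq.congr (FreeTraced.eval_functor f) (FreeTraced.eval_functor g)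

/-! ## The matrix construction on a free category -/

/-- An occurrence of `A` in a list. -/
@[ext]
structure Occ {Q : Type u} (l : List Q) (A : Q) : Type where
  index : ℕ
  getElem : l[index]? = some A

namespace Occ

variable {Q : Type u} {l m : List Q} {A : Q}

/-- An occurrence in the first part of a concatenation. -/
def left (m : List Q) (e : Occ l A) : Occ (l ++ m) A :=
  ⟨e.1, by rw [List.getElem?_append_left (List.getElem?_eq_some_iff.1 e.2).1, e.2]⟩

/-- An occurrence in the second part of a concatenation. -/
def right (l : List Q) (e : Occ m A) : Occ (l ++ m) A :=
  ⟨l.length + e.1, by rw [List.getElem?_append_right (by omega), Nat.add_sub_cancel_left, e.2]⟩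

/-- Case distinction for an occurrence in a concatenation. -/
def split (e : Occ (l ++ m) A) : Occ l A ⊕ Occ m A :=
  if h : e.1 < l.length then .inl ⟨e.1, (List.getElem?_append_left h).symm.trans e.2⟩
  else .inr ⟨e.1 - l.length, (List.getElem?_append_right (not_lt.1 h)).symm.trans e.2⟩

@[simp]
theorem split_left (e : Occ l A) : split (e.left m) = .inl e := by
  have h : e.1 < l.length := (List.getElem?_eq_some_iff.1 e.2).1
  exact dif_pos h

@[simp]
theorem split_right (e : Occ m A) : split (e.right l) = .inr e := by
  have h : ¬ l.length + e.1 < l.length := by omega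
  exact (dif_neg h).trans (congrArg _ (Occ.ext (Nat.add_sub_cancel_left ..)))

theorem left_or_right (e : Occ (l ++ m) A) :
    (∃ e' : Occ l A, e = e'.left m) ∨ ∃ e' : Occ m A, e = e'.right l := by
  by_cases h : e.1 < l.length
  · exact .inl ⟨⟨e.1, (List.getElem?_append_left h).symm.trans e.2⟩, rfl⟩
  · exact .inr ⟨⟨e.1 - l.length, (List.getElem?_append_right (not_lt.1 h)).symm.trans e.2⟩,
      Occ.ext (Nat.add_sub_of_le (not_lt.1 h)).symm⟩

/-- The occurrence in a singleton. -/
def single (A : Q) : Occ [A] A := ⟨0, rfl⟩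

theorem eq_of_single {B : Q} (e : Occ [B] A) : A = B := by
  obtain ⟨i, h⟩ := e
  cases i with
  | zero => exact (Option.some.inj h).symm
  | succ i => cases h

theorem eq_single (e : Occ [A] A) : e = single A := by
  obtain ⟨i, h⟩ := e
  cases i with
  | zero => rfl
  | succ i => cases h

theorem nil_elim {P : Prop} (e : Occ ([] : List Q) A) : P := by
  cases e.2

end Occ

/-- Formal finite sums of sorts. -/
structure FreeBip (Q : Type u) where
  ofList ::
  sorts : List Q

namespace FreeBip

variable {Q : Type u}

/-- The concatenation of formal sums. -/
def sum (X Y : FreeBip Q) : FreeBip Q := ⟨X.sorts ++ Y.sorts⟩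

theorem sum_assoc (X Y Z : FreeBip Q) : (X.sum Y).sum Z = X.sum (Y.sum Z) :=
  congrArg ofList (List.append_assoc ..)

theorem sum_nil (X : FreeBip Q) : X.sum ⟨[]⟩ = X := congrArg ofList (List.append_nil _)

variable [Quiver.{u} Q]

/-- A path from the sort `A` to one of the summands of a formal sum. -/
abbrev Target (X : FreeBip Q) (A : Q) : Type u := Σ B, Occ X.sorts B × Quiver.Path A B

/-- Matrices of finite multisets of paths, given by the rows at all summands of the source. -/
instance : Category (FreeBip Q) where
  Hom X Y := ∀ A, Occ X.sorts A → Multiset (Target Y A)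
  id X A e := {⟨A, e, .nil⟩}
  comp f g A e := (f A e).bind fun t => (g t.1 t.2.1).map fun s => ⟨s.1, s.2.1, t.2.2.comp s.2.2⟩
  id_comp f := by
    funext A e
    simp only [Multiset.singleton_bind, Quiver.Path.nil_comp]
    exact Multiset.map_id' _
  comp_id f := by
    funext A e
    simp only [Multiset.map_singleton, Quiver.Path.comp_nil]
    exact (Multiset.bind_singleton _ _).trans (Multiset.map_id' _)
  assoc f g h := by
    funext A e
    simp only [Multiset.bind_assoc, Multiset.bind_map, Multiset.map_bind, Multiset.map_map,
      Function.comp_def, Quiver.Path.comp_assoc]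

variable {X Y Z W : FreeBip Q}

theorem comp_apply (f : X ⟶ Y) (g : Y ⟶ Z) (A : Q) (e : Occ X.sorts A) :
    (f ≫ g) A e = (f A e).bind fun t =>
      (g t.1 t.2.1).map fun s => ⟨s.1, s.2.1, t.2.2.comp s.2.2⟩ := rfl

/-- The arrow given by a map of summands. -/
def embed (φ : ∀ A, Occ X.sorts A → Occ Y.sorts A) : X ⟶ Y := fun A e => {⟨A, φ A e, .nil⟩}

theorem embed_comp_apply (φ : ∀ A, Occ X.sorts A → Occ Y.sorts A) (f : Y ⟶ Z) (A : Q)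
    (e : Occ X.sorts A) : (embed φ ≫ f) A e = f A (φ A e) := by
  rw [comp_apply]
  simp only [embed, Multiset.singleton_bind, Quiver.Path.nil_comp]
  exact Multiset.map_id' _

/-- An occurrence is determined by its numerical index, so embeddings can be compared by arithmetic
on positions even when their source lists differ. -/
theorem embed_apply_congr {φ : ∀ A, Occ X.sorts A → Occ Y.sorts A}
    {ψ : ∀ A, Occ Z.sorts A → Occ Y.sorts A} {A : Q} {e : Occ X.sorts A} {e' : Occ Z.sorts A}
    (h : (φ A e).index = (ψ A e').index) : embed φ A e = embed ψ A e' := by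
  rw [embed, embed, Occ.ext h]

/-- A cast between equal lists keeps positions. This makes the structural isomorphisms, which are
casts here, computable. -/
theorem eqToHom_eq_embed (h : X = Y) :
    eqToHom h = embed fun _ e => ⟨e.index, (congrArg (fun Z : FreeBip Q => Z.sorts[e.index]?) h).symm.trans
      e.2⟩ := by
  subst h
  rfl

/-- Block diagonal matrices. -/
def blockDiag {X' Y' : FreeBip Q} (f : X ⟶ Y) (g : X' ⟶ Y') : X.sum X' ⟶ Y.sum Y' := fun A e =>
  e.split.elim ((f ≫ (embed fun _ e => e.left Y'.sorts : Y ⟶ Y.sum Y')) A)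
    ((g ≫ (embed fun _ e => e.right Y.sorts : Y' ⟶ Y.sum Y')) A)

instance : MonoidalCategoryStruct (FreeBip Q) where
  tensorObj := sum
  tensorHom := blockDiag
  whiskerLeft X _ _ f := blockDiag (𝟙 X) f
  whiskerRight f X := blockDiag f (𝟙 X)
  tensorUnit := ⟨[]⟩
  associator X Y Z := eqToIso (sum_assoc X Y Z)
  leftUnitor _ := eqToIso rfl
  rightUnitor X := eqToIso (sum_nil X)

theorem tensor_sorts (X Y : FreeBip Q) : (X ⊗ Y).sorts = X.sorts ++ Y.sorts := rfl

theorem rightUnitor_hom (X : FreeBip Q) : (ρ_ X).hom = eqToHom (sum_nil X) := rfl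

theorem associator_hom (X Y Z : FreeBip Q) : (α_ X Y Z).hom = eqToHom (sum_assoc X Y Z) := rfl

/-- A summand of the first part of a formal sum. -/
def occL (Y : FreeBip Q) {A : Q} (e : Occ X.sorts A) : Occ (X ⊗ Y).sorts A := e.left Y.sorts

/-- A summand of the second part of a formal sum. -/
def occR (X : FreeBip Q) {A : Q} (e : Occ Y.sorts A) : Occ (X ⊗ Y).sorts A := e.right X.sorts

/-- The embedding of the first part of a formal sum. -/
def inL (X Y : FreeBip Q) : X ⟶ X ⊗ Y := embed fun _ => occL Y

/-- The embedding of the second part of a formal sum. -/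
def inR (X Y : FreeBip Q) : Y ⟶ X ⊗ Y := embed fun _ => occR X

/-- Copairing of matrices. -/
def copair (f : X ⟶ Z) (g : Y ⟶ Z) : X ⊗ Y ⟶ Z := fun A e => (Occ.split e).elim (f A) (g A)

theorem inL_comp_apply (f : X ⊗ Y ⟶ Z) (A : Q) (e : Occ X.sorts A) :
    (inL X Y ≫ f) A e = f A (occL Y e) := embed_comp_apply _ _ _ _

theorem inR_comp_apply (f : X ⊗ Y ⟶ Z) (A : Q) (e : Occ Y.sorts A) :
    (inR X Y ≫ f) A e = f A (occR X e) := embed_comp_apply _ _ _ _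

theorem occL_or_occR {A : Q} (e : Occ (X ⊗ Y).sorts A) :
    (∃ e' : Occ X.sorts A, e = occL Y e') ∨ ∃ e' : Occ Y.sorts A, e = occR X e' :=
  Occ.left_or_right e

@[simp]
theorem inL_copair (f : X ⟶ Z) (g : Y ⟶ Z) : inL X Y ≫ copair f g = f := by
  funext A e
  exact (inL_comp_apply _ _ _).trans (congrArg (Sum.elim (f A) (g A)) (Occ.split_left e))

@[simp]
theorem inR_copair (f : X ⟶ Z) (g : Y ⟶ Z) : inR X Y ≫ copair f g = g := by
  funext A e
  exact (inR_comp_apply _ _ _).trans (congrArg (Sum.elim (f A) (g A)) (Occ.split_right e))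

@[simp]
theorem inL_copair_assoc (f : X ⟶ Z) (g : Y ⟶ Z) (h : Z ⟶ W) :
    inL X Y ≫ copair f g ≫ h = f ≫ h := by
  rw [← Category.assoc, inL_copair]

@[simp]
theorem inR_copair_assoc (f : X ⟶ Z) (g : Y ⟶ Z) (h : Z ⟶ W) :
    inR X Y ≫ copair f g ≫ h = g ≫ h := by
  rw [← Category.assoc, inR_copair]

theorem tensor_ext {f g : X ⊗ Y ⟶ Z} (h₁ : inL X Y ≫ f = inL X Y ≫ g)
    (h₂ : inR X Y ≫ f = inR X Y ≫ g) : f = g := by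
  funext A e
  obtain ⟨e, rfl⟩ | ⟨e, rfl⟩ := occL_or_occR e
  · have := congrFun (congrFun h₁ A) e
    rwa [inL_comp_apply, inL_comp_apply] at this
  · have := congrFun (congrFun h₂ A) e
    rwa [inR_comp_apply, inR_comp_apply] at this

@[simp]
theorem inL_tensorHom {X' Y' : FreeBip Q} (f : X ⟶ Y) (g : X' ⟶ Y') :
    inL X X' ≫ (f ⊗ₘ g) = f ≫ inL Y Y' := inL_copair (f ≫ inL Y Y') (g ≫ inR Y Y')

@[simp]
theorem inR_tensorHom {X' Y' : FreeBip Q} (f : X ⟶ Y) (g : X' ⟶ Y') :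
    inR X X' ≫ (f ⊗ₘ g) = g ≫ inR Y Y' := inR_copair (f ≫ inL Y Y') (g ≫ inR Y Y')

@[simp]
theorem inL_tensorHom_assoc {X' Y' : FreeBip Q} (f : X ⟶ Y) (g : X' ⟶ Y') (h : Y ⊗ Y' ⟶ W) :
    inL X X' ≫ (f ⊗ₘ g) ≫ h = f ≫ inL Y Y' ≫ h := by
  rw [← Category.assoc, inL_tensorHom, Category.assoc]

@[simp]
theorem inR_tensorHom_assoc {X' Y' : FreeBip Q} (f : X ⟶ Y) (g : X' ⟶ Y') (h : Y ⊗ Y' ⟶ W) :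
    inR X X' ≫ (f ⊗ₘ g) ≫ h = g ≫ inR Y Y' ≫ h := by
  rw [← Category.assoc, inR_tensorHom, Category.assoc]

theorem inL_inL_associator (X Y Z : FreeBip Q) :
    inL X Y ≫ inL (X ⊗ Y) Z ≫ (α_ X Y Z).hom = inL X (Y ⊗ Z) := by
  funext A e
  rw [associator_hom, inL_comp_apply, inL_comp_apply, eqToHom_eq_embed]
  exact embed_apply_congr rfl

theorem inR_inL_associator (X Y Z : FreeBip Q) :
    inR X Y ≫ inL (X ⊗ Y) Z ≫ (α_ X Y Z).hom = inL Y Z ≫ inR X (Y ⊗ Z) := by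
  funext A e
  rw [associator_hom, inR_comp_apply, inL_comp_apply, eqToHom_eq_embed, inL_comp_apply]
  exact embed_apply_congr rfl

theorem inR_associator (X Y Z : FreeBip Q) :
    inR (X ⊗ Y) Z ≫ (α_ X Y Z).hom = inR Y Z ≫ inR X (Y ⊗ Z) := by
  funext A e
  rw [associator_hom, inR_comp_apply, eqToHom_eq_embed, inR_comp_apply]
  refine embed_apply_congr (X := (X ⊗ Y) ⊗ Z) (Y := X ⊗ (Y ⊗ Z)) (Z := Y ⊗ Z) ?_
  -- Positions in the third part are shifted by the length of the concatenation on one side, and by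
  -- the two lengths successively on the other.
  simp only [occR, Occ.right, Nat.add_assoc, tensor_sorts, List.length_append]

theorem inR_leftUnitor (X : FreeBip Q) : inR (𝟙_ _) X ≫ (λ_ X).hom = 𝟙 X := by
  funext A e
  rw [inR_comp_apply]
  exact embed_apply_congr (X := X) (Y := X) (Z := X) (φ := fun _ e => e)
    (ψ := fun _ e => e) (Nat.zero_add _)

theorem inL_rightUnitor (X : FreeBip Q) : inL X (𝟙_ _) ≫ (ρ_ X).hom = 𝟙 X := by
  funext A e
  rw [inL_comp_apply, rightUnitor_hom, eqToHom_eq_embed]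
  rfl

@[simp]
theorem inL_inL_associator_assoc (X Y Z : FreeBip Q) (h : X ⊗ (Y ⊗ Z) ⟶ W) :
    inL X Y ≫ inL (X ⊗ Y) Z ≫ (α_ X Y Z).hom ≫ h = inL X (Y ⊗ Z) ≫ h := by
  rw [← inL_inL_associator, Category.assoc, Category.assoc]

@[simp]
theorem inR_inL_associator_assoc (X Y Z : FreeBip Q) (h : X ⊗ (Y ⊗ Z) ⟶ W) :
    inR X Y ≫ inL (X ⊗ Y) Z ≫ (α_ X Y Z).hom ≫ h = inL Y Z ≫ inR X (Y ⊗ Z) ≫ h := by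
  rw [← Category.assoc (inL Y Z), ← inR_inL_associator, Category.assoc, Category.assoc]

@[simp]
theorem inR_associator_assoc (X Y Z : FreeBip Q) (h : X ⊗ (Y ⊗ Z) ⟶ W) :
    inR (X ⊗ Y) Z ≫ (α_ X Y Z).hom ≫ h = inR Y Z ≫ inR X (Y ⊗ Z) ≫ h := by
  rw [← Category.assoc, inR_associator, Category.assoc]

@[simp]
theorem inR_leftUnitor_assoc (X : FreeBip Q) (h : X ⟶ W) :
    inR (𝟙_ _) X ≫ (λ_ X).hom ≫ h = h := by
  rw [← Category.assoc, inR_leftUnitor, Category.id_comp]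

@[simp]
theorem inL_rightUnitor_assoc (X : FreeBip Q) (h : X ⟶ W) :
    inL X (𝟙_ _) ≫ (ρ_ X).hom ≫ h = h := by
  rw [← Category.assoc, inL_rightUnitor, Category.id_comp]

attribute [simp] inL_inL_associator inR_inL_associator inR_associator inR_leftUnitor inL_rightUnitor

theorem from_nil_unique (f g : 𝟙_ (FreeBip Q) ⟶ X) : f = g :=
  funext₂ fun _ e => e.nil_elim

/-- The empty list has no occurrences, so every row into it is the empty multiset. -/
theorem to_nil_unique (f g : X ⟶ 𝟙_ (FreeBip Q)) : f = g := by
  funext A e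
  have h (s : Multiset (Target (𝟙_ (FreeBip Q)) A)) : s = 0 :=
    Multiset.eq_zero_of_forall_notMem fun t _ => t.2.1.nil_elim
  exact (h _).trans (h _).symm

/-- Apart from the definitional compatibilities, the laws compare arrows out of a sum; by
`tensor_ext` they may be checked on summands, where everything is an injection. -/
instance : MonoidalCategory (FreeBip Q) :=
  MonoidalCategory.ofTensorHom
    (id_tensorHom_id := fun X Y => tensor_ext (by simp) (by simp))
    (id_tensorHom := fun _ _ _ _ => rfl)
    (tensorHom_id := fun _ _ => rfl)
    (tensorHom_comp_tensorHom := fun f₁ f₂ g₁ g₂ => tensor_ext (by simp) (by simp))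
    (associator_naturality := fun f₁ f₂ f₃ =>
      tensor_ext (tensor_ext (by simp) (by simp)) (by simp))
    (leftUnitor_naturality := fun f => tensor_ext (from_nil_unique _ _) (by simp))
    (rightUnitor_naturality := fun f => tensor_ext (by simp) (from_nil_unique _ _))
    (pentagon := fun W X Y Z =>
      tensor_ext (tensor_ext (tensor_ext (by simp) (by simp)) (by simp)) (by simp))
    (triangle := fun X Y => tensor_ext (tensor_ext (by simp) (from_nil_unique _ _)) (by simp))

@[simp]
theorem inL_whiskerRight (f : X ⟶ Y) (Z : FreeBip Q) : inL X Z ≫ (f ▷ Z) = f ≫ inL Y Z :=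
  inL_tensorHom f (𝟙 Z)

@[simp]
theorem inR_whiskerRight (f : X ⟶ Y) (Z : FreeBip Q) : inR X Z ≫ (f ▷ Z) = inR Y Z :=
  (inR_tensorHom f (𝟙 Z)).trans (Category.id_comp _)

@[simp]
theorem inL_whiskerLeft (f : X ⟶ Y) (Z : FreeBip Q) : inL Z X ≫ (Z ◁ f) = inL Z Y :=
  (inL_tensorHom (𝟙 Z) f).trans (Category.id_comp _)

@[simp]
theorem inR_whiskerLeft (f : X ⟶ Y) (Z : FreeBip Q) : inR Z X ≫ (Z ◁ f) = f ≫ inR Z Y :=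
  inR_tensorHom (𝟙 Z) f

@[simp]
theorem inL_whiskerRight_assoc (f : X ⟶ Y) (Z : FreeBip Q) (h : Y ⊗ Z ⟶ W) :
    inL X Z ≫ (f ▷ Z) ≫ h = f ≫ inL Y Z ≫ h := by
  rw [← Category.assoc, inL_whiskerRight, Category.assoc]

@[simp]
theorem inR_whiskerRight_assoc (f : X ⟶ Y) (Z : FreeBip Q) (h : Y ⊗ Z ⟶ W) :
    inR X Z ≫ (f ▷ Z) ≫ h = inR Y Z ≫ h := by
  rw [← Category.assoc, inR_whiskerRight]

@[simp]
theorem inL_whiskerLeft_assoc (f : X ⟶ Y) (Z : FreeBip Q) (h : Z ⊗ Y ⟶ W) :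
    inL Z X ≫ (Z ◁ f) ≫ h = inL Z Y ≫ h := by
  rw [← Category.assoc, inL_whiskerLeft]

@[simp]
theorem inR_whiskerLeft_assoc (f : X ⟶ Y) (Z : FreeBip Q) (h : Z ⊗ Y ⟶ W) :
    inR Z X ≫ (Z ◁ f) ≫ h = f ≫ inR Z Y ≫ h := by
  rw [← Category.assoc, inR_whiskerLeft, Category.assoc]

@[simp]
theorem inL_associator_inv (X Y Z : FreeBip Q) :
    inL X (Y ⊗ Z) ≫ (α_ X Y Z).inv = inL X Y ≫ inL (X ⊗ Y) Z := by
  rw [Iso.comp_inv_eq, Category.assoc, inL_inL_associator]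

@[simp]
theorem inL_inR_associator_inv (X Y Z : FreeBip Q) :
    inL Y Z ≫ inR X (Y ⊗ Z) ≫ (α_ X Y Z).inv = inR X Y ≫ inL (X ⊗ Y) Z := by
  rw [← Category.assoc, Iso.comp_inv_eq, Category.assoc, inR_inL_associator]

@[simp]
theorem inR_inR_associator_inv (X Y Z : FreeBip Q) :
    inR Y Z ≫ inR X (Y ⊗ Z) ≫ (α_ X Y Z).inv = inR (X ⊗ Y) Z := by
  rw [← Category.assoc, Iso.comp_inv_eq, inR_associator]

@[simp]
theorem inL_associator_inv_assoc (X Y Z : FreeBip Q) (h : (X ⊗ Y) ⊗ Z ⟶ W) :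
    inL X (Y ⊗ Z) ≫ (α_ X Y Z).inv ≫ h = inL X Y ≫ inL (X ⊗ Y) Z ≫ h := by
  rw [← Category.assoc, inL_associator_inv, Category.assoc]

@[simp]
theorem inL_inR_associator_inv_assoc (X Y Z : FreeBip Q) (h : (X ⊗ Y) ⊗ Z ⟶ W) :
    inL Y Z ≫ inR X (Y ⊗ Z) ≫ (α_ X Y Z).inv ≫ h = inR X Y ≫ inL (X ⊗ Y) Z ≫ h := by
  rw [← Category.assoc (inR X Y), ← inL_inR_associator_inv, Category.assoc, Category.assoc]

@[simp]
theorem inR_inR_associator_inv_assoc (X Y Z : FreeBip Q) (h : (X ⊗ Y) ⊗ Z ⟶ W) :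
    inR Y Z ≫ inR X (Y ⊗ Z) ≫ (α_ X Y Z).inv ≫ h = inR (X ⊗ Y) Z ≫ h := by
  rw [← inR_inR_associator_inv, Category.assoc, Category.assoc]

instance : BraidedCategory (FreeBip Q) where
  braiding X Y :=
    { hom := copair (inR Y X) (inL Y X)
      inv := copair (inR X Y) (inL X Y)
      hom_inv_id := tensor_ext (by simp) (by simp)
      inv_hom_id := tensor_ext (by simp) (by simp) }
  braiding_naturality_right X _ _ f := tensor_ext (by simp) (by simp)
  braiding_naturality_left f X := tensor_ext (by simp) (by simp)
  hexagon_forward X Y Z := tensor_ext (tensor_ext (by simp) (by simp)) (by simp)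
  hexagon_reverse X Y Z := tensor_ext (by simp) (tensor_ext (by simp) (by simp))

instance : SymmetricCategory (FreeBip Q) where
  symmetry X Y := (β_ X Y).hom_inv_id

@[simp]
theorem inL_braiding (X Y : FreeBip Q) : inL X Y ≫ (β_ X Y).hom = inR Y X := inL_copair _ _

@[simp]
theorem inR_braiding (X Y : FreeBip Q) : inR X Y ≫ (β_ X Y).hom = inL Y X := inR_copair _ _

@[simp]
theorem inL_braiding_assoc (X Y : FreeBip Q) (h : Y ⊗ X ⟶ Z) :
    inL X Y ≫ (β_ X Y).hom ≫ h = inR Y X ≫ h := inL_copair_assoc _ _ _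

@[simp]
theorem inR_braiding_assoc (X Y : FreeBip Q) (h : Y ⊗ X ⟶ Z) :
    inR X Y ≫ (β_ X Y).hom ≫ h = inL Y X ≫ h := inR_copair_assoc _ _ _

instance : Strict (FreeBip Q) where
  assoc_obj := sum_assoc
  unit_obj _ := rfl
  obj_unit := sum_nil
  associator_eq _ _ _ := rfl
  leftUnitor_eq _ := rfl
  rightUnitor_eq _ := rfl

/-- Entrywise sum of matrices. -/
def entrySum (f g : X ⟶ Y) : X ⟶ Y := fun A e => f A e + g A e

/-- The zero matrix. -/
def entryZero (X Y : FreeBip Q) : X ⟶ Y := fun _ _ => 0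

theorem entrySum_comm (f g : X ⟶ Y) : entrySum f g = entrySum g f :=
  funext₂ fun _ _ => add_comm _ _

theorem entrySum_assoc (f g h : X ⟶ Y) :
    entrySum (entrySum f g) h = entrySum f (entrySum g h) :=
  funext₂ fun _ _ => add_assoc _ _ _

@[simp]
theorem entryZero_sum (f : X ⟶ Y) : entrySum (entryZero X Y) f = f :=
  funext₂ fun _ _ => zero_add _

@[simp]
theorem entrySum_comp (f g : X ⟶ Y) (h : Y ⟶ Z) :
    entrySum f g ≫ h = entrySum (f ≫ h) (g ≫ h) :=
  funext₂ fun _ _ => Multiset.add_bind _ _ _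

@[simp]
theorem comp_entrySum (f : X ⟶ Y) (g h : Y ⟶ Z) :
    f ≫ entrySum g h = entrySum (f ≫ g) (f ≫ h) := by
  funext A e
  rw [comp_apply]
  simp only [entrySum, Multiset.map_add, Multiset.bind_add]
  rfl

@[simp]
theorem entryZero_comp (f : Y ⟶ Z) : entryZero X Y ≫ f = entryZero X Z :=
  funext₂ fun _ _ => Multiset.zero_bind _

@[simp]
theorem comp_entryZero (f : X ⟶ Y) : f ≫ entryZero Y Z = entryZero X Z :=
  funext₂ fun _ _ => Multiset.bind_zero _

/-- Only copairing has been set up concretely; the diagonal is obtained from it as the sum of the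
two injections, and bilinearity of composition supplies the comonoid laws. -/
instance : FinBiproduct (FreeBip Q) where
  codiag X := copair (𝟙 X) (𝟙 X)
  cobang X := entryZero _ X
  diag X := entrySum (inL X X) (inR X X)
  bang X := entryZero X _
  codiag_assoc X := tensor_ext (tensor_ext (by simp) (by simp)) (by simp)
  cobang_codiag X := tensor_ext (from_nil_unique _ _) (by simp)
  braiding_codiag X := tensor_ext (by simp) (by simp)
  diag_assoc X := by simp [entrySum_assoc]
  diag_bang X := by simpa using (Iso.comp_hom_eq_id _).1 (inR_leftUnitor X)
  diag_braiding X := by simp [entrySum_comm]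
  codiag_zero := tensor_ext (from_nil_unique _ _) (from_nil_unique _ _)
  codiag_sum X Y := tensor_ext (tensor_ext (by simp [tensorμ]) (by simp [tensorμ]))
    (tensor_ext (by simp [tensorμ]) (by simp [tensorμ]))
  cobang_zero := from_nil_unique _ _
  cobang_sum X Y := from_nil_unique _ _
  diag_zero := from_nil_unique _ _
  diag_sum X Y := tensor_ext (by simp [tensorμ]) (by simp [tensorμ])
  bang_zero := from_nil_unique _ _
  bang_sum X Y := to_nil_unique _ _
  diag_natural f := by simp
  bang_natural f := by simp
  codiag_natural f := tensor_ext (by simp) (by simp)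
  cobang_natural f := by simp

end FreeBip

/-! ### Sorts, paths and rows as arrows -/

namespace FreeBip

section Unit

variable {Q : Type u} [Quiver.{u} Q] {X Y Z : FreeBip Q} {A B C : Q}

theorem inl_eq_inL (X Y : FreeBip Q) : inl X Y = inL X Y := by
  have h : (ρ_ X).inv = inL X (𝟙_ _) := ((Iso.comp_hom_eq_id _).1 (inL_rightUnitor X)).symm
  rw [inl, h, inL_whiskerLeft]

theorem inr_eq_inR (X Y : FreeBip Q) : inr X Y = inR X Y := by
  have h : (λ_ Y).inv = inR (𝟙_ _) Y := ((Iso.comp_hom_eq_id _).1 (inR_leftUnitor Y)).symm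
  rw [inr, h, inR_whiskerRight]

theorem zero_apply (e : Occ X.sorts A) : (0 : X ⟶ Y) A e = 0 := by
  have h : (0 : X ⟶ Y) = entryZero X Y := entryZero_comp (entryZero (𝟙_ _) Y)
  rw [h]
  rfl

/-- Convolution is addition of the underlying multisets, which identifies the abstract monoid
structure with formal sums of paths. -/
theorem add_apply (f g : X ⟶ Y) (e : Occ X.sorts A) : (f + g) A e = f A e + g A e := by
  have h : f + g = entrySum f g := by
    change entrySum (inL X X) (inR X X) ≫ (f ⊗ₘ g) ≫ copair (𝟙 Y) (𝟙 Y) = _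
    simp
  rw [h]
  rfl

/-- The matrix with a single row. -/
def row (s : Multiset (Target Y A)) : ofList [A] ⟶ Y := fun _ e => e.eq_of_single ▸ s

theorem row_apply (s : Multiset (Target Y A)) : row s A (.single A) = s := rfl

theorem row_eq (f : ofList [A] ⟶ Y) : row (f A (.single A)) = f := by
  funext B e
  obtain rfl := e.eq_of_single
  rw [e.eq_single]
  rfl

theorem row_ext {f g : ofList [A] ⟶ Y} (h : f A (.single A) = g A (.single A)) : f = g := by
  rw [← row_eq f, h, row_eq]

theorem row_zero : row (0 : Multiset (Target Y A)) = 0 :=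
  row_ext ((row_apply _).trans (zero_apply _).symm)

theorem row_add (s t : Multiset (Target Y A)) : row (s + t) = row s + row t :=
  row_ext ((row_apply _).trans (add_apply (row s) (row t) (.single A)).symm)

/-- The embedding of a sort as a summand. -/
def pt (e : Occ X.sorts A) : ofList [A] ⟶ X := row {⟨A, e, .nil⟩}

theorem pt_comp (e : Occ X.sorts A) (f : X ⟶ Y) : pt e ≫ f = row (f A e) := by
  refine row_ext ((Multiset.singleton_bind _ _).trans ?_)
  simp only [Quiver.Path.nil_comp]
  exact Multiset.map_id' _

theorem pt_inl (e : Occ X.sorts A) : pt e ≫ inl X Y = pt (occL Y e) := by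
  rw [pt_comp, inl_eq_inL]
  rfl

theorem pt_inr (e : Occ Y.sorts A) : pt e ≫ inr X Y = pt (occR X e) := by
  rw [pt_comp, inr_eq_inR]
  rfl

/-- A path as an arrow between sorts. -/
def pathHom (p : Quiver.Path A B) : ofList [A] ⟶ ofList [B] := row {⟨B, .single B, p⟩}

/-- Every row with one entry factors through a path between sorts, so rows are generated by paths
and injections under addition. -/
theorem pathHom_comp_pt (p : Quiver.Path A B) (e : Occ X.sorts B) :
    pathHom p ≫ pt e = row {⟨B, e, p⟩} := by
  refine row_ext ((Multiset.singleton_bind _ _).trans ?_)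
  exact Multiset.map_singleton _ _

theorem pathHom_comp (p : Quiver.Path A B) (q : Quiver.Path B C) :
    pathHom p ≫ pathHom q = pathHom (p.comp q) := by
  refine row_ext ((Multiset.singleton_bind _ _).trans ?_)
  exact Multiset.map_singleton _ _

variable (Q) in
/-- The embedding of a signature in the matrices over its free category. -/
def unit : Q ⥤q FreeBip Q where
  obj A := ⟨[A]⟩
  map q := pathHom q.toPath

theorem composePath_unit (p : Quiver.Path A B) :
    composePath ((unit Q).mapPath p) = pathHom p := by
  induction p with
  | nil => exact row_ext rfl
  | cons p q ih =>
    rw [Prefunctor.mapPath_cons, composePath_cons, ih]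
    exact pathHom_comp p q.toPath

theorem foldr_unit (l : List Q) :
    l.foldr (fun A X => (unit Q).obj A ⊗ X) (𝟙_ (FreeBip Q)) = ⟨l⟩ := by
  induction l with
  | nil => rfl
  | cons A l ih => rw [List.foldr_cons, ih]; rfl

theorem convSum_pathHom (l : List (Quiver.Path A B)) :
    convSum (l.map fun p => composePath ((unit Q).mapPath p)) =
      row (Y := ofList [B]) ((l : Multiset (Quiver.Path A B)).map fun p => ⟨B, .single B, p⟩) := by
  induction l with
  | nil => exact row_zero.symm
  | cons p l ih =>
    rw [← Multiset.cons_coe, Multiset.map_cons, ← Multiset.singleton_add, row_add, ← ih,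
      ← pathHom, ← composePath_unit]
    rfl

end Unit

end FreeBip

/-- The finite biproduct category of matrices over the free category on a signature. -/
def matObj (Q : Quiv.{u, u}) : FBCat.{u} where
  carrier := FreeBip Q

theorem isMatrixConstruction (Q : Quiv.{u, u}) :
    IsMatrixConstruction (D := matObj Q) (FreeBip.unit Q) where
  obj_bijective := by
    have h : (fun l : List Q => l.foldr (fun A X => (FreeBip.unit Q).obj A ⊗ X)
        (𝟙_ (FreeBip Q))) = FreeBip.ofList := funext FreeBip.foldr_unit
    exact h ▸ ⟨fun _ _ h => congrArg FreeBip.sorts h, fun X => ⟨X.sorts, rfl⟩⟩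
  hom_surjective A B (f : FreeBip.ofList [A] ⟶ FreeBip.ofList [B]) := by
    -- A sum with the single summand `B` can only be reached at `B`, so an entry of the row is just
    -- a path.
    have h (t : FreeBip.Target (FreeBip.ofList [B]) A) :
        ∃ p : Quiver.Path A B, (⟨B, .single B, p⟩ : FreeBip.Target (FreeBip.ofList [B]) A) = t := by
      obtain ⟨B', e, p⟩ := t
      obtain rfl : B' = B := e.eq_of_single
      exact ⟨p, by rw [e.eq_single]⟩
    choose k hk using h
    obtain ⟨l, hl⟩ := Quot.exists_rep ((f A (.single A)).map k)
    refine ⟨l, (FreeBip.convSum_pathHom l).trans (FreeBip.row_ext ?_)⟩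
    refine (congrArg (Multiset.map _) hl).trans ?_
    rw [Multiset.map_map]
    exact (Multiset.map_congr rfl fun t _ => hk t).trans (Multiset.map_id _)
  hom_injective A B l l' h := by
    have h' := (FreeBip.convSum_pathHom l).symm.trans (h.trans (FreeBip.convSum_pathHom l'))
    -- A path can be recovered from its entry, so equal rows have equal multisets of paths, that is,
    -- lists equal up to permutation.
    refine Multiset.coe_eq_coe.1 (Multiset.map_injective ?_ (congrFun (congrFun h' A) (.single A)))
    intro p p' hp
    cases hp
    rfl

/-! ## The universal property of the matrix construction -/

section Aux

section

variable {C D : Type u} [Category.{u} C] [Category.{u} D]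

theorem eqToHom_eq_associator_inv [MonoidalCategory C] [Strict C] (X Y Z : C) (h : X ⊗ (Y ⊗ Z) = (X ⊗ Y) ⊗ Z) :
    eqToHom h = (α_ X Y Z).inv := by
  rw [← cancel_mono (α_ X Y Z).hom, Iso.inv_hom_id, Strict.associator_eq]
  simp

theorem map_composePath {V : Type u} [Quiver.{u} V] (F : V ⥤q C) (G : C ⥤ D) {a b : V}
    (p : Quiver.Path a b) :
    composePath ((F ⋙q G.toPrefunctor).mapPath p) = G.map (composePath (F.mapPath p)) := by
  induction p with
  | nil => exact (G.map_id _).symm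
  | cons p q ih =>
    rw [Prefunctor.mapPath_cons, Prefunctor.mapPath_cons, composePath_cons, composePath_cons,
      G.map_comp, ← ih]
    rfl

theorem prefunctor_ext {V : Type u} [Quiver.{u} V] {F G : V ⥤q C} (h : ∀ a, F.obj a = G.obj a)
    (h' : ∀ {a b} (q : a ⟶ b), F.map q = eqToHom (h a) ≫ G.map q ≫ eqToHom (h b).symm) : F = G := by
  obtain ⟨o, m⟩ := F
  obtain ⟨o', m'⟩ := G
  obtain rfl : o = o' := funext h
  congr 1
  funext a b q
  exact (h' q).trans ((Category.id_comp _).trans (Category.comp_id _))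

end

variable {C D : Type u} [Category.{u} C] [Category.{u} D]
  [MonoidalCategory C] [MonoidalCategory D] [SymmetricCategory C] [SymmetricCategory D]
  [FinBiproduct C] [FinBiproduct D]

theorem comp_multiset_sum {X Y Z : C} (f : X ⟶ Y) (s : Multiset (Y ⟶ Z)) :
    f ≫ s.sum = (s.map (f ≫ ·)).sum := by
  induction s using Multiset.induction with
  | empty => exact comp_zero' f
  | cons g s ih => rw [Multiset.sum_cons, comp_add', ih, Multiset.map_cons, Multiset.sum_cons]

theorem multiset_sum_comp {X Y Z : C} (s : Multiset (X ⟶ Y)) (g : Y ⟶ Z) :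
    s.sum ≫ g = (s.map (· ≫ g)).sum := by
  induction s using Multiset.induction with
  | empty => exact zero_comp' g
  | cons f s ih => rw [Multiset.sum_cons, add_comp', ih, Multiset.map_cons, Multiset.sum_cons]

theorem inl_eqToHom (X : C) {Y Y' : C} (h : Y = Y') :
    inl X Y ≫ eqToHom (congrArg (X ⊗ ·) h) = inl X Y' := by
  subst h
  exact Category.comp_id _

theorem inr_eqToHom (X : C) {Y Y' : C} (h : Y = Y') :
    inr X Y ≫ eqToHom (congrArg (X ⊗ ·) h) = eqToHom h ≫ inr X Y' := by
  subst h
  exact (Category.comp_id _).trans (Category.id_comp _).symm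

/-- A functor compatible with injections and convolution is a morphism of finite biproduct
categories. -/
theorem isFB_of_map_add {F : C ⥤ D} (h₀ : F.obj (𝟙_ C) = 𝟙_ D)
    (h : ∀ X Y : C, F.obj (X ⊗ Y) = F.obj X ⊗ F.obj Y)
    (hl : ∀ X Y, F.map (inl X Y) = inl _ _ ≫ eqToHom (h X Y).symm)
    (hr : ∀ X Y, F.map (inr X Y) = inr _ _ ≫ eqToHom (h X Y).symm)
    (hz : ∀ X Y, F.map (0 : X ⟶ Y) = 0)
    (ha : ∀ {X Y} (f g : X ⟶ Y), F.map (f + g) = F.map f + F.map g) : IsFB F := by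
  have hl' (X Y) : inl _ _ = F.map (inl X Y) ≫ eqToHom (h X Y) := by simp [hl]
  have hr' (X Y) : inr _ _ = F.map (inr X Y) ≫ eqToHom (h X Y) := by simp [hr]
  -- The images of the injections are injections up to casts, hence jointly epic; this lets arrows
  -- out of the image of a sum be compared on summands.
  have ext {X Y Z} {f g : F.obj (X ⊗ Y) ⟶ Z}
      (h₁ : F.map (inl X Y) ≫ f = F.map (inl X Y) ≫ g)
      (h₂ : F.map (inr X Y) ≫ f = F.map (inr X Y) ≫ g) : f = g := by
    have : eqToHom (h X Y).symm ≫ f = eqToHom (h X Y).symm ≫ g :=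
      desc_ext (by simpa [hl] using h₁) (by simpa [hr] using h₂)
    exact (cancel_epi _).1 this
  refine ⟨⟨h₀, h, fun f g => ext ?_ ?_, fun X Y => ext ?_ ?_⟩, fun X => ext ?_ ?_, fun X => ?_,
    fun X => ?_, fun X => ?_⟩
  · rw [← F.map_comp, inl_tensor, F.map_comp, hl, hl]
    simp
  · rw [← F.map_comp, inr_tensor, F.map_comp, hr, hr]
    simp
  · rw [← F.map_comp, inl_braiding, hr, hl]
    simp
  · rw [← F.map_comp, inr_braiding, hl, hr]
    simp
  · rw [← F.map_comp, codiag_eq, inl_desc, F.map_id, hl]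
    simp
  · rw [← F.map_comp, codiag_eq, inr_desc, F.map_id, hr]
    simp
  · simp [hz]
  · rw [diag_eq, lift_eq_add, Category.id_comp, Category.id_comp, ha, hl, hr, diag_eq, lift_eq_add]
    simp
  · simp [hz]

theorem inr_unit_eq_eqToHom [Strict C] (X : C) (h : X = 𝟙_ C ⊗ X) :
    inr (𝟙_ C) X = eqToHom h := by
  rw [← leftUnitor_inv_eq, ← cancel_mono (λ_ X).hom, Iso.inv_hom_id, Strict.leftUnitor_eq]
  simp

theorem inl_unit_eq_eqToHom [Strict C] (X : C) (h : X = X ⊗ 𝟙_ C) :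
    inl X (𝟙_ C) = eqToHom h := by
  rw [← rightUnitor_inv_eq, ← cancel_mono (ρ_ X).hom, Iso.inv_hom_id, Strict.rightUnitor_eq]
  simp

/-- With the next two lemmas, this is the inductive step for identifying the value of a
concatenation with the sum of the values. Substituting the equality of the tails leaves the inverse
associator. -/
theorem inl_assoc_eqToHom [Strict C] {X Y Z W : C} (h : Y = Z ⊗ W) (h' : X ⊗ Y = (X ⊗ Z) ⊗ W) :
    inl X Y ≫ eqToHom h' = inl X Z ≫ inl (X ⊗ Z) W := by
  subst h
  rw [eqToHom_eq_associator_inv, inl_associator_inv]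

theorem inl_inr_assoc_eqToHom [Strict C] {U X Y Z W : C} (h : Y = Z ⊗ W)
    (h' : X ⊗ Y = (X ⊗ Z) ⊗ W) {f : U ⟶ Y} {g : U ⟶ Z} (hf : f ≫ eqToHom h = g ≫ inl Z W) :
    (f ≫ inr X Y) ≫ eqToHom h' = (g ≫ inr X Z) ≫ inl (X ⊗ Z) W := by
  subst h
  rw [eqToHom_refl, Category.comp_id] at hf
  simp only [eqToHom_eq_associator_inv, hf, Category.assoc, inl_inr_associator_inv]

theorem inr_inr_assoc_eqToHom [Strict C] {U X Y Z W : C} (h : Y = Z ⊗ W)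
    (h' : X ⊗ Y = (X ⊗ Z) ⊗ W) {f : U ⟶ Y} {g : U ⟶ W} (hf : f ≫ eqToHom h = g ≫ inr Z W) :
    (f ≫ inr X Y) ≫ eqToHom h' = g ≫ inr (X ⊗ Z) W := by
  subst h
  rw [eqToHom_refl, Category.comp_id] at hf
  simp only [eqToHom_eq_associator_inv, hf, Category.assoc, inr_inr_associator_inv]

end Aux

namespace Occ

variable {Q : Type u} {A B : Q} {l : List Q}

/-- The first occurrence in a nonempty list. -/
def head (B : Q) (l : List Q) : Occ (B :: l) B := ⟨0, rfl⟩

/-- An occurrence in the tail of a list. -/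
def tail (B : Q) (e : Occ l A) : Occ (B :: l) A := ⟨e.1 + 1, e.2⟩

theorem cons_cases {motive : ∀ A, Occ (B :: l) A → Prop} (head : motive B (head B l))
    (tail : ∀ A (e : Occ l A), motive A (e.tail B)) (e : Occ (B :: l) A) : motive A e := by
  obtain ⟨i, h⟩ := e
  cases i with
  | zero =>
    obtain rfl : B = A := Option.some.inj h
    exact head
  | succ i => exact tail A ⟨i, h⟩

end Occ

namespace FreeBip

/-! ### Extension of a signature morphism to matrices -/

section Lift

variable {Q : Type u} [Quiver.{u} Q] {D : Type u} [Category.{u} D] [MonoidalCategory D]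
  (F : Q ⥤q D)

/-- The value of a formal sum. -/
def liftObj (l : List Q) : D := l.foldr (fun A X => F.obj A ⊗ X) (𝟙_ D)

theorem liftObj_append [Strict D] (l m : List Q) : liftObj F (l ++ m) = liftObj F l ⊗ liftObj F m := by
  induction l with
  | nil => exact (Strict.unit_obj _).symm
  | cons A l ih => exact (congrArg (F.obj A ⊗ ·) ih).trans (Strict.assoc_obj _ _ _).symm

variable [SymmetricCategory D] [FinBiproduct D]

/-- The injections of the value of a formal sum. -/
def inj : ∀ (l : List Q) {A : Q}, Occ l A → (F.obj A ⟶ liftObj F l)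
  | [], _, _ => 0
  | _ :: _, _, ⟨0, h⟩ => eqToHom (congrArg F.obj (Option.some.inj h)).symm ≫ inl _ _
  | _ :: l, _, ⟨i + 1, h⟩ => inj l ⟨i, h⟩ ≫ inr _ _

theorem inj_head (A : Q) (l : List Q) :
    inj F (A :: l) (.head A l) = inl (F.obj A) (liftObj F l) := Category.id_comp _

theorem inj_tail (B : Q) {A : Q} {l : List Q} (e : Occ l A) :
    inj F (B :: l) (e.tail B) = inj F l e ≫ inr (F.obj B) (liftObj F l) := rfl

/-- The arrow from the value of a formal sum given by its components. -/
def descList {Z : D} : ∀ l : List Q, (∀ A, Occ l A → (F.obj A ⟶ Z)) → (liftObj F l ⟶ Z)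
  | [], _ => 0
  | A :: l, k => desc (k A (.head A l)) (descList l fun B e => k B (e.tail A))

@[simp]
theorem inj_descList {Z : D} {l : List Q} (k : ∀ A, Occ l A → (F.obj A ⟶ Z)) {A : Q}
    (e : Occ l A) : inj F l e ≫ descList F l k = k A e := by
  induction l with
  | nil => exact e.nil_elim
  | cons B l ih =>
    induction e using Occ.cons_cases with
    | head => exact (congrArg (· ≫ descList F (B :: l) k) (inj_head F B l)).trans (inl_desc _ _)
    | tail A e =>
      exact (Category.assoc (inj F l e) (inr _ _) (desc _ _)).trans
        ((congrArg (inj F l e ≫ ·) (inr_desc _ _)).trans (ih _ e))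

variable {F} in
theorem inj_ext {Z : D} {l : List Q} {f g : liftObj F l ⟶ Z}
    (h : ∀ A (e : Occ l A), inj F l e ≫ f = inj F l e ≫ g) : f = g := by
  induction l with
  | nil => exact from_unit_unique _ _
  | cons B l ih =>
    refine desc_ext ?_ (ih fun A e => ?_)
    · have := h B (.head B l)
      rwa [inj_head] at this
    · have := h A (e.tail B)
      exact (Category.assoc (inj F l e) (inr (F.obj B) (liftObj F l)) f).symm.trans
        (this.trans (Category.assoc (inj F l e) (inr (F.obj B) (liftObj F l)) g))

/-- The value of an entry of a matrix. -/
def entry (X : FreeBip Q) {A : Q} (t : Target X A) : F.obj A ⟶ liftObj F X.sorts :=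
  composePath (F.mapPath t.2.2) ≫ inj F X.sorts t.2.1

/-- The value of a matrix. -/
def liftMap {X Y : FreeBip Q} (f : X ⟶ Y) : liftObj F X.sorts ⟶ liftObj F Y.sorts :=
  descList F X.sorts fun A e => ((f A e).map (entry F Y)).sum

@[simp]
theorem inj_liftMap {X Y : FreeBip Q} (f : X ⟶ Y) {A : Q} (e : Occ X.sorts A) :
    inj F X.sorts e ≫ liftMap F f = ((f A e).map (entry F Y)).sum := inj_descList F _ e

theorem inj_embed {X Y : FreeBip Q} (φ : ∀ A, Occ X.sorts A → Occ Y.sorts A) {A : Q}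
    (e : Occ X.sorts A) : inj F X.sorts e ≫ liftMap F (embed φ) = inj F Y.sorts (φ A e) := by
  rw [inj_liftMap]
  refine (congrArg Multiset.sum (Multiset.map_singleton _ _)).trans ?_
  exact (Multiset.sum_singleton _).trans (Category.id_comp _)

/-- This is functoriality for a single entry: its path is prolonged by every entry in the row where
it ends. -/
theorem entry_comp {X Y : FreeBip Q} {A : Q} (t : Target X A) (f : X ⟶ Y) :
    entry F X t ≫ liftMap F f =
      ((f t.1 t.2.1).map fun s => entry F Y ⟨s.1, s.2.1, t.2.2.comp s.2.2⟩).sum := by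
  rw [entry, Category.assoc, inj_liftMap, comp_multiset_sum, Multiset.map_map]
  refine congrArg Multiset.sum (Multiset.map_congr rfl fun s _ => ?_)
  simp [entry]

/-- The functor on matrices induced by a morphism of signatures. -/
def liftFunctor : FreeBip Q ⥤ D where
  obj X := liftObj F X.sorts
  map f := liftMap F f
  map_id X := inj_ext fun A e => (inj_embed F (X := X) (Y := X) (fun _ e => e) e).trans
    (Category.comp_id _).symm
  map_comp {X Y Z} f g := inj_ext fun A e => by
    -- Composition distributes over finite sums, so the `bind` defining the product of matrices
    -- becomes a sum of the contributions of single entries.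
    rw [← Category.assoc, inj_liftMap, inj_liftMap, multiset_sum_comp, comp_apply,
      Multiset.map_bind, Multiset.sum_bind, Multiset.map_map]
    refine congrArg Multiset.sum (Multiset.map_congr rfl fun t _ => ?_)
    rw [Function.comp_apply, entry_comp, Multiset.map_map]
    rfl

theorem liftMap_zero (X Y : FreeBip Q) : liftMap F (0 : X ⟶ Y) = 0 := by
  refine inj_ext fun A e => ?_
  rw [inj_liftMap, zero_apply, comp_zero']
  rfl

theorem liftMap_add {X Y : FreeBip Q} (f g : X ⟶ Y) :
    liftMap F (f + g) = liftMap F f + liftMap F g := by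
  refine inj_ext fun A e => ?_
  rw [inj_liftMap, add_apply, Multiset.map_add, Multiset.sum_add, comp_add', inj_liftMap,
    inj_liftMap]

variable [Strict D]

theorem inj_left {l : List Q} (m : List Q) {A : Q} (e : Occ l A) :
    inj F (l ++ m) (e.left m) ≫ eqToHom (liftObj_append F l m) = inj F l e ≫ inl _ _ := by
  induction l with
  | nil => exact e.nil_elim
  | cons B l ih =>
    induction e using Occ.cons_cases with
    | head =>
      exact (congrArg (· ≫ eqToHom _) (inj_head F B (l ++ m))).trans
        ((inl_assoc_eqToHom (liftObj_append F l m) _).trans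
          (congrArg (· ≫ inl _ _) (inj_head F B l).symm))
    | tail A e => exact inl_inr_assoc_eqToHom (liftObj_append F l m) _ (ih e)

theorem inj_right (l : List Q) {m : List Q} {A : Q} (e : Occ m A) :
    inj F (l ++ m) (e.right l) ≫ eqToHom (liftObj_append F l m) = inj F m e ≫ inr _ _ := by
  induction l with
  | nil =>
    have h : e.right [] = e := Occ.ext (Nat.zero_add _)
    rw [h]
    exact congrArg (inj F m e ≫ ·) (inr_unit_eq_eqToHom _ _).symm
  | cons B l ih =>
    have h : e.right (B :: l) = (e.right l).tail B := Occ.ext (Nat.add_right_comm _ _ _)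
    rw [h]
    exact inr_inr_assoc_eqToHom (liftObj_append F l m) _ ih

theorem liftMap_inL (X Y : FreeBip Q) (h : liftObj F (X ⊗ Y).sorts = _ ⊗ _) :
    liftMap F (inL X Y) = inl (liftObj F X.sorts) (liftObj F Y.sorts) ≫ eqToHom h.symm := by
  refine inj_ext fun A e => ?_
  have h' : inj F (X ⊗ Y).sorts (occL Y e) ≫ eqToHom h = inj F X.sorts e ≫ inl _ _ :=
    inj_left F Y.sorts e
  rw [← Category.assoc, ← h', Category.assoc, eqToHom_trans, eqToHom_refl, Category.comp_id]
  exact inj_embed F (X := X) (Y := X ⊗ Y) _ e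

theorem liftMap_inR (X Y : FreeBip Q) (h : liftObj F (X ⊗ Y).sorts = _ ⊗ _) :
    liftMap F (inR X Y) = inr (liftObj F X.sorts) (liftObj F Y.sorts) ≫ eqToHom h.symm := by
  refine inj_ext fun A e => ?_
  have h' : inj F (X ⊗ Y).sorts (occR X e) ≫ eqToHom h = inj F Y.sorts e ≫ inr _ _ :=
    inj_right F X.sorts e
  rw [← Category.assoc, ← h', Category.assoc, eqToHom_trans, eqToHom_refl, Category.comp_id]
  exact inj_embed F (X := Y) (Y := X ⊗ Y) _ e

theorem isFB_liftFunctor : IsFB (liftFunctor F) :=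
  isFB_of_map_add rfl (fun X Y => liftObj_append F X.sorts Y.sorts)
    (fun X Y => (congrArg (liftMap F) (inl_eq_inL X Y)).trans
      (liftMap_inL F X Y (liftObj_append F X.sorts Y.sorts)))
    (fun X Y => (congrArg (liftMap F) (inr_eq_inR X Y)).trans
      (liftMap_inR F X Y (liftObj_append F X.sorts Y.sorts)))
    (liftMap_zero F) (liftMap_add F)

theorem inj_single (A : Q) (h : F.obj A = liftObj F [A]) : inj F [A] (.single A) = eqToHom h :=
  (inj_head F A []).trans (inl_unit_eq_eqToHom _ _)

theorem liftMap_pathHom {A B : Q} (p : Quiver.Path A B) (hA : liftObj F (ofList [A]).sorts = F.obj A)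
    (hB : F.obj B = liftObj F (ofList [B]).sorts) :
    liftMap F (pathHom p) = eqToHom hA ≫ composePath (F.mapPath p) ≫ eqToHom hB := by
  have h : inj F (ofList [A]).sorts (.single A) ≫ liftMap F (pathHom p) =
      composePath (F.mapPath p) ≫ inj F (ofList [B]).sorts (.single B) := by
    rw [inj_liftMap]
    exact (congrArg Multiset.sum (Multiset.map_singleton _ _)).trans (Multiset.sum_singleton _)
  rw [← inj_single F B hB, ← h, inj_single F A hA.symm, ← Category.assoc, eqToHom_trans,
    eqToHom_refl, Category.id_comp]

/-- The value of a one-element sum is `F.obj A ⊗ 𝟙_ D`, which strictness identifies with `F.obj A`;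
the equality on arrows therefore holds up to casts, as `prefunctor_ext` allows. -/
theorem unit_liftFunctor : unit Q ⋙q (liftFunctor F).toPrefunctor = F :=
  prefunctor_ext (fun A => Strict.obj_unit (F.obj A)) fun {A B} q => by
    refine (liftMap_pathHom F q.toPath (Strict.obj_unit _) (Strict.obj_unit _).symm).trans ?_
    rw [Quiver.Hom.toPath, Prefunctor.mapPath_cons, composePath_cons, Prefunctor.mapPath_nil,
      composePath_nil, Category.id_comp]
    rfl

end Lift

/-! ### Uniqueness of the extension -/

section Uniqueness

variable {Q : Type u} [Quiver.{u} Q] {D : Type u} [Category.{u} D] [MonoidalCategory D]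
  [SymmetricCategory D] [FinBiproduct D] {G : FreeBip Q ⥤ D}

theorem liftObj_unit (hG : IsFB G) (l : List Q) :
    liftObj (unit Q ⋙q G.toPrefunctor) l = G.obj ⟨l⟩ := by
  induction l with
  | nil => exact hG.obj_zero.symm
  | cons A l ih => exact (congrArg (G.obj ⟨[A]⟩ ⊗ ·) ih).trans (hG.obj_sum ⟨[A]⟩ ⟨l⟩).symm

theorem pt_head (A : Q) (l : List Q) :
    pt (X := ⟨A :: l⟩) (.head A l) = inl (ofList [A]) (ofList l) :=
  (pt_inl (Y := ⟨l⟩) (X := ⟨[A]⟩) (.single A)).symm.trans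
    ((congrArg (· ≫ inl _ _) (row_ext rfl : pt (X := ⟨[A]⟩) (.single A) = 𝟙 _)).trans
      (Category.id_comp _))

theorem pt_tail (B : Q) {A : Q} {l : List Q} (e : Occ l A) :
    pt (X := ⟨B :: l⟩) (e.tail B) = pt (X := ⟨l⟩) e ≫ inr (ofList [B]) (ofList l) := by
  rw [pt_inr]
  exact congrArg (fun e' => pt (X := ⟨B :: l⟩) e') (Occ.ext (Nat.add_comm _ _))

/-- By induction on the list: each inclusion of a sort is a composite of binary injections
(`pt_head`, `pt_tail`), and `G` preserves these. -/
theorem inj_unit (hG : IsFB G) {l : List Q} {A : Q} (e : Occ l A) :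
    inj (unit Q ⋙q G.toPrefunctor) l e ≫ eqToHom (liftObj_unit hG l) =
      G.map (pt (X := ⟨l⟩) e) := by
  induction l with
  | nil => exact e.nil_elim
  | cons B l ih =>
    have h : eqToHom (liftObj_unit hG (B :: l)) =
        eqToHom (congrArg (G.obj ⟨[B]⟩ ⊗ ·) (liftObj_unit hG l)) ≫
          eqToHom (hG.obj_sum ⟨[B]⟩ ⟨l⟩).symm := (eqToHom_trans _ _).symm
    induction e using Occ.cons_cases with
    | head =>
      have h₁ : inl (G.obj ⟨[B]⟩) (liftObj (unit Q ⋙q G.toPrefunctor) l) ≫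
          eqToHom (congrArg (G.obj ⟨[B]⟩ ⊗ ·) (liftObj_unit hG l)) ≫
            eqToHom (hG.obj_sum ⟨[B]⟩ ⟨l⟩).symm = G.map (inl (ofList [B]) (ofList l)) := by
        rw [hG.map_inl, ← inl_eqToHom _ (liftObj_unit hG l), Category.assoc]
      refine (congrArg (inj _ (B :: l) (.head B l) ≫ ·) h).trans ?_
      refine Eq.trans ?_ (h₁.trans (congrArg (G.map ·) (pt_head B l).symm))
      exact congrArg (· ≫ _) (inj_head _ B l)
    | tail A e =>
      have h₁ : inr (G.obj ⟨[B]⟩) (liftObj (unit Q ⋙q G.toPrefunctor) l) ≫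
          eqToHom (congrArg (G.obj ⟨[B]⟩ ⊗ ·) (liftObj_unit hG l)) ≫
            eqToHom (hG.obj_sum ⟨[B]⟩ ⟨l⟩).symm =
              eqToHom (liftObj_unit hG l) ≫ G.map (inr (ofList [B]) (ofList l)) := by
        rw [hG.map_inr, ← Category.assoc, inr_eqToHom _ (liftObj_unit hG l), Category.assoc]
      have h₂ := (congrArg (G.map ·) (pt_tail B e)).trans (G.map_comp (pt (X := ofList l) e) _)
      refine Eq.trans ?_ h₂.symm
      refine (congrArg (inj _ (B :: l) (e.tail B) ≫ ·) h).trans ?_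
      refine (Category.assoc (inj (unit Q ⋙q G.toPrefunctor) l e) (inr _ _) _).trans ?_
      refine (congrArg (inj (unit Q ⋙q G.toPrefunctor) l e ≫ ·) h₁).trans ?_
      rw [← ih]
      exact (Category.assoc (inj (unit Q ⋙q G.toPrefunctor) l e) _ _).symm

theorem inj_sorts (hG : IsFB G) {X : FreeBip Q} {A : Q} (e : Occ X.sorts A)
    (h : liftObj (unit Q ⋙q G.toPrefunctor) X.sorts = G.obj X) :
    inj (unit Q ⋙q G.toPrefunctor) X.sorts e ≫ eqToHom h = G.map (pt e) := inj_unit hG e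

theorem map_row_singleton (hG : IsFB G) {Y : FreeBip Q} {A : Q} (t : Target Y A)
    (h : liftObj (unit Q ⋙q G.toPrefunctor) Y.sorts = G.obj Y) :
    G.map (row {t}) = entry (unit Q ⋙q G.toPrefunctor) Y t ≫ eqToHom h := by
  have hp : composePath ((unit Q ⋙q G.toPrefunctor).mapPath t.2.2) = G.map (pathHom t.2.2) :=
    (map_composePath _ G _).trans (congrArg (G.map ·) (composePath_unit _))
  rw [← pathHom_comp_pt, G.map_comp, ← inj_sorts hG _ h, ← hp]
  exact (Category.assoc (composePath _) (inj _ Y.sorts t.2.1) (eqToHom h)).symm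

/-- Since `G` preserves zero and addition, induction on the multiset reduces to a single entry,
which is fixed by the values of `G` on generators. -/
theorem map_row (hG : IsFB G) {Y : FreeBip Q} {A : Q} (s : Multiset (Target Y A))
    (h : liftObj (unit Q ⋙q G.toPrefunctor) Y.sorts = G.obj Y) :
    G.map (row s) = (s.map (entry (unit Q ⋙q G.toPrefunctor) Y)).sum ≫ eqToHom h := by
  induction s using Multiset.induction with
  | empty => rw [row_zero, hG.map_zero]; exact (zero_comp' _).symm
  | cons t s ih =>
    rw [← Multiset.singleton_add, row_add, hG.map_add, ih, Multiset.map_add, Multiset.sum_add,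
      add_comp', Multiset.map_singleton, Multiset.sum_singleton, map_row_singleton hG t h]
    rfl

theorem liftMap_unit (hG : IsFB G) {X Y : FreeBip Q} (f : X ⟶ Y)
    (hX : liftObj (unit Q ⋙q G.toPrefunctor) X.sorts = G.obj X)
    (hY : liftObj (unit Q ⋙q G.toPrefunctor) Y.sorts = G.obj Y) :
    liftMap (unit Q ⋙q G.toPrefunctor) f ≫ eqToHom hY = eqToHom hX ≫ G.map f := by
  refine inj_ext fun A e => ?_
  have h : G.map (pt e) ≫ G.map f = _ := (G.map_comp _ _).symm.trans
    ((congrArg (G.map ·) (pt_comp e f)).trans (map_row hG (f A e) hY))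
  rw [← Category.assoc, inj_liftMap, ← h, ← inj_sorts hG e hX]
  exact Category.assoc (inj _ X.sorts e) _ _

theorem liftFunctor_unit (hG : IsFB G) : liftFunctor (unit Q ⋙q G.toPrefunctor) = G := by
  have hX (X : FreeBip Q) : liftObj (unit Q ⋙q G.toPrefunctor) X.sorts = G.obj X :=
    liftObj_unit hG X.sorts
  refine CategoryTheory.Functor.ext hX fun X Y f => ?_
  have h : liftMap (unit Q ⋙q G.toPrefunctor) f =
      eqToHom (hX X) ≫ G.map f ≫ eqToHom (hX Y).symm := by
    rw [← Category.assoc, ← liftMap_unit hG f (hX X) (hX Y), Category.assoc, eqToHom_trans,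
      eqToHom_refl, Category.comp_id]
  exact h

end Uniqueness

end FreeBip

/-- The unit of the matrix construction. -/
def matUnit (Q : Quiv.{u, u}) : Q ⟶ FBCat.forget.obj (matObj Q) := FreeBip.unit Q

/-- The extension of a morphism of signatures to matrices. -/
def matLift {Q : Quiv.{u, u}} {D : FBCat.{u}} (F : Q ⥤q D.carrier) : matObj Q ⟶ D where
  functor := FreeBip.liftFunctor F
  isFB := FreeBip.isFB_liftFunctor F

/-- The universal property of the matrix construction. -/
def matEquiv (Q : Quiv.{u, u}) (D : FBCat.{u}) :
    (matObj Q ⟶ D) ≃ (Q ⟶ FBCat.forget.obj D) where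
  toFun G := matUnit Q ≫ FBCat.forget.map G
  invFun F := matLift F
  left_inv G := FBHom.ext (FreeBip.liftFunctor_unit G.isFB)
  right_inv (F : Q ⥤q D.carrier) := FreeBip.unit_liftFunctor F

/-- The matrix construction, as a functor. -/
def matFree : Quiv.{u, u} ⥤ FBCat.{u} :=
  Adjunction.leftAdjointOfEquiv (G := FBCat.forget) matEquiv fun _ _ _ _ _ => rfl

/-- The matrix construction is left adjoint to the forgetful functor. -/
def matAdj : matFree.{u} ⊣ FBCat.forget :=
  Adjunction.adjunctionOfEquivLeft (G := FBCat.forget) matEquiv fun _ _ _ _ _ => rfl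

end FreeKleene

end

theorem theoremG13 :
    ∃ (M : Quiv.{u, u} ⥤ FBCat.{u}) (Qid : FBCat.{u} ⥤ FIBCat.{u})
      (UTr : FIBCat.{u} ⥤ UTFIBCat.{u}) (QK : UTFIBCat.{u} ⥤ KBicat.{u})
      (adjM : M ⊣ FBCat.forget) (adjId : Qid ⊣ FIBCat.forget)
      (adjTr : UTr ⊣ UTFIBCat.forget) (adjK : QK ⊣ KBicat.incl)
      (adj : (M ⋙ Qid ⋙ UTr ⋙ QK) ⊣ KBicat.forget),
      (∀ Q : Quiv.{u, u},
        IsMatrixConstruction (D := M.obj Q) (adjM.unit.app Q)) ∧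
      (∀ C : FBCat.{u},
        IsQuotientFunctor IdCong (FBHom.functor (D := (Qid.obj C).toFBCat) (adjId.unit.app C))) ∧
      (∀ C : FIBCat.{u},
        IsUniformTraceConstruction (D := UTr.obj C) (adjTr.unit.app C)) ∧
      (∀ C : UTFIBCat.{u},
        IsQuotientFunctor KleeneCong
          (UTFIBHom.toFIBHom (D := KBicat.incl.obj (QK.obj C)) (adjK.unit.app C)).functor) ∧
      adj = adjM.comp (adjId.comp (adjTr.comp adjK)) := by
  -- The unit of an adjunction built from a hom-set bijection is the image of the identity, here the
  -- explicit unit followed by an identity functor. The statements about the explicit units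
  -- therefore apply by unfolding definitions.
  exact ⟨matFree, idFree, traceFree, kleeneFree, matAdj, idAdj, traceAdj, kleeneAdj,
    matAdj.comp (idAdj.comp (traceAdj.comp kleeneAdj)), isMatrixConstruction,
    fun C => Quo.isQuotientFunctor (R := idCongruence C.carrier), isUniformTraceConstruction,
    fun C => Quo.isQuotientFunctor (R := kleeneCongruence C.carrier), rfl⟩
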